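/- Let $T_0\subset\mathbb R^3$ be a regular Euclidean tetrahedron with side length $1$, and let $L_0\subset T_0$ be the union of the following ten curves: for each of the four faces, the circle of radius $1/4$ in the plane of the face centered at the barycenter of the face; and for each of the six edges, the intersection with $T_0$ of the circle of radius $1/8$ centered at the midpoint of the edge and contained in the plane orthogonal to the edge. Regard $T_0\smallsetminus L_0$ as a manifold with corners, whose boundary is the union of the four faces of $T_0$ with $L_0$ removed and whose corners lie along the $1$-skeleton of $T_0$. Then there is a complete hyperbolic structure on $T_0\smallsetminus L_0$ of finite volume such that all boundary components are totally geodesic and all dihedral angles at the corners are $\frac{\pi}{2}$. (Here a hyperbolic structure with totally geodesic boundary is a length metric inducing the topology of $T_0\smallsetminus L_0$ for which every point has an open neighborhood isometric to a relatively open subset of an intersection of closed half-spaces of $\mathbb H^3$ in general position, one for each face of $T_0$ through the point, with each such face corresponding to the boundary plane of its half-space.) -/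

import Mathlib

open scoped MeasureTheory ENNReal

/-- Euclidean three-space. -/
abbrev E3 : Type := EuclideanSpace ℝ (Fin 3)

/-! ### Hyperbolic three-space -/

/-- The underlying space `{(x, y, z) | z > 0}` of the upper half-space model of hyperbolic
three-space, with the subspace topology. -/
abbrev UpperHalfSpace : Type := {p : E3 // 0 < p 2}

namespace UpperHalfSpace

/-- The hyperbolic distance: `sinh (d / 2) = |p - q| / (2 √(z_p z_q))`. The subtype's own metric
is the Euclidean one, which is used here only for its topology. -/
noncomputable def hdist (p q : UpperHalfSpace) : ℝ :=
  2 * Real.arsinh (dist p.1 q.1 / (2 * Real.sqrt (p.1 2 * q.1 2)))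

end UpperHalfSpace

/-- A closed hyperbolic half-space `{a (x² + y² + z²) + b x + c y + d ≤ 0}` of the upper half-space
model. The discriminant condition says that the equation `… = 0` defines a hyperbolic plane: a
vertical Euclidean half-plane if `a = 0`, a hemisphere centred on `{z = 0}` if `a ≠ 0`. -/
structure HypHalfSpace where
  a : ℝ
  b : ℝ
  c : ℝ
  d : ℝ
  discr_pos : 4 * a * d < b ^ 2 + c ^ 2

namespace HypHalfSpace

/-- The defining function of a half-space. -/
noncomputable def fn (H : HypHalfSpace) (p : UpperHalfSpace) : ℝ :=
  H.a * (p.1 0 ^ 2 + p.1 1 ^ 2 + p.1 2 ^ 2) + H.b * p.1 0 + H.c * p.1 1 + H.d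

/-- The points of the half-space. -/
def carrier (H : HypHalfSpace) : Set UpperHalfSpace := {p | H.fn p ≤ 0}

/-- The hyperbolic plane bounding the half-space. -/
def boundary (H : HypHalfSpace) : Set UpperHalfSpace := {p | H.fn p = 0}

/-- The Euclidean gradient of the defining function, an outward normal vector of the half-space
at the points of the bounding plane. -/
noncomputable def outwardNormal (H : HypHalfSpace) (p : UpperHalfSpace) : E3 :=
  !₂[2 * H.a * p.1 0 + H.b, 2 * H.a * p.1 1 + H.c, 2 * H.a * p.1 2]

/-- The interior dihedral angle of `H ∩ K` at a common point `p` of the two bounding planes. The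
upper half-space model is conformal, so that hyperbolic and Euclidean angles agree. -/
noncomputable def dihedralAngle (H K : HypHalfSpace) (p : UpperHalfSpace) : ℝ :=
  Real.pi - InnerProductGeometry.angle (H.outwardNormal p) (K.outwardNormal p)

end HypHalfSpace

/-! ### Hyperbolic structures on manifolds with corners -/

/-- A chart at the point `p` of a metric space `X` with boundary faces `F i`, modelled on
hyperbolic three-space with totally geodesic faces: an isometry from an open neighbourhood of `p`
onto a relatively open subset of an intersection of half-spaces in general position, one for each
face through `p`, that takes each such face to the plane bounding its half-space. At a point on no
face the image is an open subset of hyperbolic three-space. -/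
structure GeodesicCornerChart {X : Type*} [MetricSpace X] {ι : Type*} (F : ι → Set X) (p : X) where
  source : Set X
  isOpen_source : IsOpen source
  mem_source : p ∈ source
  toFun : X → UpperHalfSpace
  hdist_eq : ∀ x ∈ source, ∀ y ∈ source, UpperHalfSpace.hdist (toFun x) (toFun y) = dist x y
  /-- The half-space of each of the faces that contain `p`. -/
  side : {i : ι // p ∈ F i} → HypHalfSpace
  linearIndependent : LinearIndependent ℝ fun i => (side i).outwardNormal (toFun p)
  image_eq : ∃ V : Set UpperHalfSpace, IsOpen V ∧ toFun '' source = V ∩ ⋂ i, (side i).carrier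
  mem_face_iff : ∀ x ∈ source, ∀ i : {i : ι // p ∈ F i}, x ∈ F i ↔ toFun x ∈ (side i).boundary
  disjoint_of_notMem : ∀ i, p ∉ F i → Disjoint source (F i)

/-- A hyperbolic structure on the three-manifold with corners `M`, with boundary faces `F i`, for
which all the boundary faces are totally geodesic: a length metric on `M` (given as a metric space
with a homeomorphism to `M`) that is locally isometric to hyperbolic three-space, to a hyperbolic
half-space at the boundary, and to an intersection of two or three half-spaces at the corners. -/
structure GeodesicHyperbolicStructure (M : Type) [TopologicalSpace M] {ι : Type}
    (F : ι → Set M) where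
  X : Type
  [metric : MetricSpace X]
  marking : X ≃ₜ M
  /-- The distance is the infimum of the lengths of paths. -/
  length : ∀ x y : X, ∀ ε : ℝ, 0 < ε →
    ∃ γ : Path x y, eVariationOn γ Set.univ ≤ ENNReal.ofReal (dist x y + ε)
  chartAt : ∀ p : X, GeodesicCornerChart (fun i => marking ⁻¹' F i) p

namespace GeodesicHyperbolicStructure

variable {M : Type} [TopologicalSpace M] {ι : Type} {F : ι → Set M}

/-- The structure is complete if its length metric is. -/
def IsComplete (S : GeodesicHyperbolicStructure M F) : Prop :=
  letI := S.metric
  CompleteSpace S.X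

/-- The hyperbolic volume. It is the three-dimensional Hausdorff measure, with the factor for which
this agrees with Riemannian volume (a Euclidean ball of diameter one has volume `π / 6`, and its
unnormalized Hausdorff measure is one). -/
noncomputable def volume (S : GeodesicHyperbolicStructure M F) : ℝ≥0∞ :=
  letI := S.metric
  letI : MeasurableSpace S.X := borel S.X
  haveI : BorelSpace S.X := ⟨rfl⟩
  ENNReal.ofReal (Real.pi / 6) * μH[3] (Set.univ : Set S.X)

/-- The interior dihedral angle, at the point `p` of `M`, between two faces through `p`. -/
noncomputable def dihedralAngle (S : GeodesicHyperbolicStructure M F) (p : M) (i j : ι)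
    (hi : p ∈ F i) (hj : p ∈ F j) : ℝ :=
  letI := S.metric
  let c := S.chartAt (S.marking.symm p)
  (c.side ⟨i, by simpa using hi⟩).dihedralAngle (c.side ⟨j, by simpa using hj⟩)
    (c.toFun (S.marking.symm p))

end GeodesicHyperbolicStructure

/-! ### The tangle in the regular tetrahedron -/

namespace TetTangle

/-- The vertices of a regular tetrahedron with side length one: alternate vertices of a cube. -/
noncomputable def vertex : Fin 4 → E3 :=
  ![(Real.sqrt 2 / 4) • !₂[1, 1, 1], (Real.sqrt 2 / 4) • !₂[1, -1, -1],
    (Real.sqrt 2 / 4) • !₂[-1, 1, -1], (Real.sqrt 2 / 4) • !₂[-1, -1, 1]]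

/-- The solid tetrahedron `T₀`. -/
def tet : Set E3 := convexHull ℝ (Set.range vertex)

/-- The face opposite the `i`-th vertex. -/
def face (i : Fin 4) : Set E3 := convexHull ℝ (vertex '' {i}ᶜ)

/-- The barycenter of the face opposite the `i`-th vertex. -/
noncomputable def faceCenter (i : Fin 4) : E3 := (1 / 3 : ℝ) • ∑ j ∈ {i}ᶜ, vertex j

/-- The circle of radius `1/4`, in the plane of a face, centered at the barycenter of the face. -/
def faceCircle (i : Fin 4) : Set E3 :=
  {p | p ∈ affineSpan ℝ (vertex '' {i}ᶜ) ∧ dist p (faceCenter i) = 1 / 4}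

/-- The intersection with `T₀` of the circle of radius `1/8` that is centered at the midpoint of an
edge and lies in the plane orthogonal to the edge. -/
def edgeArc (i j : Fin 4) : Set E3 :=
  {p | p ∈ tet ∧ dist p (midpoint ℝ (vertex i) (vertex j)) = 1 / 8 ∧
    inner ℝ (p - midpoint ℝ (vertex i) (vertex j)) (vertex j - vertex i) = 0}

/-- The tangle `L₀`: four circles and six arcs. -/
def tangle : Set E3 := (⋃ i, faceCircle i) ∪ ⋃ (i) (j) (_ : i ≠ j), edgeArc i j

/-- The space `T₀ ∖ L₀`. -/
abbrev Complement : Type := ↥(tet \ tangle)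

/-- The boundary faces of `T₀ ∖ L₀`. -/
def boundaryFace (i : Fin 4) : Set Complement := {x | x.1 ∈ face i}

end TetTangle

/-! ### The metric geometry of the upper half-space -/

/-! The tetrahedron and the tangle are invariant under all permutations of the vertices, so
everything is built over one chamber `l 0 ≤ l 1 ≤ l 2 ≤ l 3` of barycentric coordinates. The chamber
is itself a tetrahedron, with walls a piece of a face (`l 0 = 0`) and three mirrors. The tangle
meets it in two arcs: one divides the piece of the face, the other divides the mirror `l 2 = l 3`.
Counting the divided walls twice turns the chamber into a cube in which the arcs are two skew edges
(`injOn_toCube`, `image_toCube`, `toCube_mem_cubeTangle_iff`).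

The cube without these edges is identified with `polyhedron`, whose six walls are `x = 0`, `x = 1`,
`y = 0`, `y = 3`, `|p|² = (4 - 2√2) x` and `|p|² = 4 y`. Its ideal vertices `0` and `∞` replace the
deleted edges: the two walls along such an edge become tangent at infinity. The mirrors meet at `(1,
3, √2)`, the image of the barycenter, at the angles `π/3`, `π/3`, `π/2` of the tetrahedral
reflection group. The walls coming from the face are orthogonal to the mirrors they meet, except
that `|p|² = (4 - 2√2) x` meets `x = 1` at angle `π/4`; reflecting in `x = 1` doubles this to the
right angle between two faces of the tetrahedron. Hence 24 copies of the polyhedron, glued like the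
chambers, form a hyperbolic manifold with right-angled corners.

The gluing is expressed by a path metric: `fold` maps the complement to the polyhedron, and
`pathDist` minimizes the length of folded paths. Charts are developing maps, which undo the folding
by reflections near a point. Two coordinate systems suffice: `cornerModel`, where the symmetric
group permutes hyperboloid coordinates centered at `(1, 3, √2)`, and `arcModel` for the wall `y =
0`. Folding does not increase distances (the rearrangement inequality, in `cornerModel`), so
geodesics in the developed image lift to paths that are no longer. The image is locally an
intersection of half-spaces (`LocalSides.eventually`), hence convex, and so the developing map is
locally an isometry (`nonempty_localChart`). The half-spaces are pairwise orthogonal, which gives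
the dihedral angles.

Completeness holds because the polyhedron is closed in hyperbolic space and has finitely many
copies. The volume is finite because each copy is covered by two prisms going up to infinity, after
an inversion that moves the ideal vertex `0` to `∞`. -/

namespace UpperHalfSpace

open Real Filter Topology

/-- The squared Euclidean norm of a point. -/
noncomputable def normSq (p : UpperHalfSpace) : ℝ := p.1 0 ^ 2 + p.1 1 ^ 2 + p.1 2 ^ 2

theorem normSq_pos (p : UpperHalfSpace) : 0 < normSq p := by
  have := p.2
  unfold normSq
  positivity

/-- The point with given coordinates, the last of which should be positive. -/
noncomputable def ofCoords (x y z : ℝ) : UpperHalfSpace :=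
  ⟨!₂[x, y, if 0 < z then z else 1], by
    simp only [Fin.isValue, Matrix.cons_val]; split_ifs <;> simp_all⟩

@[simp] theorem ofCoords_zero (x y z : ℝ) : (ofCoords x y z).1 0 = x := by simp [ofCoords]
@[simp] theorem ofCoords_one (x y z : ℝ) : (ofCoords x y z).1 1 = y := by simp [ofCoords]
theorem ofCoords_two (x y : ℝ) {z : ℝ} (hz : 0 < z) : (ofCoords x y z).1 2 = z := by
  simp [ofCoords, hz]

theorem ext_coords {p q : UpperHalfSpace} (h0 : p.1 0 = q.1 0) (h1 : p.1 1 = q.1 1)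
    (h2 : p.1 2 = q.1 2) : p = q := by
  apply Subtype.ext
  ext i
  fin_cases i <;> assumption

theorem ofCoords_eq (p : UpperHalfSpace) : ofCoords (p.1 0) (p.1 1) (p.1 2) = p :=
  ext_coords (by simp) (by simp) (ofCoords_two _ _ p.2)

theorem tendsto_iff_coords {α : Type*} {l : Filter α} {f : α → UpperHalfSpace}
    {p : UpperHalfSpace} : Tendsto f l (𝓝 p) ↔ ∀ i, Tendsto (fun a => (f a).1 i) l (𝓝 (p.1 i)) := by
  rw [tendsto_subtype_rng, (PiLp.homeomorph 2 (fun _ : Fin 3 => ℝ)).isInducing.tendsto_nhds_iff,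
    tendsto_pi_nhds]
  rfl

theorem continuousOn_iff_coords {α : Type*} [TopologicalSpace α] {s : Set α}
    {f : α → UpperHalfSpace} : ContinuousOn f s ↔ ∀ i, ContinuousOn (fun a => (f a).1 i) s := by
  simp only [ContinuousOn, ContinuousWithinAt, tendsto_iff_coords]
  exact ⟨fun h i a ha => h a ha i, fun h a ha i => h i a ha⟩

@[fun_prop] theorem continuous_coord (i : Fin 3) :
    Continuous fun p : UpperHalfSpace => p.1 i := by
  rw [continuous_iff_continuousAt]
  exact fun p => tendsto_iff_coords.1 tendsto_id i

theorem continuousOn_ofCoords {α : Type*} [TopologicalSpace α] {s : Set α} {x y z : α → ℝ}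
    (hx : ContinuousOn x s) (hy : ContinuousOn y s) (hz : ContinuousOn z s)
    (hpos : ∀ a ∈ s, 0 < z a) : ContinuousOn (fun a => ofCoords (x a) (y a) (z a)) s := by
  rw [continuousOn_iff_coords]
  intro i
  fin_cases i
  · simpa using hx
  · simpa using hy
  · exact hz.congr fun a ha => ofCoords_two _ _ (hpos a ha)

@[fun_prop] theorem continuous_normSq : Continuous normSq := by
  unfold normSq
  fun_prop

theorem dist_sq (p q : UpperHalfSpace) : dist p.1 q.1 ^ 2 =
    (p.1 0 - q.1 0) ^ 2 + (p.1 1 - q.1 1) ^ 2 + (p.1 2 - q.1 2) ^ 2 := by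
  rw [EuclideanSpace.dist_eq, Real.sq_sqrt (by positivity), Fin.sum_univ_three]
  simp [Real.dist_eq, sq_abs]

theorem hdist_nonneg (p q : UpperHalfSpace) : 0 ≤ hdist p q := by
  unfold hdist
  have : 0 ≤ arsinh (dist p.1 q.1 / (2 * √(p.1 2 * q.1 2))) := arsinh_nonneg_iff.2 (by positivity)
  linarith

theorem hdist_comm (p q : UpperHalfSpace) : hdist p q = hdist q p := by
  unfold hdist
  rw [dist_comm, mul_comm (p.1 2)]

@[simp] theorem hdist_self (p : UpperHalfSpace) : hdist p p = 0 := by simp [hdist]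

theorem sinh_half_hdist (p q : UpperHalfSpace) :
    sinh (hdist p q / 2) = dist p.1 q.1 / (2 * √(p.1 2 * q.1 2)) := by
  rw [hdist, mul_div_cancel_left₀ _ two_ne_zero, sinh_arsinh]

theorem cosh_hdist_eq_one_add (p q : UpperHalfSpace) :
    cosh (hdist p q) = 1 + dist p.1 q.1 ^ 2 / (2 * p.1 2 * q.1 2) := by
  have hp := p.2
  have hq := q.2
  have h : hdist p q = 2 * (hdist p q / 2) := by ring
  rw [h, cosh_two_mul, cosh_sq, sinh_half_hdist, div_pow, mul_pow, sq_sqrt (by positivity)]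
  field_simp
  ring

theorem cosh_hdist (p q : UpperHalfSpace) : cosh (hdist p q) =
    ((normSq p + normSq q) / 2 - p.1 0 * q.1 0 - p.1 1 * q.1 1) / (p.1 2 * q.1 2) := by
  have hp := p.2
  have hq := q.2
  rw [cosh_hdist_eq_one_add, dist_sq, normSq, normSq]
  field_simp
  ring

theorem hdist_le_iff {p q : UpperHalfSpace} {r : ℝ} (hr : 0 ≤ r) :
    hdist p q ≤ r ↔ cosh (hdist p q) ≤ cosh r := by
  rw [cosh_le_cosh, abs_of_nonneg (hdist_nonneg p q), abs_of_nonneg hr]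

theorem hdist_lt_iff {p q : UpperHalfSpace} {r : ℝ} (hr : 0 ≤ r) :
    hdist p q < r ↔ cosh (hdist p q) < cosh r := by
  rw [cosh_lt_cosh, abs_of_nonneg (hdist_nonneg p q), abs_of_nonneg hr]

theorem hdist_le_hdist_iff {p q p' q' : UpperHalfSpace} :
    hdist p q ≤ hdist p' q' ↔ cosh (hdist p q) ≤ cosh (hdist p' q') :=
  hdist_le_iff (hdist_nonneg _ _)

theorem hdist_eq_hdist_iff {p q p' q' : UpperHalfSpace} :
    hdist p q = hdist p' q' ↔ cosh (hdist p q) = cosh (hdist p' q') := by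
  rw [le_antisymm_iff, le_antisymm_iff, hdist_le_hdist_iff, hdist_le_hdist_iff]

theorem eq_of_hdist_eq_zero {p q : UpperHalfSpace} (h : hdist p q = 0) : p = q := by
  have hp := p.2
  have hq := q.2
  have h1 := sinh_half_hdist p q
  rw [h, zero_div, sinh_zero, eq_comm, div_eq_zero_iff] at h1
  rcases h1 with h1 | h1
  · exact Subtype.ext (dist_eq_zero.1 h1)
  · have : 0 < 2 * √(p.1 2 * q.1 2) := by positivity
    exact absurd h1 this.ne'

/-- Let `c` be the mirror image of `q` below the boundary plane. Then `cosh` of half the distance to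
`q` is a Euclidean distance to `c`, normalized as in `sinh_half_hdist`, and the addition formula for
`sinh` turns the claim into Ptolemy's inequality for `p`, `q`, `r`, `c`. -/
theorem hdist_triangle (p q r : UpperHalfSpace) : hdist p r ≤ hdist p q + hdist q r := by
  have hp := p.2
  have hq := q.2
  have hr := r.2
  let c : E3 := !₂[q.1 0, q.1 1, -q.1 2]
  have cosh_half : ∀ a : UpperHalfSpace,
      cosh (hdist a q / 2) = dist a.1 c / (2 * √(a.1 2 * q.1 2)) := by
    intro a
    have ha := a.2
    have h1 : dist a.1 c ^ 2 = dist a.1 q.1 ^ 2 + 4 * (a.1 2 * q.1 2) := by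
      rw [dist_sq, EuclideanSpace.dist_eq, Real.sq_sqrt (by positivity), Fin.sum_univ_three]
      simp only [Real.dist_eq, sq_abs, c, Fin.isValue, Matrix.cons_val_zero,
        Matrix.cons_val_one, Matrix.cons_val]
      ring
    have h2 : cosh (hdist a q / 2) ^ 2 = (dist a.1 c / (2 * √(a.1 2 * q.1 2))) ^ 2 := by
      rw [cosh_sq, sinh_half_hdist, div_pow, div_pow, mul_pow, sq_sqrt (by positivity), h1]
      field_simp
      ring
    exact (pow_left_inj₀ (cosh_pos _).le (by positivity) two_ne_zero).1 h2
  have hqc : dist q.1 c = 2 * q.1 2 := by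
    have := cosh_half q
    rw [hdist_self, zero_div, cosh_zero, sqrt_mul_self hq.le, eq_comm,
      div_eq_one_iff_eq (by positivity)] at this
    exact this
  have pt := EuclideanGeometry.mul_dist_le_mul_dist_add_mul_dist p.1 q.1 r.1 c
  have key : sinh (hdist p r / 2) ≤ sinh ((hdist p q + hdist q r) / 2) := by
    rw [add_div, sinh_add, sinh_half_hdist, sinh_half_hdist, sinh_half_hdist, cosh_half p,
      hdist_comm q r, cosh_half r, mul_comm (q.1 2) (r.1 2), hqc] at *
    have e1 : √(p.1 2 * r.1 2) = √(p.1 2) * √(r.1 2) := sqrt_mul hp.le _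
    have e2 : √(p.1 2 * q.1 2) = √(p.1 2) * √(q.1 2) := sqrt_mul hp.le _
    have e3 : √(r.1 2 * q.1 2) = √(r.1 2) * √(q.1 2) := sqrt_mul hr.le _
    have hp' := sqrt_pos.2 hp
    have hq' := sqrt_pos.2 hq
    have hr' := sqrt_pos.2 hr
    rw [e1, e2, e3, div_mul_div_comm, div_mul_div_comm]
    have e4 : 2 * (√(p.1 2) * √(q.1 2)) * (2 * (√(r.1 2) * √(q.1 2))) =
        2 * (√(p.1 2) * √(r.1 2)) * (2 * q.1 2) := by
      have e6 := mul_self_sqrt hq.le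
      linear_combination (4 * √(p.1 2) * √(r.1 2)) * e6
    rw [e4, ← add_div, div_le_div_iff₀ (by positivity) (by positivity)]
    have e5 : 0 < 2 * (√(p.1 2) * √(r.1 2)) := by positivity
    nlinarith [mul_le_mul_of_nonneg_left pt e5.le]
  have := sinh_le_sinh.1 key
  linarith

theorem continuous_hdist : Continuous fun x : UpperHalfSpace × UpperHalfSpace =>
    hdist x.1 x.2 := by
  unfold hdist
  refine continuous_const.mul (continuous_arsinh.comp ?_)
  refine Continuous.div (by fun_prop) (by fun_prop) ?_
  intro x
  have h1 := x.1.2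
  have h2 := x.2.2
  positivity

theorem continuousOn_hdist {α : Type*} [TopologicalSpace α] {s : Set α}
    {f g : α → UpperHalfSpace} (hf : ContinuousOn f s) (hg : ContinuousOn g s) :
    ContinuousOn (fun a => hdist (f a) (g a)) s :=
  Continuous.comp_continuousOn (g := fun x : UpperHalfSpace × UpperHalfSpace => hdist x.1 x.2)
    (f := fun a => (f a, g a)) continuous_hdist (hf.prodMk hg)

theorem hdist_le_dist_div {p q : UpperHalfSpace} {c : ℝ} (hc : 0 < c) (hp : c ≤ p.1 2)
    (hq : c ≤ q.1 2) : hdist p q ≤ dist p.1 q.1 / c := by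
  have h1 : c ≤ √(p.1 2 * q.1 2) := le_sqrt_of_sq_le (by nlinarith)
  have h2 : hdist p q / 2 ≤ sinh (hdist p q / 2) :=
    self_le_sinh_iff.2 (by linarith [hdist_nonneg p q])
  rw [sinh_half_hdist] at h2
  have h3 : dist p.1 q.1 / (2 * √(p.1 2 * q.1 2)) ≤ dist p.1 q.1 / (2 * c) := by gcongr
  have h4 : dist p.1 q.1 / (2 * c) = dist p.1 q.1 / c / 2 := by field_simp
  linarith

/-- Bounds on the height of points at bounded distance. -/
theorem height_le (p q : UpperHalfSpace) : p.1 2 ≤ 2 * cosh (hdist p q) * q.1 2 := by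
  have hp := p.2
  have hq := q.2
  have h : cosh (hdist p q) * (2 * p.1 2 * q.1 2) =
      2 * p.1 2 * q.1 2 + ((p.1 0 - q.1 0) ^ 2 + (p.1 1 - q.1 1) ^ 2 + (p.1 2 - q.1 2) ^ 2) := by
    rw [cosh_hdist_eq_one_add, dist_sq]
    field_simp
  have h2 : p.1 2 * p.1 2 ≤ p.1 2 * (2 * cosh (hdist p q) * q.1 2) := by
    nlinarith [sq_nonneg (p.1 0 - q.1 0), sq_nonneg (p.1 1 - q.1 1), sq_nonneg (q.1 2)]
  exact le_of_mul_le_mul_left h2 hp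

theorem dist_le_of_height_le {p q : UpperHalfSpace} {c : ℝ} (hp : p.1 2 ≤ c) (hq : q.1 2 ≤ c) :
    dist p.1 q.1 ≤ 2 * c * sinh (hdist p q / 2) := by
  have hp0 := p.2
  have hq0 := q.2
  rw [sinh_half_hdist]
  have h1 : √(p.1 2 * q.1 2) ≤ c := sqrt_le_iff.2 ⟨by linarith, by nlinarith⟩
  have h2 : 0 < √(p.1 2 * q.1 2) := by positivity
  rw [mul_div_assoc', le_div_iff₀ (by positivity)]
  nlinarith [mul_le_mul_of_nonneg_left h1 (dist_nonneg (x := p.1) (y := q.1))]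

theorem tendsto_hdist_nhds {α : Type*} {l : Filter α} {f : α → UpperHalfSpace}
    {p : UpperHalfSpace} : Tendsto f l (𝓝 p) ↔ Tendsto (fun a => hdist (f a) p) l (𝓝 0) := by
  constructor
  · intro h
    have := (continuous_hdist.tendsto (p, p)).comp (h.prodMk_nhds tendsto_const_nhds)
    simpa [Function.comp_def] using this
  · intro h
    rw [tendsto_subtype_rng, tendsto_iff_dist_tendsto_zero]
    have h1 : Tendsto (fun a => 2 * (2 * cosh 1 * p.1 2) * sinh (hdist (f a) p / 2)) l (𝓝 0) := by
      have : Continuous fun t : ℝ => 2 * (2 * cosh 1 * p.1 2) * sinh (t / 2) := by fun_prop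
      simpa [Function.comp_def] using (this.tendsto 0).comp h
    refine squeeze_zero' (Eventually.of_forall fun a => dist_nonneg) ?_ h1
    filter_upwards [h.eventually (gt_mem_nhds zero_lt_one)] with a ha
    have hp := p.2
    have h1 : 1 ≤ cosh (1 : ℝ) := one_le_cosh 1
    apply dist_le_of_height_le
    · refine (height_le (f a) p).trans ?_
      have : cosh (hdist (f a) p) ≤ cosh 1 := by
        rw [← hdist_le_iff zero_le_one]; exact ha.le
      gcongr
    · nlinarith

theorem hasBasis_nhds (p : UpperHalfSpace) :
    (𝓝 p).HasBasis (fun r : ℝ => 0 < r) fun r => {q | hdist q p < r} := by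
  have : 𝓝 p = comap (fun q => hdist q p) (𝓝 0) := by
    apply le_antisymm
    · exact (tendsto_hdist_nhds.1 tendsto_id).le_comap
    · exact tendsto_hdist_nhds.2 tendsto_comap
  rw [this]
  refine (nhds_basis_abs_sub_lt (0 : ℝ)).comap _ |>.congr (fun _ => Iff.rfl) ?_
  intro r _
  ext q
  simp [abs_of_nonneg (hdist_nonneg q p)]

theorem eventually_nhds {p : UpperHalfSpace} {s : UpperHalfSpace → Prop} :
    (∀ᶠ q in 𝓝 p, s q) ↔ ∃ r > 0, ∀ q, hdist q p < r → s q := by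
  rw [(hasBasis_nhds p).eventually_iff]
  simp

/-- A sequence that is Cauchy for the hyperbolic distance converges. -/
theorem exists_tendsto_of_cauchy {u : ℕ → UpperHalfSpace}
    (hu : ∀ ε > 0, ∃ N, ∀ m ≥ N, ∀ n ≥ N, hdist (u m) (u n) < ε) :
    ∃ p, Tendsto u atTop (𝓝 p) := by
  obtain ⟨N, hN⟩ := hu 1 zero_lt_one
  -- From `N` on, all heights lie between `(u N).1 2 / (2 * cosh 1)` and `c`. The upper bound makes
  -- the sequence Cauchy for the Euclidean distance, the lower one keeps its limit off the boundary
  -- plane.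
  set c := 2 * cosh 1 * (u N).1 2
  have hz := (u N).2
  have hc : 0 < c := by have := cosh_pos (1 : ℝ); positivity
  have hcosh : ∀ n ≥ N, cosh (hdist (u n) (u N)) ≤ cosh 1 := fun n hn => by
    rw [← hdist_le_iff zero_le_one]; exact (hN n hn N le_rfl).le
  have hup : ∀ n ≥ N, (u n).1 2 ≤ c := fun n hn => by
    refine (height_le (u n) (u N)).trans ?_
    exact mul_le_mul_of_nonneg_right (by linarith [hcosh n hn]) hz.le
  have hlow : ∀ n ≥ N, (u N).1 2 / (2 * cosh 1) ≤ (u n).1 2 := fun n hn => by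
    have h1 := height_le (u N) (u n)
    rw [hdist_comm] at h1
    have h2 := hcosh n hn
    have h3 := (u n).2
    rw [div_le_iff₀ (by have := cosh_pos (1 : ℝ); positivity)]
    nlinarith [mul_le_mul_of_nonneg_right h2 h3.le]
  have hE : CauchySeq fun n => (u n).1 := by
    rw [Metric.cauchySeq_iff]
    intro ε hε
    have hcont : Tendsto (fun t : ℝ => 2 * c * sinh (t / 2)) (𝓝 0) (𝓝 0) := by
      have : Continuous fun t : ℝ => 2 * c * sinh (t / 2) := by fun_prop
      simpa using this.tendsto 0
    obtain ⟨δ, hδ, hδ'⟩ := Metric.tendsto_nhds_nhds.1 hcont ε hε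
    obtain ⟨M, hM⟩ := hu δ hδ
    refine ⟨max M N, fun m hm n hn => ?_⟩
    have h1 := hM m (le_of_max_le_left hm) n (le_of_max_le_left hn)
    have h2 := hδ' (x := hdist (u m) (u n))
      (by simpa [Real.dist_eq, abs_of_nonneg (hdist_nonneg _ _)] using h1)
    rw [Real.dist_eq, sub_zero] at h2
    exact (dist_le_of_height_le (hup m (le_of_max_le_right hm))
      (hup n (le_of_max_le_right hn))).trans_lt ((le_abs_self _).trans_lt h2)
  obtain ⟨a, ha⟩ := cauchySeq_tendsto_of_complete hE
  have ha2 : (u N).1 2 / (2 * cosh 1) ≤ a 2 := by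
    have h1 : Tendsto (fun n => (u n).1 2) atTop (𝓝 (a 2)) :=
      ((EuclideanSpace.proj (𝕜 := ℝ) (2 : Fin 3)).continuous.tendsto a).comp ha
    exact ge_of_tendsto h1 (eventually_atTop.2 ⟨N, hlow⟩)
  refine ⟨⟨a, lt_of_lt_of_le ?_ ha2⟩, tendsto_subtype_rng.2 ha⟩
  have := cosh_pos (1 : ℝ)
  positivity

/-! ### Geodesics -/

/-- The point in the direction of a linear combination of `p` and `q` in the hyperboloid model. -/
noncomputable def comb (p q : UpperHalfSpace) (a b : ℝ) : UpperHalfSpace :=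
  ofCoords ((a * (p.1 0 / p.1 2) + b * (q.1 0 / q.1 2)) / (a / p.1 2 + b / q.1 2))
    ((a * (p.1 1 / p.1 2) + b * (q.1 1 / q.1 2)) / (a / p.1 2 + b / q.1 2))
    (1 / (a / p.1 2 + b / q.1 2))

/-- The functions `(α|p|² + βx + γy + δ) / z` are the linear functionals on the hyperboloid model,
and `h` says that the combination lies on the hyperboloid. Linearity is what makes half-spaces and
balls convex. -/
theorem comb_eval {p q : UpperHalfSpace} {a b : ℝ} (hpos : 0 < a / p.1 2 + b / q.1 2)
    (h : a ^ 2 + b ^ 2 + 2 * a * b * cosh (hdist p q) = 1) (α β γ δ : ℝ) :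
    (α * normSq (comb p q a b) + β * (comb p q a b).1 0 + γ * (comb p q a b).1 1 + δ) /
      (comb p q a b).1 2 =
    a * ((α * normSq p + β * p.1 0 + γ * p.1 1 + δ) / p.1 2) +
      b * ((α * normSq q + β * q.1 0 + γ * q.1 1 + δ) / q.1 2) := by
  have hp := p.2
  have hq := q.2
  set w := a / p.1 2 + b / q.1 2 with hw
  have hz : (comb p q a b).1 2 = 1 / w := ofCoords_two _ _ (by positivity)
  have hx : (comb p q a b).1 0 = (a * (p.1 0 / p.1 2) + b * (q.1 0 / q.1 2)) / w := by
    simp [comb, hw]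
  have hy : (comb p q a b).1 1 = (a * (p.1 1 / p.1 2) + b * (q.1 1 / q.1 2)) / w := by
    simp [comb, hw]
  have hn : normSq (comb p q a b) = (a * (normSq p / p.1 2) + b * (normSq q / q.1 2)) / w := by
    have e : normSq (comb p q a b) = ((a * (p.1 0 / p.1 2) + b * (q.1 0 / q.1 2)) ^ 2 +
        (a * (p.1 1 / p.1 2) + b * (q.1 1 / q.1 2)) ^ 2 + 1) / w ^ 2 := by
      rw [normSq, hx, hy, hz]
      field_simp
    rw [e, div_eq_div_iff (by positivity) (by positivity), ← h, cosh_hdist, hw, normSq, normSq]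
    field_simp
    ring
  rw [hx, hy, hz, hn]
  field_simp [hpos.ne']
  rw [hw]
  field_simp
  ring

theorem cosh_hdist_comb {p q : UpperHalfSpace} {a b : ℝ} (hpos : 0 < a / p.1 2 + b / q.1 2)
    (h : a ^ 2 + b ^ 2 + 2 * a * b * cosh (hdist p q) = 1) (k : UpperHalfSpace) :
    cosh (hdist (comb p q a b) k) = a * cosh (hdist p k) + b * cosh (hdist q k) := by
  have hk := k.2
  have key : ∀ u : UpperHalfSpace, cosh (hdist u k) =
      ((1 / 2 / k.1 2) * normSq u + (-k.1 0 / k.1 2) * u.1 0 + (-k.1 1 / k.1 2) * u.1 1 +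
        normSq k / 2 / k.1 2) / u.1 2 := by
    intro u
    have hu := u.2
    rw [cosh_hdist]
    field_simp
    ring
  rw [key, key, key, comb_eval hpos h]

/-- The last two clauses are the convexity of half-spaces and of balls. The geodesic is frozen at
its endpoints outside the interval of its length, so that every clause holds for all real
parameters. -/
theorem exists_geodesic (p q : UpperHalfSpace) : ∃ γ : ℝ → UpperHalfSpace, Continuous γ ∧
    γ 0 = p ∧ γ (hdist p q) = q ∧ (∀ s t, hdist (γ s) (γ t) ≤ |s - t|) ∧
    (∀ t α β c δ, α * normSq p + β * p.1 0 + c * p.1 1 + δ ≤ 0 →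
      α * normSq q + β * q.1 0 + c * q.1 1 + δ ≤ 0 →
      α * normSq (γ t) + β * (γ t).1 0 + c * (γ t).1 1 + δ ≤ 0) ∧
    ∀ t k r, hdist p k < r → hdist q k < r → hdist (γ t) k < r := by
  rcases eq_or_ne p q with rfl | hne
  · exact ⟨fun _ => p, continuous_const, rfl, rfl, by simp, fun _ _ _ _ _ h _ => h,
      fun _ _ _ h _ => h⟩
  set l := hdist p q with hl
  have hl0 : 0 < l := lt_of_le_of_ne (hdist_nonneg p q) fun h => hne (eq_of_hdist_eq_zero h.symm)
  have hS : 0 < sinh l := sinh_pos_iff.2 hl0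
  have hp := p.2
  have hq := q.2
  -- The coefficients of the arc-length parametrization of the hyperboloid geodesic from `p` to `q`.
  let a : ℝ → ℝ := fun t => sinh (l - t) / sinh l
  let b : ℝ → ℝ := fun t => sinh t / sinh l
  have ha : ∀ t ∈ Set.Icc 0 l, 0 ≤ a t := fun t ht =>
    div_nonneg (sinh_nonneg_iff.2 (by linarith [ht.2])) hS.le
  have hb : ∀ t ∈ Set.Icc 0 l, 0 ≤ b t := fun t ht => div_nonneg (sinh_nonneg_iff.2 ht.1) hS.le
  have hsl : ∀ t, sinh (l - t) = sinh l * cosh t - cosh l * sinh t := fun t => sinh_sub l t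
  have hcl : ∀ t, cosh (l - t) = cosh l * cosh t - sinh l * sinh t := fun t => cosh_sub l t
  have hnorm : ∀ t, a t ^ 2 + b t ^ 2 + 2 * a t * b t * cosh (hdist p q) = 1 := by
    intro t
    simp only [a, b, ← hl, hsl]
    field_simp
    linear_combination (sinh l ^ 2) * (cosh_sq t) - (sinh t ^ 2) * (cosh_sq l)
  have hpos : ∀ t ∈ Set.Icc 0 l, 0 < a t / p.1 2 + b t / q.1 2 := by
    intro t ht
    have h1 := ha t ht
    have h2 := hb t ht
    rcases eq_or_lt_of_le h1 with h | h
    · have h3 := hnorm t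
      rw [← h] at h3
      have h4 : 0 < b t := lt_of_le_of_ne h2 fun h5 => by rw [← h5] at h3; norm_num at h3
      rw [← h, zero_div, zero_add]
      positivity
    · positivity
  -- Needed for the convexity of balls: the `cosh` of the distance to `k` is then at most the larger
  -- of its end values.
  have hab : ∀ t ∈ Set.Icc 0 l, a t + b t ≤ 1 := by
    intro t ht
    have h1 := sinh_nonneg_iff.2 ht.1
    have h2 : 0 ≤ sinh (l - t) := sinh_nonneg_iff.2 (by linarith [ht.2])
    have h3 := one_le_cosh t
    have h4 := one_le_cosh (l - t)
    have h5 : sinh l = sinh (l - t) * cosh t + cosh (l - t) * sinh t := by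
      rw [← sinh_add]; ring_nf
    rw [← add_div, div_le_one hS, h5]
    nlinarith
  have hcp : ∀ t ∈ Set.Icc 0 l, ∀ k, cosh (hdist (comb p q (a t) (b t)) k) =
      a t * cosh (hdist p k) + b t * cosh (hdist q k) := fun t ht k =>
    cosh_hdist_comb (hpos t ht) (hnorm t) k
  have hdist_eq : ∀ s ∈ Set.Icc 0 l, ∀ t ∈ Set.Icc 0 l,
      hdist (comb p q (a s) (b s)) (comb p q (a t) (b t)) = |s - t| := by
    intro s hs t ht
    have h1 : cosh (hdist (comb p q (a s) (b s)) (comb p q (a t) (b t))) = cosh (s - t) := by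
      rw [hcp s hs, hdist_comm p, hdist_comm q, hcp t ht, hcp t ht, hdist_self, hdist_self,
        hdist_comm q p, ← hl, cosh_zero, cosh_sub]
      simp only [a, b, hsl]
      field_simp
      linear_combination (-(sinh s * sinh t)) * (cosh_sq l)
    rw [← abs_of_nonneg (hdist_nonneg (comb p q (a s) (b s)) (comb p q (a t) (b t)))]
    exact le_antisymm (cosh_le_cosh.1 h1.le) (cosh_le_cosh.1 h1.ge)
  let clamp : ℝ → ℝ := fun t => max 0 (min l t)
  have hclamp : ∀ t, clamp t ∈ Set.Icc 0 l := fun t =>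
    ⟨le_max_left _ _, max_le hl0.le (min_le_left _ _)⟩
  have hlip : ∀ s t, |clamp s - clamp t| ≤ |s - t| := fun s t =>
    (abs_max_sub_max_le_max _ _ _ _).trans (by
      rw [sub_self, abs_zero, max_eq_right (abs_nonneg _)]
      exact (abs_min_sub_min_le_max _ _ _ _).trans (by simp))
  have hγ : ∀ s t, hdist (comb p q (a (clamp s)) (b (clamp s))) (comb p q (a (clamp t)) (b (clamp t))) ≤ |s - t| :=
    fun s t => (hdist_eq _ (hclamp s) _ (hclamp t)).le.trans (hlip s t)
  refine ⟨fun t => comb p q (a (clamp t)) (b (clamp t)), ?_, ?_, ?_, hγ, ?_, ?_⟩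
  · rw [continuous_iff_continuousAt]
    intro t
    refine tendsto_hdist_nhds.2 (squeeze_zero (fun s => hdist_nonneg _ _) (fun s => hγ s t) ?_)
    have : Continuous fun s : ℝ => |s - t| := by fun_prop
    simpa using this.tendsto t
  · have h0 : clamp 0 = 0 := by simp [clamp, hl0.le]
    apply eq_of_hdist_eq_zero
    have : cosh (hdist (comb p q (a 0) (b 0)) p) = cosh 0 := by
      rw [hcp 0 ⟨le_rfl, hl0.le⟩]
      simp [a, b, hS.ne']
    simp only [h0]
    have h3 := (cosh_le_cosh.1 this.le)
    rw [abs_zero, abs_of_nonneg (hdist_nonneg _ _)] at h3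
    exact le_antisymm h3 (hdist_nonneg _ _)
  · have h0 : clamp l = l := by simp [clamp, hl0.le]
    apply eq_of_hdist_eq_zero
    have : cosh (hdist (comb p q (a l) (b l)) q) = cosh 0 := by
      rw [hcp l ⟨hl0.le, le_rfl⟩]
      simp [a, b, hS.ne']
    simp only [h0]
    have h3 := (cosh_le_cosh.1 this.le)
    rw [abs_zero, abs_of_nonneg (hdist_nonneg _ _)] at h3
    exact le_antisymm h3 (hdist_nonneg _ _)
  · intro t α β c δ h1 h2
    have h3 := comb_eval (hpos _ (hclamp t)) (hnorm (clamp t)) α β c δ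
    have h4 := (comb p q (a (clamp t)) (b (clamp t))).2
    have h5 : a (clamp t) * ((α * normSq p + β * p.1 0 + c * p.1 1 + δ) / p.1 2) ≤ 0 :=
      mul_nonpos_of_nonneg_of_nonpos (ha _ (hclamp t)) (div_nonpos_of_nonpos_of_nonneg h1 hp.le)
    have h6 : b (clamp t) * ((α * normSq q + β * q.1 0 + c * q.1 1 + δ) / q.1 2) ≤ 0 :=
      mul_nonpos_of_nonneg_of_nonpos (hb _ (hclamp t)) (div_nonpos_of_nonpos_of_nonneg h2 hq.le)
    rw [div_eq_iff h4.ne'] at h3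
    rw [h3]
    exact mul_nonpos_of_nonpos_of_nonneg (by linarith) h4.le
  · intro t k r h1 h2
    have hr : 0 ≤ r := (hdist_nonneg p k).trans h1.le
    rw [hdist_lt_iff hr] at h1 h2 ⊢
    rw [hcp _ (hclamp t)]
    have h3 := ha _ (hclamp t)
    have h4 := hb _ (hclamp t)
    have h5 := hab _ (hclamp t)
    have h6 := one_le_cosh r
    have h7 : max (cosh (hdist p k)) (cosh (hdist q k)) < cosh r := max_lt h1 h2
    set M := max (cosh (hdist p k)) (cosh (hdist q k))
    have h8 : cosh (hdist p k) ≤ M := le_max_left _ _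
    have h9 : cosh (hdist q k) ≤ M := le_max_right _ _
    have h10 : 0 ≤ M := (cosh_pos _).le.trans h8
    calc _ ≤ a (clamp t) * M + b (clamp t) * M := by gcongr
      _ = (a (clamp t) + b (clamp t)) * M := by ring
      _ ≤ 1 * M := by gcongr
      _ < _ := by linarith

end UpperHalfSpace

/-! ### A homeomorphism from a tetrahedron with two folded faces to a cube -/

/-- A homogeneous function on the quadrant, increasing in the first variable, that restricts to the
identity on the second axis. -/
structure IsGauge (s : ℝ → ℝ → ℝ) : Prop where
  cont : Continuous fun p : ℝ × ℝ => s p.1 p.2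
  zero : ∀ c, 0 ≤ c → s 0 c = c
  smul : ∀ k a c, 0 ≤ k → s (k * a) (k * c) = k * s a c
  mono : ∀ a a' c, 0 ≤ a → 0 ≤ c → a < a' → s a c < s a' c
  surj : ∀ c b, 0 ≤ c → c ≤ b → ∃ a, 0 ≤ a ∧ s a c = b

namespace IsGauge

variable {s : ℝ → ℝ → ℝ}

theorem le (h : IsGauge s) {a c : ℝ} (ha : 0 ≤ a) (hc : 0 ≤ c) : c ≤ s a c := by
  rcases eq_or_lt_of_le ha with rfl | ha
  · rw [h.zero c hc]
  · exact (h.zero c hc).symm.le.trans (h.mono 0 a c le_rfl hc ha).le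

theorem eq_iff (h : IsGauge s) {a c : ℝ} (ha : 0 ≤ a) (hc : 0 ≤ c) : s a c = c ↔ a = 0 := by
  constructor
  · intro he
    by_contra hne
    have := h.mono 0 a c le_rfl hc (lt_of_le_of_ne ha (Ne.symm hne))
    rw [h.zero c hc] at this
    linarith
  · rintro rfl
    exact h.zero c hc

theorem inj (h : IsGauge s) {a a' c : ℝ} (ha : 0 ≤ a) (ha' : 0 ≤ a') (hc : 0 ≤ c)
    (he : s a c = s a' c) : a = a' := by
  rcases lt_trichotomy a a' with hl | hl | hl
  · exact absurd he (h.mono a a' c ha hc hl).ne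
  · exact hl
  · exact absurd he (h.mono a' a c ha' hc hl).ne'

theorem eq_zero (h : IsGauge s) {a c : ℝ} (ha : 0 ≤ a) (hc : 0 ≤ c) (he : s a c = 0) :
    a = 0 ∧ c = 0 := by
  have h1 := h.le ha hc
  have h2 : c = 0 := by linarith
  exact ⟨(h.eq_iff ha hc).1 (by rw [he, h2]), h2⟩

end IsGauge

/-- The gauge `(√(α a² + β a c + γ c²) - a - c) / (√γ - 1)`. -/
noncomputable def sqrtGauge (α β γ a c : ℝ) : ℝ :=
  (√(α * a ^ 2 + β * a * c + γ * c ^ 2) - a - c) / (√γ - 1)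

/-- The bound `4 * γ < β ^ 2` makes the derivative of the square root with respect to `a` at least
one, and `1 < α` makes the increment strictly larger than that of `a`. Moreover `1 < α` lets the
gauge grow without bound, which gives surjectivity. -/
theorem isGauge_sqrtGauge {α β γ : ℝ} (hα : 1 < α) (hγ : 1 < γ) (hβ : 0 < β)
    (h : 4 * γ < β ^ 2) : IsGauge (sqrtGauge α β γ) := by
  have hg : 0 < √γ - 1 := sub_pos.2 (Real.lt_sqrt_of_sq_lt (by linarith))
  have mono : ∀ a a' c, 0 ≤ a → 0 ≤ c → a < a' → sqrtGauge α β γ a c < sqrtGauge α β γ a' c := by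
    intro a a' c ha hc haa
    unfold sqrtGauge
    rw [div_lt_div_iff_of_pos_right hg]
    set f := α * a ^ 2 + β * a * c + γ * c ^ 2 with hf
    have hf0 : 0 ≤ f := by positivity
    set d := a' - a with hd
    have hd0 : 0 < d := sub_pos.2 haa
    have ha' : a' = a + d := by ring
    have h1 : 2 * √f ≤ 2 * α * a + β * c := by
      have h2 : 2 * √f = √(4 * f) := by
        rw [Real.sqrt_mul (by norm_num), show (4 : ℝ) = 2 ^ 2 by norm_num,
          Real.sqrt_sq (by norm_num)]
      rw [h2, Real.sqrt_le_left (by positivity)]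
      have h3 : 0 ≤ a * c := by positivity
      nlinarith [mul_nonneg (sq_nonneg a) (by nlinarith : 0 ≤ α ^ 2 - α),
        mul_nonneg h3 (by nlinarith : 0 ≤ α * β - β),
        mul_nonneg (sq_nonneg c) (by linarith : 0 ≤ β ^ 2 - 4 * γ)]
    have h4 : √f + d < √(α * a' ^ 2 + β * a' * c + γ * c ^ 2) := by
      apply Real.lt_sqrt_of_sq_lt
      rw [add_sq, Real.sq_sqrt hf0, ha', hf]
      nlinarith [mul_le_mul_of_nonneg_right h1 hd0.le, sq_pos_of_pos hd0,
        mul_pos (sub_pos.2 hα) (sq_pos_of_pos hd0)]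
    linarith
  have zero : ∀ c, 0 ≤ c → sqrtGauge α β γ 0 c = c := by
    intro c hc
    have : √(α * 0 ^ 2 + β * 0 * c + γ * c ^ 2) = √γ * c := by
      rw [show α * 0 ^ 2 + β * 0 * c + γ * c ^ 2 = γ * c ^ 2 by ring, Real.sqrt_mul (by linarith),
        Real.sqrt_sq hc]
    rw [sqrtGauge, this, div_eq_iff hg.ne']
    ring
  have cont : Continuous fun p : ℝ × ℝ => sqrtGauge α β γ p.1 p.2 := by
    unfold sqrtGauge
    fun_prop
  refine ⟨cont, zero, ?_, mono, ?_⟩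
  · intro k a c hk
    have : √(α * (k * a) ^ 2 + β * (k * a) * (k * c) + γ * (k * c) ^ 2) =
        k * √(α * a ^ 2 + β * a * c + γ * c ^ 2) := by
      rw [show α * (k * a) ^ 2 + β * (k * a) * (k * c) + γ * (k * c) ^ 2 =
        k ^ 2 * (α * a ^ 2 + β * a * c + γ * c ^ 2) by ring, Real.sqrt_mul (by positivity),
        Real.sqrt_sq hk]
    rw [sqrtGauge, sqrtGauge, this]
    ring
  · intro c b hc hb
    have hα' : 0 < √α - 1 := sub_pos.2 (Real.lt_sqrt_of_sq_lt (by linarith))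
    -- Chosen so that replacing the square root by its lower bound `√α * a₁` gives exactly the value
    -- `b`.
    set a₁ := (b * (√γ - 1) + c) / (√α - 1) with ha₁
    have hb0 : 0 ≤ b := hc.trans hb
    have h1 : 0 ≤ a₁ := by positivity
    have h2 : b ≤ sqrtGauge α β γ a₁ c := by
      rw [sqrtGauge, le_div_iff₀ hg]
      have h3 : √α * a₁ ≤ √(α * a₁ ^ 2 + β * a₁ * c + γ * c ^ 2) := by
        apply Real.le_sqrt_of_sq_le
        rw [mul_pow, Real.sq_sqrt (by linarith)]
        have : 0 ≤ β * a₁ * c + γ * c ^ 2 := by positivity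
        linarith
      have h4 : a₁ * (√α - 1) = b * (√γ - 1) + c := div_mul_cancel₀ _ hα'.ne'
      linarith
    have h5 : ContinuousOn (fun a => sqrtGauge α β γ a c) (Set.Icc 0 a₁) :=
      (cont.comp (by fun_prop : Continuous fun a : ℝ => (a, c))).continuousOn
    obtain ⟨a, ha, he⟩ := intermediate_value_Icc h1 h5
      ⟨by simpa only [zero c hc] using hb, h2⟩
    exact ⟨a, ha.1, he⟩

/-- Data for the folding of two faces of a tetrahedron. -/
structure FoldData where
  s : ℝ → ℝ → ℝ
  t : ℝ → ℝ → ℝ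
  hs : IsGauge s
  ht : IsGauge t
  q : ℝ
  q' : ℝ
  hq : 0 < q
  hq' : 0 < q'
  -- On the edge `A = B = 0` the dividing curves are the points `C = q' * D` and `D = q * C`. This
  -- inequality fixes their order, keeping the parts that go to `z = 1` and `z = 0` apart.
  hqq : q * q' < 1

namespace FoldData

-- The face `A = 0` is divided along `C = q' * t B D` and folded onto the cube faces `x = 0` and `z
-- = 1`. The face `B = 0` is divided along `D = q * s A C` and folded onto `y = 0` and `z = 0`. The
-- faces `C = 0` and `D = 0` become `x = 1` and `y = 1`.
variable (F : FoldData)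

/-- The first coordinate of the map to the cube. -/
noncomputable def x (A B C D : ℝ) : ℝ := 1 - C / max (F.s A C) (F.q' * F.t B D)

/-- The second coordinate of the map to the cube. -/
noncomputable def y (A B C D : ℝ) : ℝ := 1 - D / max (F.t B D) (F.q * F.s A C)

/-- A function that vanishes on the first part of the first face. -/
noncomputable def a (A B C D : ℝ) : ℝ := (F.s A C - C) + max 0 (F.s A C - F.q' * F.t B D)

/-- A function that vanishes on the second part of the second face. -/
noncomputable def b (A B C D : ℝ) : ℝ := (F.t B D - D) + max 0 (F.t B D - F.q * F.s A C)

/-- The third coordinate of the map to the cube. -/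
noncomputable def z (A B C D : ℝ) : ℝ := F.b A B C D / (F.a A B C D + F.b A B C D)

variable {F} {A B C D : ℝ}

theorem pos (hA : 0 ≤ A) (hB : 0 ≤ B) (hC : 0 ≤ C) (hD : 0 ≤ D) (h : 0 < A + B + C + D) :
    0 < F.s A C ∨ 0 < F.t B D := by
  by_contra! hn
  have h1 := F.hs.le hA hC
  have h2 := F.ht.le hB hD
  obtain ⟨h3, h4⟩ := F.hs.eq_zero hA hC (by linarith)
  obtain ⟨h5, h6⟩ := F.ht.eq_zero hB hD (by linarith)
  linarith

theorem max_pos (hA : 0 ≤ A) (hB : 0 ≤ B) (hC : 0 ≤ C) (hD : 0 ≤ D) (h : 0 < A + B + C + D) :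
    0 < max (F.s A C) (F.q' * F.t B D) := by
  rcases pos (F := F) hA hB hC hD h with h1 | h1
  · exact lt_max_of_lt_left h1
  · exact lt_max_of_lt_right (mul_pos F.hq' h1)

theorem max_pos' (hA : 0 ≤ A) (hB : 0 ≤ B) (hC : 0 ≤ C) (hD : 0 ≤ D) (h : 0 < A + B + C + D) :
    0 < max (F.t B D) (F.q * F.s A C) := by
  rcases pos (F := F) hA hB hC hD h with h1 | h1
  · exact lt_max_of_lt_right (mul_pos F.hq h1)
  · exact lt_max_of_lt_left h1

theorem a_nonneg (hA : 0 ≤ A) (hC : 0 ≤ C) : 0 ≤ F.a A B C D :=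
  add_nonneg (sub_nonneg.2 (F.hs.le hA hC)) (le_max_left _ _)

theorem b_nonneg (hB : 0 ≤ B) (hD : 0 ≤ D) : 0 ≤ F.b A B C D :=
  add_nonneg (sub_nonneg.2 (F.ht.le hB hD)) (le_max_left _ _)

theorem a_eq_zero_iff (hA : 0 ≤ A) (hC : 0 ≤ C) :
    F.a A B C D = 0 ↔ A = 0 ∧ F.s A C ≤ F.q' * F.t B D := by
  rw [a, add_eq_zero_iff_of_nonneg (sub_nonneg.2 (F.hs.le hA hC)) (le_max_left _ _), sub_eq_zero,
    F.hs.eq_iff hA hC, max_eq_left_iff, sub_nonpos]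

theorem b_eq_zero_iff (hB : 0 ≤ B) (hD : 0 ≤ D) :
    F.b A B C D = 0 ↔ B = 0 ∧ F.t B D ≤ F.q * F.s A C := by
  rw [b, add_eq_zero_iff_of_nonneg (sub_nonneg.2 (F.ht.le hB hD)) (le_max_left _ _), sub_eq_zero,
    F.ht.eq_iff hB hD, max_eq_left_iff, sub_nonpos]

/-- If both summands vanish, the gauges satisfy `S ≤ q' * T` and `T ≤ q * S`, which forces both to
be zero because `q * q' < 1`. -/
theorem ab_pos (hA : 0 ≤ A) (hB : 0 ≤ B) (hC : 0 ≤ C) (hD : 0 ≤ D) (h : 0 < A + B + C + D) :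
    0 < F.a A B C D + F.b A B C D := by
  refine lt_of_le_of_ne (add_nonneg (a_nonneg hA hC) (b_nonneg hB hD)) fun he => ?_
  rw [eq_comm, add_eq_zero_iff_of_nonneg (a_nonneg hA hC) (b_nonneg hB hD), a_eq_zero_iff hA hC,
    b_eq_zero_iff hB hD] at he
  have h1 := F.hs.le hA hC
  have h2 := F.ht.le hB hD
  have h3 := F.hqq
  have h4 := F.hq
  have h5 := F.hq'
  have h6 := mul_le_mul_of_nonneg_left he.2.2 h5.le
  have h7 := mul_le_mul_of_nonneg_left he.1.2 h4.le
  rcases pos (F := F) hA hB hC hD h with h8 | h8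
  · nlinarith [he.1.2]
  · nlinarith [he.2.2]

theorem mem_Icc (hA : 0 ≤ A) (hB : 0 ≤ B) (hC : 0 ≤ C) (hD : 0 ≤ D) (h : 0 < A + B + C + D) :
    F.x A B C D ∈ Set.Icc 0 1 ∧ F.y A B C D ∈ Set.Icc 0 1 ∧ F.z A B C D ∈ Set.Icc 0 1 := by
  have h1 := F.hs.le hA hC
  have h2 := F.ht.le hB hD
  have h3 := max_pos (F := F) hA hB hC hD h
  have h4 := max_pos' (F := F) hA hB hC hD h
  have h5 := ab_pos (F := F) hA hB hC hD h
  have h6 := a_nonneg (F := F) (B := B) (D := D) hA hC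
  have h7 := b_nonneg (F := F) (A := A) (C := C) hB hD
  refine ⟨⟨sub_nonneg.2 ((div_le_one h3).2 (h1.trans (le_max_left _ _))),
    sub_le_self _ (by positivity)⟩, ⟨sub_nonneg.2 ((div_le_one h4).2 (h2.trans (le_max_left _ _))),
    sub_le_self _ (by positivity)⟩, div_nonneg h7 h5.le, (div_le_one h5).2 (by linarith)⟩

theorem x_eq_zero_iff (hA : 0 ≤ A) (hB : 0 ≤ B) (hC : 0 ≤ C) (hD : 0 ≤ D)
    (h : 0 < A + B + C + D) : F.x A B C D = 0 ↔ A = 0 ∧ F.q' * F.t B D ≤ F.s A C := by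
  rw [x, sub_eq_zero, eq_comm, div_eq_one_iff_eq (max_pos hA hB hC hD h).ne']
  have h1 := F.hs.le hA hC
  constructor
  · intro he
    have h2 : F.s A C = C := le_antisymm ((le_max_left _ _).trans_eq he.symm) h1
    exact ⟨(F.hs.eq_iff hA hC).1 h2, by rw [h2]; exact (le_max_right _ _).trans_eq he.symm⟩
  · rintro ⟨h2, h3⟩
    rw [max_eq_left h3, (F.hs.eq_iff hA hC).2 h2]

theorem y_eq_zero_iff (hA : 0 ≤ A) (hB : 0 ≤ B) (hC : 0 ≤ C) (hD : 0 ≤ D)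
    (h : 0 < A + B + C + D) : F.y A B C D = 0 ↔ B = 0 ∧ F.q * F.s A C ≤ F.t B D := by
  rw [y, sub_eq_zero, eq_comm, div_eq_one_iff_eq (max_pos' hA hB hC hD h).ne']
  have h1 := F.ht.le hB hD
  constructor
  · intro he
    have h2 : F.t B D = D := le_antisymm ((le_max_left _ _).trans_eq he.symm) h1
    exact ⟨(F.ht.eq_iff hB hD).1 h2, by rw [h2]; exact (le_max_right _ _).trans_eq he.symm⟩
  · rintro ⟨h2, h3⟩
    rw [max_eq_left h3, (F.ht.eq_iff hB hD).2 h2]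

theorem x_eq_one_iff (hA : 0 ≤ A) (hB : 0 ≤ B) (hC : 0 ≤ C) (hD : 0 ≤ D)
    (h : 0 < A + B + C + D) : F.x A B C D = 1 ↔ C = 0 := by
  have := (max_pos (F := F) hA hB hC hD h).ne'
  simp [x, this]

theorem y_eq_one_iff (hA : 0 ≤ A) (hB : 0 ≤ B) (hC : 0 ≤ C) (hD : 0 ≤ D)
    (h : 0 < A + B + C + D) : F.y A B C D = 1 ↔ D = 0 := by
  have := (max_pos' (F := F) hA hB hC hD h).ne'
  simp [y, this]

theorem z_eq_one_iff (hA : 0 ≤ A) (hB : 0 ≤ B) (hC : 0 ≤ C) (hD : 0 ≤ D)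
    (h : 0 < A + B + C + D) : F.z A B C D = 1 ↔ A = 0 ∧ F.s A C ≤ F.q' * F.t B D := by
  rw [z, div_eq_one_iff_eq (ab_pos hA hB hC hD h).ne', ← a_eq_zero_iff hA hC]
  constructor <;> intro he <;> linarith

theorem z_eq_zero_iff (hA : 0 ≤ A) (hB : 0 ≤ B) (hC : 0 ≤ C) (hD : 0 ≤ D)
    (h : 0 < A + B + C + D) : F.z A B C D = 0 ↔ B = 0 ∧ F.t B D ≤ F.q * F.s A C := by
  rw [z, div_eq_zero_iff, or_iff_left (ab_pos hA hB hC hD h).ne', ← b_eq_zero_iff hB hD]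

variable (F) in
/-- The function whose zero determines the ratio of the two gauges. -/
noncomputable def balance (x y z S T : ℝ) : ℝ :=
  (1 - z) * (T - F.q * S + y * max T (F.q * S)) - z * (S - F.q' * T + x * max S (F.q' * T))

theorem C_eq (hA : 0 ≤ A) (hB : 0 ≤ B) (hC : 0 ≤ C) (hD : 0 ≤ D) (h : 0 < A + B + C + D) :
    C = (1 - F.x A B C D) * max (F.s A C) (F.q' * F.t B D) := by
  have := (max_pos (F := F) hA hB hC hD h).ne'
  rw [x]
  field_simp
  ring

theorem D_eq (hA : 0 ≤ A) (hB : 0 ≤ B) (hC : 0 ≤ C) (hD : 0 ≤ D) (h : 0 < A + B + C + D) :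
    D = (1 - F.y A B C D) * max (F.t B D) (F.q * F.s A C) := by
  have := (max_pos' (F := F) hA hB hC hD h).ne'
  rw [y]
  field_simp
  ring

theorem max_zero_sub (u v : ℝ) : max 0 (u - v) = max u v - v := by
  rw [max_comm, max_sub_sub_right u v v |>.symm, sub_self]

theorem balance_eq_zero (hA : 0 ≤ A) (hB : 0 ≤ B) (hC : 0 ≤ C) (hD : 0 ≤ D)
    (h : 0 < A + B + C + D) :
    F.balance (F.x A B C D) (F.y A B C D) (F.z A B C D) (F.s A C) (F.t B D) = 0 := by
  have h1 : F.a A B C D = F.s A C - F.q' * F.t B D +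
      F.x A B C D * max (F.s A C) (F.q' * F.t B D) := by
    rw [a, max_zero_sub]
    linear_combination -(C_eq (F := F) hA hB hC hD h)
  have h2 : F.b A B C D = F.t B D - F.q * F.s A C +
      F.y A B C D * max (F.t B D) (F.q * F.s A C) := by
    rw [b, max_zero_sub]
    linear_combination -(D_eq (F := F) hA hB hC hD h)
  rw [balance, ← h1, ← h2, z]
  have := (ab_pos (F := F) hA hB hC hD h).ne'
  field_simp
  ring

theorem balance_smul (x y z S T k : ℝ) (hk : 0 ≤ k) :
    F.balance x y z (k * S) (k * T) = k * F.balance x y z S T := by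
  have h1 : max (k * T) (F.q * (k * S)) = k * max T (F.q * S) := by
    rw [mul_max_of_nonneg _ _ hk]; ring_nf
  have h2 : max (k * S) (F.q' * (k * T)) = k * max S (F.q' * T) := by
    rw [mul_max_of_nonneg _ _ hk]; ring_nf
  rw [balance, h1, h2, balance]
  ring

theorem mul_max_sub_le {y u v w : ℝ} (hy : y ∈ Set.Icc (0 : ℝ) 1) (h : u ≤ v) :
    y * max w v - y * max w u ≤ v - u := by
  have h1 : max w v ≤ max w u + (v - u) := by
    rcases max_cases w v with h | h <;> rcases max_cases w u with h' | h' <;> linarith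
  have h2 : max w u ≤ max w v := max_le_max le_rfl h
  nlinarith [hy.1, hy.2]

theorem balance_anti {x y z S S' T : ℝ} (hx : x ∈ Set.Icc (0 : ℝ) 1) (hy : y ∈ Set.Icc (0 : ℝ) 1)
    (hz : z ∈ Set.Icc (0 : ℝ) 1) (h : S ≤ S') :
    F.balance x y z S' T + z * (S' - S) ≤ F.balance x y z S T := by
  have h1 := mul_max_sub_le (w := T) hy (mul_le_mul_of_nonneg_left h F.hq.le)
  have h2 : x * max S (F.q' * T) ≤ x * max S' (F.q' * T) :=
    mul_le_mul_of_nonneg_left (max_le_max h le_rfl) hx.1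
  have h3 : 0 ≤ 1 - z := sub_nonneg.2 hz.2
  unfold balance
  nlinarith [mul_le_mul_of_nonneg_left h1 h3, mul_le_mul_of_nonneg_left h2 hz.1]

theorem balance_mono {x y z S T T' : ℝ} (hx : x ∈ Set.Icc (0 : ℝ) 1) (hy : y ∈ Set.Icc (0 : ℝ) 1)
    (hz : z ∈ Set.Icc (0 : ℝ) 1) (h : T ≤ T') :
    F.balance x y z S T + (1 - z) * (T' - T) ≤ F.balance x y z S T' := by
  have h1 := mul_max_sub_le (w := S) hx (mul_le_mul_of_nonneg_left h F.hq'.le)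
  have h2 : y * max T (F.q * S) ≤ y * max T' (F.q * S) :=
    mul_le_mul_of_nonneg_left (max_le_max h le_rfl) hy.1
  have h3 : 0 ≤ 1 - z := sub_nonneg.2 hz.2
  unfold balance
  nlinarith [mul_le_mul_of_nonneg_left h1 hz.1, mul_le_mul_of_nonneg_left h2 h3]

/-- The balance is homogeneous, decreasing in `S` and increasing in `T`, and one of the two is
strict because `z` and `1 - z` do not vanish together. Its zeros in the quadrant therefore lie on
one ray. The rescalings make one variable of the two zeros agree so that the monotonicities apply.
-/
theorem cross_le {x y z S T S' T' : ℝ} (hx : x ∈ Set.Icc (0 : ℝ) 1) (hy : y ∈ Set.Icc (0 : ℝ) 1)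
    (hz : z ∈ Set.Icc (0 : ℝ) 1) (hS : 0 ≤ S) (hT : 0 ≤ T) (hS' : 0 ≤ S') (hT' : 0 ≤ T')
    (h : F.balance x y z S T = 0) (h' : F.balance x y z S' T' = 0) : S' * T ≤ S * T' := by
  by_contra! hlt
  have e1 := balance_smul (F := F) x y z S T T' hT'
  have e2 := balance_smul (F := F) x y z S' T' T hT
  have e3 := balance_smul (F := F) x y z S T S' hS'
  have e4 := balance_smul (F := F) x y z S' T' S hS
  rw [h, mul_zero] at e1 e3
  rw [h', mul_zero] at e2 e4
  have h1 := balance_anti (F := F) (S := T' * S) (S' := T * S') (T := T' * T) hx hy hz (by linarith)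
  have h2 := balance_mono (F := F) (S := S' * S) (T := S * T') (T' := S' * T) hx hy hz (by linarith)
  rw [mul_comm T T'] at e2
  rw [mul_comm S S'] at e4
  rw [e1, e2] at h1
  rw [e3, e4] at h2
  nlinarith [hz.1, hz.2]

/-- By `cross_le` the cube coordinates fix the ratio of the two gauges, hence `C` and `D`, and then
`A` and `B`, up to a common factor `k`. The normalization of the sum makes it one. -/
theorem inj {A' B' C' D' : ℝ} (hA : 0 ≤ A) (hB : 0 ≤ B) (hC : 0 ≤ C) (hD : 0 ≤ D)
    (h : A + B + C + D = 1) (hA' : 0 ≤ A') (hB' : 0 ≤ B') (hC' : 0 ≤ C') (hD' : 0 ≤ D')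
    (h' : A' + B' + C' + D' = 1) (hx : F.x A B C D = F.x A' B' C' D')
    (hy : F.y A B C D = F.y A' B' C' D') (hz : F.z A B C D = F.z A' B' C' D') :
    A = A' ∧ B = B' ∧ C = C' ∧ D = D' := by
  have p : 0 < A + B + C + D := by linarith
  have p' : 0 < A' + B' + C' + D' := by linarith
  obtain ⟨ix, iy, iz⟩ := mem_Icc (F := F) hA hB hC hD p
  have hS := hC.trans (F.hs.le hA hC)
  have hT := hD.trans (F.ht.le hB hD)
  have hS' := hC'.trans (F.hs.le hA' hC')
  have hT' := hD'.trans (F.ht.le hB' hD')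
  have b1 := balance_eq_zero (F := F) hA hB hC hD p
  have b2 := balance_eq_zero (F := F) hA' hB' hC' hD' p'
  have ec := C_eq (F := F) hA hB hC hD p
  have ec' := C_eq (F := F) hA' hB' hC' hD' p'
  have ed := D_eq (F := F) hA hB hC hD p
  have ed' := D_eq (F := F) hA' hB' hC' hD' p'
  rw [← hx, ← hy, ← hz] at b2
  rw [← hx] at ec'
  rw [← hy] at ed'
  have c1 := cross_le ix iy iz hS hT hS' hT' b1 b2
  have c2 := cross_le ix iy iz hS' hT' hS hT b2 b1
  have hst : 0 < F.s A C + F.t B D := by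
    rcases pos (F := F) hA hB hC hD p with h | h <;> linarith
  set k := (F.s A' C' + F.t B' D') / (F.s A C + F.t B D) with hk
  have hk0 : 0 ≤ k := by positivity
  have kS : F.s A' C' = k * F.s A C := by rw [hk]; field_simp; nlinarith
  have kT : F.t B' D' = k * F.t B D := by rw [hk]; field_simp; nlinarith
  have kC : C' = k * C := by
    rw [ec', kS, kT, show F.q' * (k * F.t B D) = k * (F.q' * F.t B D) by ring,
      ← mul_max_of_nonneg _ _ hk0]
    linear_combination -k * ec
  have kD : D' = k * D := by
    rw [ed', kS, kT, show F.q * (k * F.s A C) = k * (F.q * F.s A C) by ring,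
      ← mul_max_of_nonneg _ _ hk0]
    linear_combination -k * ed
  have kA : A' = k * A := F.hs.inj hA' (by positivity) hC' (by
    rw [kS, ← F.hs.smul _ _ _ hk0, ← kC])
  have kB : B' = k * B := F.ht.inj hB' (by positivity) hD' (by
    rw [kT, ← F.ht.smul _ _ _ hk0, ← kD])
  have k1 : k = 1 := by
    have : k * (A + B + C + D) = A' + B' + C' + D' := by rw [kA, kB, kC, kD]; ring
    rw [h, h'] at this
    linarith
  rw [k1, one_mul] at kA kB kC kD
  exact ⟨kA.symm, kB.symm, kC.symm, kD.symm⟩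

/-- The intermediate value theorem on `S + T = 1` finds the ratio of the gauges. Then `x` and `y`
dictate `C` and `D`, the gauges are solved for `A` and `B`, and the result is rescaled to have sum
one. -/
theorem surj {x y z : ℝ} (hx : x ∈ Set.Icc (0 : ℝ) 1) (hy : y ∈ Set.Icc (0 : ℝ) 1)
    (hz : z ∈ Set.Icc (0 : ℝ) 1) : ∃ A B C D : ℝ, 0 ≤ A ∧ 0 ≤ B ∧ 0 ≤ C ∧ 0 ≤ D ∧
      A + B + C + D = 1 ∧ F.x A B C D = x ∧ F.y A B C D = y ∧ F.z A B C D = z := by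
  have hq := F.hq
  have hq' := F.hq'
  have hqq := F.hqq
  have hcont : ContinuousOn (fun S => F.balance x y z S (1 - S)) (Set.Icc 0 1) := by
    unfold balance
    fun_prop
  have g0 : 0 ≤ F.balance x y z 0 (1 - 0) := by
    rw [balance]
    simp only [sub_zero, mul_zero, mul_one, zero_sub]
    rw [max_eq_left zero_le_one, max_eq_right hq'.le]
    nlinarith [hx.1, hx.2, hy.1, hy.2, hz.1, hz.2, mul_nonneg (sub_nonneg.2 hz.2) hy.1,
      mul_nonneg (mul_nonneg hz.1 hq'.le) (sub_nonneg.2 hx.2)]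
  have g1 : F.balance x y z 1 (1 - 1) ≤ 0 := by
    rw [balance]
    simp only [sub_self, mul_zero, mul_one, zero_sub, sub_zero]
    rw [max_eq_right hq.le, max_eq_left zero_le_one]
    nlinarith [hx.1, hx.2, hy.1, hy.2, hz.1, hz.2, mul_nonneg hz.1 hx.1,
      mul_nonneg (mul_nonneg (sub_nonneg.2 hz.2) hq.le) (sub_nonneg.2 hy.2)]
  obtain ⟨S, ⟨hS0, hS1⟩, hS⟩ := intermediate_value_Icc' zero_le_one hcont ⟨g1, g0⟩
  obtain ⟨T, hT⟩ : ∃ T, T = 1 - S := ⟨_, rfl⟩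
  simp only [← hT] at hS
  have hT0 : 0 ≤ T := by linarith
  set M := max S (F.q' * T) with hM
  set M' := max T (F.q * S) with hM'
  have hMS : S ≤ M := le_max_left _ _
  have hMT : F.q' * T ≤ M := le_max_right _ _
  have hMT' : T ≤ M' := le_max_left _ _
  have hMS' : F.q * S ≤ M' := le_max_right _ _
  have hMp : 0 < M := by
    rcases eq_or_lt_of_le hS0 with h | h
    · have : T = 1 := by linarith
      rw [this] at hMT; linarith
    · linarith
  have hMp' : 0 < M' := by
    rcases eq_or_lt_of_le hT0 with h | h
    · have : S = 1 := by linarith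
      rw [this] at hMS'; linarith
    · linarith
  have hbal : (1 - z) * (T - F.q * S + y * M') = z * (S - F.q' * T + x * M) := by
    have := hS; unfold balance at this; linarith
  have hC0 : 0 ≤ (1 - x) * M := mul_nonneg (sub_nonneg.2 hx.2) hMp.le
  have hD0 : 0 ≤ (1 - y) * M' := mul_nonneg (sub_nonneg.2 hy.2) hMp'.le
  -- The condition for solving the gauge for `A`. The critical case is `S < q' * T`: then `q * q' <
  -- 1` makes the left side of `hbal` nonnegative, so the factor of `z` on the right is nonnegative,
  -- and this is the claim.
  have hCS : (1 - x) * M ≤ S := by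
    rcases le_total (F.q' * T) S with h | h
    · rw [hM, max_eq_left h]; nlinarith [hx.1]
    · rcases eq_or_lt_of_le h with h | h
      · rw [hM, ← h, max_self]; nlinarith [hx.1]
      have hMe : M = F.q' * T := max_eq_right h.le
      have hb : 0 < T - F.q * S + y * M' := by
        have : 0 ≤ y * M' := mul_nonneg hy.1 hMp'.le
        nlinarith
      have hzp : 0 < z := lt_of_le_of_ne hz.1 fun h0 => by
        rw [← h0] at hbal
        linarith
      have := nonneg_of_mul_nonneg_right
        (hbal ▸ mul_nonneg (sub_nonneg.2 hz.2) hb.le) hzp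
      rw [hMe] at this ⊢
      linarith
  have hDT : (1 - y) * M' ≤ T := by
    rcases le_total (F.q * S) T with h | h
    · rw [hM', max_eq_left h]; nlinarith [hy.1]
    · rcases eq_or_lt_of_le h with h | h
      · rw [hM', ← h, max_self]; nlinarith [hy.1]
      have hMe : M' = F.q * S := max_eq_right h.le
      have ha : 0 < S - F.q' * T + x * M := by
        have : 0 ≤ x * M := mul_nonneg hx.1 hMp.le
        nlinarith
      have hzp : 0 < 1 - z := lt_of_le_of_ne (sub_nonneg.2 hz.2) fun h0 => by
        rw [← h0, zero_mul] at hbal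
        have : z = 1 := by linarith
        rw [this] at hbal
        linarith
      have := nonneg_of_mul_nonneg_right
        (hbal ▸ mul_nonneg hz.1 ha.le) hzp
      rw [hMe] at this ⊢
      linarith
  obtain ⟨A, hA0, hA⟩ := F.hs.surj _ S hC0 hCS
  obtain ⟨B, hB0, hB⟩ := F.ht.surj _ T hD0 hDT
  set C := (1 - x) * M with hC
  set D := (1 - y) * M' with hD
  have hN : 0 < A + B + C + D := by
    refine lt_of_le_of_ne (by positivity) fun h0 => ?_
    have a0 : A = 0 := by linarith
    have b0 : B = 0 := by linarith
    have c0 : C = 0 := by linarith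
    have d0 : D = 0 := by linarith
    rw [a0, c0, F.hs.zero 0 le_rfl] at hA
    rw [b0, d0, F.ht.zero 0 le_rfl] at hB
    linarith
  set k := (A + B + C + D)⁻¹ with hk
  have hk0 : 0 < k := inv_pos.2 hN
  have kS : F.s (k * A) (k * C) = k * S := by rw [F.hs.smul _ _ _ hk0.le, hA]
  have kT : F.t (k * B) (k * D) = k * T := by rw [F.ht.smul _ _ _ hk0.le, hB]
  have kM : max (k * S) (F.q' * (k * T)) = k * M := by
    rw [hM, mul_max_of_nonneg _ _ hk0.le]; ring_nf
  have kM' : max (k * T) (F.q * (k * S)) = k * M' := by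
    rw [hM', mul_max_of_nonneg _ _ hk0.le]; ring_nf
  refine ⟨k * A, k * B, k * C, k * D, by positivity, by positivity, by positivity, by positivity,
    by rw [hk]; field_simp, ?_, ?_, ?_⟩
  · rw [FoldData.x, kS, kT, kM, hC]
    field_simp
    ring
  · rw [FoldData.y, kS, kT, kM', hD]
    field_simp
    ring
  · have ea : F.a (k * A) (k * B) (k * C) (k * D) = k * (S - F.q' * T + x * M) := by
      rw [a, max_zero_sub, kS, kT, kM, hC]; ring
    have eb : F.b (k * A) (k * B) (k * C) (k * D) = k * (T - F.q * S + y * M') := by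
      rw [b, max_zero_sub, kS, kT, kM', hD]; ring
    have hp := ab_pos (F := F) (A := k * A) (B := k * B) (C := k * C) (D := k * D)
      (by positivity) (by positivity) (by positivity) (by positivity)
      (by rw [← mul_add, ← mul_add, ← mul_add]; exact mul_pos hk0 hN)
    rw [FoldData.z, div_eq_iff hp.ne', ea, eb]
    linear_combination k * hbal

end FoldData

theorem continuousOn_of_leftInvOn_of_isCompact {α β : Type*} [TopologicalSpace α]
    [TopologicalSpace β] [T2Space β] {f : α → β} {g : β → α} {K : Set α} (hK : IsCompact K)
    (hf : ContinuousOn f K) (hg : Set.LeftInvOn g f K) : ContinuousOn g (f '' K) := by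
  rw [continuousOn_iff_isClosed]
  intro C hC
  refine ⟨f '' (K ∩ C), ((hK.inter_right hC).image_of_continuousOn
    (hf.mono Set.inter_subset_left)).isClosed, ?_⟩
  ext b
  constructor
  · rintro ⟨hb, a, ha, rfl⟩
    rw [Set.mem_preimage, hg ha] at hb
    exact ⟨⟨a, ⟨ha, hb⟩, rfl⟩, a, ha, rfl⟩
  · rintro ⟨⟨a, ⟨ha, hc⟩, rfl⟩, h⟩
    exact ⟨by rwa [Set.mem_preimage, hg ha], h⟩

/-! ### The chamber of the tetrahedron and the hyperbolic polyhedron -/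

namespace TetTangle

open UpperHalfSpace

/-- Sorted barycentric coordinates: a fundamental chamber of the symmetric tetrahedron. -/
def chamber : Set (Fin 4 → ℝ) := {l | Monotone l ∧ 0 ≤ l 0 ∧ ∑ i, l i = 1}

/-- The part of the tangle in the chamber. -/
def chamberTangle : Set (Fin 4 → ℝ) :=
  {l | l 0 = 0 ∧ ∑ i, l i ^ 2 = 11 / 24 ∨ l 2 = l 3 ∧ ∑ i, l i ^ 2 = l 2 + l 3 - 15 / 32}

/-- The chamber without the tangle. -/
def cell : Set (Fin 4 → ℝ) := chamber \ chamberTangle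

/-- The gauges adapted to the circular arcs of the tangle. -/
noncomputable def tangleFold : FoldData where
  -- When the coordinates have sum one, `D = q * s A C` with `B = 0` reads `8 A² + 32/3 A C + 16/3
  -- C² = 1`, the circle of radius `1/8` about the midpoint of the edge. Likewise `C = q' * t B D`
  -- with `A = 0` reads `16/3 B² + 8/3 B D + 4/3 D² = 1`, the circle of radius `1/4` about the
  -- barycenter of the face. The factors `q` and `q'` cancel the denominators of the gauges.
  s := sqrtGauge 8 (32 / 3) (16 / 3)
  t := sqrtGauge (16 / 3) (8 / 3) (4 / 3)
  hs := isGauge_sqrtGauge (by norm_num) (by norm_num) (by norm_num) (by norm_num)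
  ht := isGauge_sqrtGauge (by norm_num) (by norm_num) (by norm_num) (by norm_num)
  q := √(16 / 3) - 1
  q' := √(4 / 3) - 1
  hq := sub_pos.2 (Real.lt_sqrt_of_sq_lt (by norm_num))
  hq' := sub_pos.2 (Real.lt_sqrt_of_sq_lt (by norm_num))
  hqq := by
    have h1 : √(16 / 3) * √(4 / 3) = 8 / 3 := by
      rw [← Real.sqrt_mul (by norm_num), show (16 / 3 * (4 / 3) : ℝ) = (8 / 3) ^ 2 by norm_num,
        Real.sqrt_sq (by norm_num)]
    have h2 : 2 < √(16 / 3) := Real.lt_sqrt_of_sq_lt (by norm_num)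
    have h3 : 1 < √(4 / 3) := Real.lt_sqrt_of_sq_lt (by norm_num)
    nlinarith

/-- The map from the chamber to the unit cube. -/
noncomputable def toCube (l : Fin 4 → ℝ) : ℝ × ℝ × ℝ :=
  -- The four arguments are the barycentric weights in the chamber of its vertices: the center of
  -- the tetrahedron, a vertex, the barycenter of a face and the midpoint of an edge.
  (tangleFold.x (4 * l 0) (l 3 - l 2) (3 * (l 1 - l 0)) (2 * (l 2 - l 1)),
    tangleFold.y (4 * l 0) (l 3 - l 2) (3 * (l 1 - l 0)) (2 * (l 2 - l 1)),
    tangleFold.z (4 * l 0) (l 3 - l 2) (3 * (l 1 - l 0)) (2 * (l 2 - l 1)))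

/-- The unit cube. -/
def cube : Set (ℝ × ℝ × ℝ) := Set.Icc 0 1 ×ˢ Set.Icc 0 1 ×ˢ Set.Icc 0 1

theorem monotone_iff (l : Fin 4 → ℝ) : Monotone l ↔ l 0 ≤ l 1 ∧ l 1 ≤ l 2 ∧ l 2 ≤ l 3 := by
  rw [Fin.monotone_iff_le_succ, Fin.forall_fin_succ, Fin.forall_fin_succ, Fin.forall_fin_one]
  rfl

theorem chamber_coords {l : Fin 4 → ℝ} (hl : l ∈ chamber) : 0 ≤ 4 * l 0 ∧ 0 ≤ l 3 - l 2 ∧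
    0 ≤ 3 * (l 1 - l 0) ∧ 0 ≤ 2 * (l 2 - l 1) ∧
    4 * l 0 + (l 3 - l 2) + 3 * (l 1 - l 0) + 2 * (l 2 - l 1) = 1 := by
  obtain ⟨h1, h2, h3⟩ := hl
  rw [monotone_iff] at h1
  rw [Fin.sum_univ_four] at h3
  refine ⟨?_, ?_, ?_, ?_, ?_⟩ <;> linarith [h1.1, h1.2.1, h1.2.2]

theorem isCompact_chamber : IsCompact chamber := by
  refine Metric.isCompact_of_isClosed_isBounded ?_ ?_
  · have : chamber = {l | l 0 ≤ l 1} ∩ {l | l 1 ≤ l 2} ∩ {l | l 2 ≤ l 3} ∩ {l | 0 ≤ l 0} ∩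
        {l | ∑ i, l i = 1} := by
      ext l
      simp only [chamber, monotone_iff, Set.mem_inter_iff, Set.mem_ofPred_eq]
      tauto
    rw [this]
    exact ((((isClosed_le (by fun_prop) (by fun_prop)).inter
      (isClosed_le (by fun_prop) (by fun_prop))).inter
      (isClosed_le (by fun_prop) (by fun_prop))).inter
      (isClosed_le (by fun_prop) (by fun_prop))).inter
      (isClosed_eq (by fun_prop) (by fun_prop))
  · refine (Metric.isBounded_Icc (0 : Fin 4 → ℝ) 1).subset fun l hl => ?_
    obtain ⟨h1, h2, h3, h4, h5⟩ := chamber_coords hl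
    constructor <;> intro i <;> fin_cases i <;> simp <;> linarith

theorem toCube_mem {l : Fin 4 → ℝ} (hl : l ∈ chamber) : toCube l ∈ cube := by
  obtain ⟨h1, h2, h3, h4, h5⟩ := chamber_coords hl
  obtain ⟨hx, hy, hz⟩ := FoldData.mem_Icc (F := tangleFold) h1 h2 h3 h4 (by linarith)
  exact ⟨hx, hy, hz⟩

theorem injOn_toCube : Set.InjOn toCube chamber := by
  intro l hl l' hl' h
  obtain ⟨h1, h2, h3, h4, h5⟩ := chamber_coords hl
  obtain ⟨h1', h2', h3', h4', h5'⟩ := chamber_coords hl'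
  simp only [toCube, Prod.mk.injEq] at h
  obtain ⟨e1, e2, e3, e4⟩ := FoldData.inj h1 h2 h3 h4 (by linarith) h1' h2' h3' h4' (by linarith)
    h.1 h.2.1 h.2.2
  ext i
  fin_cases i <;> simp <;> linarith

theorem image_toCube : toCube '' chamber = cube := by
  refine Set.Subset.antisymm (Set.image_subset_iff.2 fun l hl => toCube_mem hl) ?_
  rintro ⟨x, y, z⟩ ⟨hx, hy, hz⟩
  obtain ⟨A, B, C, D, hA, hB, hC, hD, hs, h1, h2, h3⟩ :=
    FoldData.surj (F := tangleFold) hx hy hz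
  refine ⟨![A / 4, A / 4 + C / 3, A / 4 + C / 3 + D / 2, A / 4 + C / 3 + D / 2 + B],
    ⟨?_, ?_, ?_⟩, ?_⟩
  · rw [monotone_iff]
    simp
    exact ⟨by positivity, by positivity, hB⟩
  · simp; positivity
  · rw [Fin.sum_univ_four]
    simp
    linarith
  · have e1 : 4 * (A / 4) = A := by ring
    have e2 : A / 4 + C / 3 + D / 2 + B - (A / 4 + C / 3 + D / 2) = B := by ring
    have e5 : 3 * (C / 3) = C := by ring
    have e6 : 2 * (D / 2) = D := by ring
    simp [toCube, e1, e2, e5, e6, h1, h2, h3]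

theorem continuousOn_foldData (F : FoldData) : ContinuousOn (fun l : Fin 4 → ℝ =>
    (F.x (4 * l 0) (l 3 - l 2) (3 * (l 1 - l 0)) (2 * (l 2 - l 1)),
      F.y (4 * l 0) (l 3 - l 2) (3 * (l 1 - l 0)) (2 * (l 2 - l 1)),
      F.z (4 * l 0) (l 3 - l 2) (3 * (l 1 - l 0)) (2 * (l 2 - l 1)))) chamber := by
  have hs := F.hs.cont
  have ht := F.ht.cont
  have cs : Continuous fun l : Fin 4 → ℝ => F.s (4 * l 0) (3 * (l 1 - l 0)) :=
    hs.comp (by fun_prop : Continuous fun l : Fin 4 → ℝ => (4 * l 0, 3 * (l 1 - l 0)))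
  have ct : Continuous fun l : Fin 4 → ℝ => F.t (l 3 - l 2) (2 * (l 2 - l 1)) :=
    ht.comp (by fun_prop : Continuous fun l : Fin 4 → ℝ => (l 3 - l 2, 2 * (l 2 - l 1)))
  have ca : Continuous fun l : Fin 4 → ℝ =>
      F.a (4 * l 0) (l 3 - l 2) (3 * (l 1 - l 0)) (2 * (l 2 - l 1)) := by
    unfold FoldData.a
    fun_prop
  have cb : Continuous fun l : Fin 4 → ℝ =>
      F.b (4 * l 0) (l 3 - l 2) (3 * (l 1 - l 0)) (2 * (l 2 - l 1)) := by
    unfold FoldData.b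
    fun_prop
  refine ContinuousOn.prodMk ?_ (ContinuousOn.prodMk ?_ ?_)
  · refine continuousOn_const.sub (ContinuousOn.div (by fun_prop)
      (cs.max (continuous_const.mul ct)).continuousOn fun l hl => ?_)
    obtain ⟨h1, h2, h3, h4, h5⟩ := chamber_coords hl
    exact (FoldData.max_pos h1 h2 h3 h4 (by linarith)).ne'
  · refine continuousOn_const.sub (ContinuousOn.div (by fun_prop)
      (ct.max (continuous_const.mul cs)).continuousOn fun l hl => ?_)
    obtain ⟨h1, h2, h3, h4, h5⟩ := chamber_coords hl
    exact (FoldData.max_pos' h1 h2 h3 h4 (by linarith)).ne'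
  · refine ContinuousOn.div cb.continuousOn (ca.add cb).continuousOn fun l hl => ?_
    obtain ⟨h1, h2, h3, h4, h5⟩ := chamber_coords hl
    exact (FoldData.ab_pos h1 h2 h3 h4 (by linarith)).ne'

theorem continuousOn_toCube : ContinuousOn toCube chamber := continuousOn_foldData tangleFold

/-- The inverse of the map from the chamber to the unit cube. -/
noncomputable def ofCubeChamber : ℝ × ℝ × ℝ → Fin 4 → ℝ := Function.invFunOn toCube chamber

theorem ofCubeChamber_toCube {l : Fin 4 → ℝ} (hl : l ∈ chamber) : ofCubeChamber (toCube l) = l :=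
  injOn_toCube.leftInvOn_invFunOn hl

theorem ofCubeChamber_mem {c : ℝ × ℝ × ℝ} (hc : c ∈ cube) : ofCubeChamber c ∈ chamber :=
  Function.invFunOn_mem (by rw [← image_toCube] at hc; exact hc)

theorem toCube_ofCubeChamber {c : ℝ × ℝ × ℝ} (hc : c ∈ cube) : toCube (ofCubeChamber c) = c :=
  Function.invFunOn_eq (by rw [← image_toCube] at hc; exact hc)

theorem continuousOn_ofCubeChamber : ContinuousOn ofCubeChamber cube := by
  rw [← image_toCube]
  exact continuousOn_of_leftInvOn_of_isCompact isCompact_chamber continuousOn_toCube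
    fun l hl => ofCubeChamber_toCube hl

/-- Two skew edges of the cube, which correspond to the tangle. -/
def cubeTangle : Set (ℝ × ℝ × ℝ) := {c | c.1 = 0 ∧ c.2.2 = 1 ∨ c.2.1 = 0 ∧ c.2.2 = 0}

theorem sqrtGauge_eq_iff {α β γ p c T : ℝ} (hγ : 1 < γ) (hp : 0 ≤ T + p + c)
    (h : 0 ≤ α * p ^ 2 + β * p * c + γ * c ^ 2) :
    (√γ - 1) * sqrtGauge α β γ p c = T ↔ α * p ^ 2 + β * p * c + γ * c ^ 2 = (T + p + c) ^ 2 := by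
  have hg : 0 < √γ - 1 := sub_pos.2 (Real.lt_sqrt_of_sq_lt (by linarith))
  rw [sqrtGauge, mul_div_cancel₀ _ hg.ne', ← Real.sqrt_eq_iff_eq_sq h hp]
  constructor <;> intro <;> linarith

/-- Each deleted edge of the cube borders the two faces that come from one wall of the chamber. The
two inequalities that select the parts of this wall combine to an equality, which is the equation of
the circle by the choice of `tangleFold`. -/
theorem toCube_mem_cubeTangle_iff {l : Fin 4 → ℝ} (hl : l ∈ chamber) :
    toCube l ∈ cubeTangle ↔ l ∈ chamberTangle := by
  obtain ⟨h1, h2, h3, h4, h5⟩ := chamber_coords hl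
  have h6 : (0 : ℝ) < 4 * l 0 + (l 3 - l 2) + 3 * (l 1 - l 0) + 2 * (l 2 - l 1) := by linarith
  have hs := hl.2.2
  rw [Fin.sum_univ_four] at hs
  simp only [cubeTangle, toCube, Set.mem_ofPred_eq, FoldData.x_eq_zero_iff h1 h2 h3 h4 h6,
    FoldData.y_eq_zero_iff h1 h2 h3 h4 h6, FoldData.z_eq_zero_iff h1 h2 h3 h4 h6,
    FoldData.z_eq_one_iff h1 h2 h3 h4 h6, chamberTangle, Fin.sum_univ_four]
  apply or_congr
  · constructor
    · rintro ⟨⟨e1, e2⟩, -, e3⟩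
      have e4 : l 0 = 0 := by linarith
      have e5 := le_antisymm e2 e3
      rw [e1, tangleFold.hs.zero _ h3] at e5
      refine ⟨e4, ?_⟩
      have := (sqrtGauge_eq_iff (by norm_num) (by linarith) (by positivity)).1 e5
      rw [e4] at this hs ⊢
      nlinarith
    · rintro ⟨e4, e6⟩
      have e1 : 4 * l 0 = 0 := by linarith
      have e5 : tangleFold.q' * tangleFold.t (l 3 - l 2) (2 * (l 2 - l 1)) = 3 * (l 1 - l 0) := by
        refine (sqrtGauge_eq_iff (by norm_num) (by linarith) (by positivity)).2 ?_
        rw [e4] at e6 hs ⊢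
        have : l 1 = 1 - l 2 - l 3 := by linarith
        rw [this] at e6 ⊢
        nlinarith
      rw [e1, tangleFold.hs.zero _ h3]
      exact ⟨⟨rfl, e5.le⟩, rfl, e5.ge⟩
  · constructor
    · rintro ⟨⟨e1, e2⟩, -, e3⟩
      have e4 : l 2 = l 3 := by linarith
      have e5 := le_antisymm e2 e3
      rw [e1, tangleFold.ht.zero _ h4] at e5
      refine ⟨e4, ?_⟩
      have := (sqrtGauge_eq_iff (by norm_num) (by linarith) (by positivity)).1 e5
      rw [← e4] at hs ⊢
      have e7 : l 0 = 1 - 2 * l 2 - l 1 := by linarith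
      rw [e7] at this ⊢
      nlinarith
    · rintro ⟨e4, e6⟩
      have e1 : l 3 - l 2 = 0 := by linarith
      have e5 : tangleFold.q * tangleFold.s (4 * l 0) (3 * (l 1 - l 0)) = 2 * (l 2 - l 1) := by
        refine (sqrtGauge_eq_iff (by norm_num) (by linarith) (by positivity)).2 ?_
        rw [← e4] at e6 hs
        have : l 0 = 1 - 2 * l 2 - l 1 := by linarith
        rw [this] at e6 ⊢
        nlinarith
      rw [e1, tangleFold.ht.zero _ h4]
      exact ⟨⟨rfl, e5.le⟩, rfl, e5.ge⟩

/-- The slope `4 - 2√2` of the face of the polyhedron that is adjacent to the edges of the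
tetrahedron. -/
noncomputable def slope : ℝ := 4 - 2 * √2

/-! ### The hyperbolic polyhedron as a cube without two skew edges -/

theorem slope_bounds : 1.17 < slope ∧ slope < 1.2 := by
  have h1 : 1.4 < √2 := Real.lt_sqrt_of_sq_lt (by norm_num)
  have h2 : √2 < 1.415 := (Real.sqrt_lt' (by norm_num)).2 (by norm_num)
  unfold slope
  constructor <;> linarith

/-- The hyperbolic polyhedron that is glued to itself to give the tangle complement. -/
def polyhedron : Set UpperHalfSpace := {p | (0 ≤ p.1 0 ∧ p.1 0 ≤ 1) ∧ (0 ≤ p.1 1 ∧ p.1 1 ≤ 3) ∧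
  -- Both hemispheres pass through the origin, where they are tangent to `x = 0` and `y = 0`. The
  -- one of radius `2` has its center at distance one from `x = 1` and from `y = 3`, so it meets
  -- them at `π/3`. The one of radius `2 - √2` has its center at distance `√2 - 1` from `x = 1`,
  -- which gives `π/4`, and is orthogonal to the first.
  slope * p.1 0 ≤ normSq p ∧ 4 * p.1 1 ≤ normSq p}

/-- With `q` the squared norm, this bounds the squared height below by `0.01 * q`. It makes the
height in `ofCube` well defined and keeps the cusp at the origin, once inverted, away from the
boundary plane. -/
theorem sq_add_sq_le {x y q : ℝ} (hx : 0 ≤ x) (hx' : x ≤ 1) (hy : 0 ≤ y) (hy' : y ≤ 3)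
    (h1 : slope * x ≤ q) (h2 : 4 * y ≤ q) : x ^ 2 + y ^ 2 ≤ 0.99 * q := by
  have hs := slope_bounds.1
  have h3 : 1.17 * x ≤ q := by nlinarith
  rcases le_total (4 * y) (1.17 * x) with h | h
  · nlinarith [mul_nonneg hx (sub_nonneg.2 hx'), mul_nonneg hy (sub_nonneg.2 h)]
  · rcases le_total y 0.2925 with h' | h'
    · nlinarith [mul_nonneg hx (sub_nonneg.2 hx'), mul_nonneg hy (sub_nonneg.2 h')]
    · nlinarith [mul_nonneg hx (sub_nonneg.2 hx'), mul_nonneg (sub_nonneg.2 hy') (sub_nonneg.2 h')]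

/-- The squared norm of the point of the polyhedron with given cube coordinates. -/
noncomputable def cubeNormSq (c : ℝ × ℝ × ℝ) : ℝ :=
  -- Found by solving the formula for the third coordinate in `cubeCoords` for the squared norm. On
  -- the cube the numerator vanishes exactly on one deleted edge and the denominator on the other,
  -- which sends these edges to the ideal points `0` and `∞`.
  (12 * (1 - c.2.2) + slope * c.1 * c.2.2) / (c.2.2 + c.2.1 * (1 - c.2.2))

/-- The map from the cube to the polyhedron. -/
noncomputable def ofCube (c : ℝ × ℝ × ℝ) : UpperHalfSpace :=
  ofCoords c.1 (c.2.1 * cubeNormSq c / 4)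
    (√(cubeNormSq c - c.1 ^ 2 - (c.2.1 * cubeNormSq c / 4) ^ 2))

/-- The map from the polyhedron to the cube. -/
noncomputable def cubeCoords (p : UpperHalfSpace) : ℝ × ℝ × ℝ :=
  (p.1 0, 4 * p.1 1 / normSq p,
    (12 - 4 * p.1 1) / (12 - 4 * p.1 1 + (normSq p - slope * p.1 0)))

theorem cube_den_pos {c : ℝ × ℝ × ℝ} (hc : c ∈ cube \ cubeTangle) :
    0 < c.2.2 + c.2.1 * (1 - c.2.2) := by
  obtain ⟨⟨⟨hx, hx'⟩, ⟨hy, hy'⟩, ⟨hz, hz'⟩⟩, hn⟩ := hc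
  have h := mul_nonneg hy (sub_nonneg.2 hz')
  refine lt_of_le_of_ne (by positivity) fun h0 => hn (Or.inr ?_)
  have h1 : c.2.2 = 0 := by linarith
  rw [h1] at h0
  exact ⟨by linarith, h1⟩

theorem slope_mul_lt {x y : ℝ} (hx : 0 ≤ x) (hx' : x ≤ 1) (hy' : y ≤ 1) : slope * x * y < 12 := by
  have h1 := slope_bounds
  have h2 : 0 ≤ slope * x := by nlinarith
  nlinarith

theorem cubeNormSq_spec {c : ℝ × ℝ × ℝ} (hc : c ∈ cube \ cubeTangle) :
    0 < cubeNormSq c ∧ cubeNormSq c - slope * c.1 = (1 - c.2.2) * (12 - slope * c.1 * c.2.1) /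
      (c.2.2 + c.2.1 * (1 - c.2.2)) ∧ 12 - c.2.1 * cubeNormSq c =
      c.2.2 * (12 - slope * c.1 * c.2.1) / (c.2.2 + c.2.1 * (1 - c.2.2)) := by
  have hd := cube_den_pos hc
  obtain ⟨⟨⟨hx, hx'⟩, ⟨hy, hy'⟩, ⟨hz, hz'⟩⟩, hn⟩ := hc
  have hs := slope_bounds
  refine ⟨div_pos ?_ hd, ?_, ?_⟩
  · have h1 : 0 ≤ slope * c.1 * c.2.2 := by
      have : 0 ≤ slope := by linarith
      positivity
    refine lt_of_le_of_ne (by linarith) fun h0 => hn (Or.inl ?_)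
    have h2 : c.2.2 = 1 := by linarith
    rw [h2] at h0
    exact ⟨by nlinarith, h2⟩
  · rw [cubeNormSq, eq_div_iff hd.ne', sub_mul, div_mul_cancel₀ _ hd.ne']
    ring
  · rw [cubeNormSq, eq_div_iff hd.ne', sub_mul, mul_assoc, div_mul_cancel₀ _ hd.ne']
    ring

theorem ofCube_spec {c : ℝ × ℝ × ℝ} (hc : c ∈ cube \ cubeTangle) :
    ofCube c ∈ polyhedron ∧ normSq (ofCube c) = cubeNormSq c ∧
      0 < cubeNormSq c - c.1 ^ 2 - (c.2.1 * cubeNormSq c / 4) ^ 2 := by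
  have hd := cube_den_pos hc
  obtain ⟨h1, h2, h3⟩ := cubeNormSq_spec hc
  obtain ⟨⟨⟨hx, hx'⟩, ⟨hy, hy'⟩, ⟨hz, hz'⟩⟩, hn⟩ := hc
  have h4 := slope_mul_lt hx hx' hy'
  have h5 : 0 ≤ cubeNormSq c - slope * c.1 := by
    rw [h2]
    exact div_nonneg (mul_nonneg (by linarith) (by linarith)) hd.le
  have h6 : 0 ≤ 12 - c.2.1 * cubeNormSq c := by
    rw [h3]
    exact div_nonneg (mul_nonneg (by linarith) (by linarith)) hd.le
  have h7 : 0 ≤ c.2.1 * cubeNormSq c / 4 := by positivity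
  have h8 : 4 * (c.2.1 * cubeNormSq c / 4) ≤ cubeNormSq c := by nlinarith
  have h9 := sq_add_sq_le hx hx' h7 (by linarith) (by linarith) h8
  have h10 : 0 < cubeNormSq c - c.1 ^ 2 - (c.2.1 * cubeNormSq c / 4) ^ 2 := by linarith
  have h11 : normSq (ofCube c) = cubeNormSq c := by
    rw [normSq, ofCube, ofCoords_zero, ofCoords_one, ofCoords_two _ _ (Real.sqrt_pos.2 h10),
      Real.sq_sqrt h10.le]
    ring
  refine ⟨?_, h11, h10⟩
  simp only [polyhedron, Set.mem_ofPred_eq, h11]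
  simp only [ofCube, ofCoords_zero, ofCoords_one]
  exact ⟨⟨hx, hx'⟩, ⟨h7, by linarith⟩, by linarith, h8⟩

theorem polyhedron_den_pos {p : UpperHalfSpace} (hp : p ∈ polyhedron) :
    0 < 12 - 4 * p.1 1 + (normSq p - slope * p.1 0) := by
  obtain ⟨⟨h1, h2⟩, ⟨h3, h4⟩, h5, h6⟩ := hp
  have := slope_bounds
  rcases eq_or_lt_of_le h4 with h | h <;> nlinarith

theorem cubeCoords_mem {p : UpperHalfSpace} (hp : p ∈ polyhedron) :
    cubeCoords p ∈ cube \ cubeTangle := by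
  have hd := polyhedron_den_pos hp
  have hq := normSq_pos p
  obtain ⟨⟨h1, h2⟩, ⟨h3, h4⟩, h5, h6⟩ := hp
  refine ⟨⟨⟨h1, h2⟩, ⟨?_, ?_⟩, ⟨?_, ?_⟩⟩, ?_⟩
  · simp only [cubeCoords]; positivity
  · simp only [cubeCoords]; rwa [div_le_one hq]
  · simp only [cubeCoords]; exact div_nonneg (by linarith) hd.le
  · simp only [cubeCoords]; rw [div_le_one hd]; linarith
  · simp only [cubeCoords, cubeTangle, Set.mem_ofPred_eq, div_eq_one_iff_eq hd.ne', div_eq_zero_iff,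
      hq.ne', hd.ne', or_false]
    rintro (⟨e1, e2⟩ | ⟨e1, e2⟩)
    · rw [e1] at e2; linarith
    · linarith

theorem ofCube_cubeCoords {p : UpperHalfSpace} (hp : p ∈ polyhedron) :
    ofCube (cubeCoords p) = p := by
  have hd := polyhedron_den_pos hp
  have hq := normSq_pos p
  have hc := cube_den_pos (cubeCoords_mem hp)
  have e : cubeNormSq (cubeCoords p) = normSq p := by
    rw [cubeNormSq, div_eq_iff hc.ne']
    simp only [cubeCoords]
    field_simp
    ring
  have e1 : 4 * p.1 1 / normSq p * normSq p / 4 = p.1 1 := by field_simp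
  have e2 : √(normSq p - p.1 0 ^ 2 - p.1 1 ^ 2) = p.1 2 := by
    rw [normSq, show p.1 0 ^ 2 + p.1 1 ^ 2 + p.1 2 ^ 2 - p.1 0 ^ 2 - p.1 1 ^ 2 = p.1 2 ^ 2 by ring,
      Real.sqrt_sq p.2.le]
  rw [ofCube, e]
  simp only [cubeCoords, e1, e2]
  exact ofCoords_eq p

theorem cubeCoords_ofCube {c : ℝ × ℝ × ℝ} (hc : c ∈ cube \ cubeTangle) :
    cubeCoords (ofCube c) = c := by
  have hd := cube_den_pos hc
  obtain ⟨h1, h2, h3⟩ := cubeNormSq_spec hc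
  obtain ⟨-, h4, -⟩ := ofCube_spec hc
  have h5 := slope_mul_lt hc.1.1.1 hc.1.1.2 hc.1.2.1.2
  have e1 : (12 - 4 * (c.2.1 * cubeNormSq c / 4)) = 12 - c.2.1 * cubeNormSq c := by ring
  have h6 : 12 - slope * c.1 * c.2.1 ≠ 0 := by linarith
  refine Prod.ext (by simp [cubeCoords, ofCube]) (Prod.ext ?_ ?_)
  · rw [cubeCoords, h4]
    simp only [ofCube, ofCoords_one]
    field_simp
  · rw [cubeCoords, h4]
    simp only [ofCube, ofCoords_one, ofCoords_zero]
    rw [e1, h2, h3]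
    field_simp
    ring

theorem continuousOn_cubeNormSq : ContinuousOn cubeNormSq (cube \ cubeTangle) := by
  unfold cubeNormSq
  exact ContinuousOn.div (by fun_prop) (by fun_prop) fun c hc => (cube_den_pos hc).ne'

theorem continuousOn_ofCube : ContinuousOn ofCube (cube \ cubeTangle) := by
  have h := continuousOn_cubeNormSq
  refine continuousOn_ofCoords (by fun_prop) (by fun_prop) (by fun_prop) fun c hc => ?_
  exact Real.sqrt_pos.2 (ofCube_spec hc).2.2

theorem continuousOn_cubeCoords : ContinuousOn cubeCoords polyhedron := by
  refine ContinuousOn.prodMk (by fun_prop) (ContinuousOn.prodMk ?_ ?_)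
  · exact ContinuousOn.div (by fun_prop) (by fun_prop) fun p _ => (normSq_pos p).ne'
  · exact ContinuousOn.div (by fun_prop) (by fun_prop) fun p hp => (polyhedron_den_pos hp).ne'

/-- The homeomorphism from the chamber without the tangle to the hyperbolic polyhedron. -/
noncomputable def toPoly (l : Fin 4 → ℝ) : UpperHalfSpace := ofCube (toCube l)

/-- The homeomorphism from the hyperbolic polyhedron to the chamber without the tangle. -/
noncomputable def ofPoly (p : UpperHalfSpace) : Fin 4 → ℝ := ofCubeChamber (cubeCoords p)

theorem toCube_mem_diff {l : Fin 4 → ℝ} (hl : l ∈ cell) : toCube l ∈ cube \ cubeTangle :=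
  ⟨toCube_mem hl.1, fun h => hl.2 ((toCube_mem_cubeTangle_iff hl.1).1 h)⟩

theorem toPoly_mem {l : Fin 4 → ℝ} (hl : l ∈ cell) : toPoly l ∈ polyhedron :=
  (ofCube_spec (toCube_mem_diff hl)).1

theorem ofPoly_mem {p : UpperHalfSpace} (hp : p ∈ polyhedron) : ofPoly p ∈ cell := by
  have h := cubeCoords_mem hp
  have h1 := ofCubeChamber_mem h.1
  refine ⟨h1, fun h2 => h.2 ?_⟩
  rw [← toCube_ofCubeChamber h.1]
  exact (toCube_mem_cubeTangle_iff h1).2 h2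

theorem ofPoly_toPoly {l : Fin 4 → ℝ} (hl : l ∈ cell) : ofPoly (toPoly l) = l := by
  rw [ofPoly, toPoly, cubeCoords_ofCube (toCube_mem_diff hl), ofCubeChamber_toCube hl.1]

theorem toPoly_ofPoly {p : UpperHalfSpace} (hp : p ∈ polyhedron) : toPoly (ofPoly p) = p := by
  rw [ofPoly, toPoly, toCube_ofCubeChamber (cubeCoords_mem hp).1, ofCube_cubeCoords hp]

theorem continuousOn_toPoly : ContinuousOn toPoly cell :=
  continuousOn_ofCube.comp (continuousOn_toCube.mono Set.sdiff_subset) fun _ => toCube_mem_diff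

theorem continuousOn_ofPoly : ContinuousOn ofPoly polyhedron :=
  continuousOn_ofCubeChamber.comp continuousOn_cubeCoords fun _ hp => (cubeCoords_mem hp).1

/-- The disjunctions record the two walls divided by the tangle. The inequality that distinguishes
the two parts is absorbed by totality of the order. -/
theorem toPoly_walls {l : Fin 4 → ℝ} (hl : l ∈ cell) :
    (l 0 = 0 ↔ (toPoly l).1 0 = 0 ∨ normSq (toPoly l) = slope * (toPoly l).1 0) ∧
    (l 0 = l 1 ↔ (toPoly l).1 0 = 1) ∧ (l 1 = l 2 ↔ normSq (toPoly l) = 4 * (toPoly l).1 1) ∧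
    (l 2 = l 3 ↔ (toPoly l).1 1 = 0 ∨ (toPoly l).1 1 = 3) := by
  have hp := toPoly_mem hl
  have hd := polyhedron_den_pos hp
  have hq := normSq_pos (toPoly l)
  have hc : cubeCoords (toPoly l) = toCube l := cubeCoords_ofCube (toCube_mem_diff hl)
  obtain ⟨h1, h2, h3, h4, h5⟩ := chamber_coords hl.1
  have h6 : (0 : ℝ) < 4 * l 0 + (l 3 - l 2) + 3 * (l 1 - l 0) + 2 * (l 2 - l 1) := by linarith
  have ex : (toPoly l).1 0 = (toCube l).1 := by rw [← hc]; rfl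
  have ey : 4 * (toPoly l).1 1 / normSq (toPoly l) = (toCube l).2.1 := by rw [← hc]; rfl
  have ez : (12 - 4 * (toPoly l).1 1) / (12 - 4 * (toPoly l).1 1 + (normSq (toPoly l) -
    slope * (toPoly l).1 0)) = (toCube l).2.2 := by rw [← hc]; rfl
  have x0 := FoldData.x_eq_zero_iff (F := tangleFold) h1 h2 h3 h4 h6
  have x1 := FoldData.x_eq_one_iff (F := tangleFold) h1 h2 h3 h4 h6
  have y0 := FoldData.y_eq_zero_iff (F := tangleFold) h1 h2 h3 h4 h6
  have y1 := FoldData.y_eq_one_iff (F := tangleFold) h1 h2 h3 h4 h6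
  have z0 := FoldData.z_eq_zero_iff (F := tangleFold) h1 h2 h3 h4 h6
  have z1 := FoldData.z_eq_one_iff (F := tangleFold) h1 h2 h3 h4 h6
  have cx0 : (toPoly l).1 0 = 0 ↔ (toCube l).1 = 0 := by rw [ex]
  have cx1 : (toPoly l).1 0 = 1 ↔ (toCube l).1 = 1 := by rw [ex]
  have cy0 : (toPoly l).1 1 = 0 ↔ (toCube l).2.1 = 0 := by simp [← ey, hq.ne']
  have cy1 : normSq (toPoly l) = 4 * (toPoly l).1 1 ↔ (toCube l).2.1 = 1 := by
    rw [← ey, div_eq_one_iff_eq hq.ne', eq_comm]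
  have cz0 : (toPoly l).1 1 = 3 ↔ (toCube l).2.2 = 0 := by
    rw [← ez, div_eq_zero_iff, or_iff_left hd.ne']
    constructor <;> intro <;> linarith
  have cz1 : normSq (toPoly l) = slope * (toPoly l).1 0 ↔ (toCube l).2.2 = 1 := by
    rw [← ez, div_eq_one_iff_eq hd.ne']
    constructor <;> intro <;> linarith
  rw [cx0, cx1, cy0, cy1, cz0, cz1]
  simp only [toCube, x0, x1, y0, y1, z0, z1]
  refine ⟨?_, ?_, ?_, ?_⟩
  · rw [← and_or_left, and_iff_left (le_total _ _)]
    constructor <;> intro <;> linarith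
  · constructor <;> intro <;> linarith
  · constructor <;> intro <;> linarith
  · rw [← and_or_left, and_iff_left (le_total _ _)]
    constructor <;> intro <;> linarith

end TetTangle

/-! ### Barycentric coordinates on the tetrahedron -/

namespace TetTangle

/-- The barycentric coordinates of a point of Euclidean space. -/
noncomputable def bary (p : E3) (i : Fin 4) : ℝ := 2 * inner ℝ p (vertex i) + 1 / 4

theorem bary_eq (p : E3) : bary p = ![√2 / 2 * (p 0 + p 1 + p 2) + 1 / 4,
    √2 / 2 * (p 0 - p 1 - p 2) + 1 / 4, √2 / 2 * (-p 0 + p 1 - p 2) + 1 / 4,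
    √2 / 2 * (-p 0 - p 1 + p 2) + 1 / 4] := by
  ext i
  fin_cases i <;>
    simp [bary, vertex, PiLp.inner_apply, Fin.sum_univ_three, inner_smul_right] <;> ring

theorem sum_bary (p : E3) : ∑ i, bary p i = 1 := by
  rw [bary_eq, Fin.sum_univ_four]
  simp
  ring

theorem sum_bary_smul (p : E3) : ∑ i, bary p i • vertex i = p := by
  have h2 : √2 * √2 = 2 := Real.mul_self_sqrt (by norm_num)
  rw [bary_eq, Fin.sum_univ_four]
  ext j
  fin_cases j <;> simp [vertex]
  · linear_combination (p 0 / 2) * h2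
  · linear_combination (p 1 / 2) * h2
  · linear_combination (p 2 / 2) * h2

theorem inner_vertex (i j : Fin 4) :
    inner ℝ (vertex i) (vertex j) = if i = j then (3 / 8 : ℝ) else -1 / 8 := by
  have h2 : √2 * √2 = 2 := Real.mul_self_sqrt (by norm_num)
  rw [PiLp.inner_apply, Fin.sum_univ_three]
  fin_cases i <;> fin_cases j <;> simp [vertex, div_pow, sq_abs] <;> nlinarith

theorem bary_sum_smul {w : Fin 4 → ℝ} (hw : ∑ i, w i = 1) : bary (∑ i, w i • vertex i) = w := by
  ext j
  simp only [bary, sum_inner, inner_smul_left, inner_vertex, RCLike.conj_to_real]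
  rw [Fin.sum_univ_four] at *
  fin_cases j <;> simp <;> linarith

theorem bary_combo (p q : E3) {a b : ℝ} (h : a + b = 1) (i : Fin 4) :
    bary (a • p + b • q) i = a * bary p i + b * bary q i := by
  simp only [bary, inner_add_left, inner_smul_left, RCLike.conj_to_real]
  linear_combination (-1 / 4) * h

theorem dist_sq_eq_bary (p q : E3) : dist p q ^ 2 = 1 / 2 * ∑ i, (bary p i - bary q i) ^ 2 := by
  have h2 : √2 * √2 = 2 := Real.mul_self_sqrt (by norm_num)
  rw [EuclideanSpace.dist_eq, Real.sq_sqrt (by positivity), Fin.sum_univ_three, bary_eq, bary_eq,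
    Fin.sum_univ_four]
  simp only [Real.dist_eq, sq_abs, Matrix.cons_val_zero, Matrix.cons_val_one, Matrix.cons_val]
  linear_combination (-(1 / 2) * ((p 0 - q 0) ^ 2 + (p 1 - q 1) ^ 2 + (p 2 - q 2) ^ 2)) * h2

theorem bary_vertex (i j : Fin 4) : bary (vertex i) j = if i = j then 1 else 0 := by
  rw [bary, inner_vertex]
  split_ifs <;> norm_num

theorem convex_bary : Convex ℝ {p : E3 | ∀ i, 0 ≤ bary p i} := by
  intro p hp q hq a b ha hb hab i
  rw [bary_combo p q hab]
  exact add_nonneg (mul_nonneg ha (hp i)) (mul_nonneg hb (hq i))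

theorem mem_tet_iff {p : E3} : p ∈ tet ↔ ∀ i, 0 ≤ bary p i := by
  constructor
  · intro hp
    refine convexHull_min ?_ convex_bary hp
    rintro _ ⟨j, rfl⟩ i
    rw [bary_vertex]
    split_ifs <;> norm_num
  · intro hp
    rw [← sum_bary_smul p]
    exact (convex_convexHull ℝ _).sum_mem (fun i _ => hp i) (sum_bary p)
      fun i _ => subset_convexHull ℝ _ ⟨i, rfl⟩

theorem mem_face_iff {p : E3} {i : Fin 4} : p ∈ face i ↔ p ∈ tet ∧ bary p i = 0 := by
  constructor
  · intro hp
    refine ⟨convexHull_mono (Set.image_subset_range _ _) hp, ?_⟩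
    have hc : Convex ℝ {p : E3 | bary p i = 0} := by
      intro p hp q hq a b _ _ hab
      have hp' : bary p i = 0 := hp
      have hq' : bary q i = 0 := hq
      show bary _ i = 0
      rw [bary_combo p q hab, hp', hq']
      ring
    refine convexHull_min ?_ hc hp
    rintro _ ⟨j, hj, rfl⟩
    show bary _ i = 0
    rw [bary_vertex, if_neg (by simpa using hj)]
  · rintro ⟨hp, h0⟩
    rw [mem_tet_iff] at hp
    have h1 : ∑ j ∈ {i}ᶜ, bary p j • vertex j = p := by
      have := sum_bary_smul p
      rwa [← Finset.sum_compl_add_sum {i}, Finset.sum_singleton, h0, zero_smul, add_zero] at this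
    have h2 : ∑ j ∈ {i}ᶜ, bary p j = 1 := by
      rw [← sum_bary p, ← Finset.sum_compl_add_sum {i}, Finset.sum_singleton, h0, add_zero]
    rw [← h1]
    refine (convex_convexHull ℝ _).sum_mem (fun j _ => hp j) h2 fun j hj => ?_
    refine subset_convexHull ℝ _ ⟨j, ?_, rfl⟩
    simpa using hj

theorem bary_eq_zero_of_mem_affineSpan {p : E3} {i : Fin 4}
    (hp : p ∈ affineSpan ℝ (vertex '' {i}ᶜ)) : bary p i = 0 := by
  induction hp using affineSpan_induction' with
  | mem x hx =>
    obtain ⟨j, hj, rfl⟩ := hx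
    rw [bary_vertex, if_neg (by simpa using hj)]
  | smul_vsub_vadd c u _ v _ w _ hu hv hw =>
    simp only [bary, vsub_eq_sub, vadd_eq_add, inner_add_left, inner_smul_left, inner_sub_left,
      RCLike.conj_to_real] at *
    linear_combination c * hu - c * hv + hw

theorem bary_faceCenter (i j : Fin 4) : bary (faceCenter i) j = if i = j then 0 else 1 / 3 := by
  have : faceCenter i = ∑ k, (if i = k then 0 else 1 / 3 : ℝ) • vertex k := by
    rw [faceCenter, ← Finset.sum_compl_add_sum {i}, Finset.sum_singleton, if_pos rfl, zero_smul,
      add_zero, Finset.smul_sum]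
    refine Finset.sum_congr rfl fun k hk => ?_
    rw [if_neg fun h => (by simpa using hk : k ≠ i) h.symm]
  rw [this, bary_sum_smul]
  rw [Fin.sum_univ_four]
  fin_cases i <;> simp <;> norm_num

theorem bary_midpoint (i j k : Fin 4) : bary (midpoint ℝ (vertex i) (vertex j)) k =
    ((if i = k then 1 else 0) + if j = k then 1 else 0) / 2 := by
  rw [midpoint_eq_smul_add, smul_add, bary_combo _ _ (by norm_num), bary_vertex, bary_vertex]
  simp only [invOf_eq_inv]
  ring

/-- The constant is `11/24 = 1/3 + 2 * (1/4)²`, where `1/3` is the sum of squares at the barycenter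
of the face. -/
theorem mem_faceCircle_iff {p : E3} (hp : p ∈ tet) (i : Fin 4) :
    p ∈ faceCircle i ↔ bary p i = 0 ∧ ∑ j, bary p j ^ 2 = 11 / 24 := by
  have hs := sum_bary p
  have h1 : p ∈ affineSpan ℝ (vertex '' {i}ᶜ) ↔ bary p i = 0 :=
    ⟨bary_eq_zero_of_mem_affineSpan, fun h =>
      convexHull_subset_affineSpan _ (mem_face_iff.2 ⟨hp, h⟩)⟩
  rw [faceCircle, Set.mem_ofPred_eq, h1]
  refine and_congr_right fun h0 => ?_
  rw [← pow_left_inj₀ dist_nonneg (by norm_num) two_ne_zero, dist_sq_eq_bary]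
  simp only [bary_faceCenter]
  rw [Fin.sum_univ_four] at *
  rw [Fin.sum_univ_four]
  fin_cases i <;> simp at h0 ⊢ <;> rw [h0] at hs ⊢ <;> constructor <;> intro h <;> nlinarith

/-- The constant is `-15/32 = 2 * (1/8)² - 1/2`. -/
theorem mem_edgeArc_iff {p : E3} (hp : p ∈ tet) {i j : Fin 4} (hij : i ≠ j) :
    p ∈ edgeArc i j ↔ bary p i = bary p j ∧
      ∑ k, bary p k ^ 2 = bary p i + bary p j - 15 / 32 := by
  have hs := sum_bary p
  have h1 : inner ℝ (p - midpoint ℝ (vertex i) (vertex j)) (vertex j - vertex i) = 0 ↔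
      bary p i = bary p j := by
    have e1 := bary_midpoint i j i
    have e2 := bary_midpoint i j j
    rw [if_pos rfl, if_neg hij.symm, bary] at e1
    rw [if_neg hij, if_pos rfl, bary] at e2
    rw [inner_sub_left, inner_sub_right, inner_sub_right, bary, bary]
    constructor <;> intro <;> linarith
  rw [edgeArc, Set.mem_ofPred_eq, h1, and_iff_right hp, and_comm]
  refine and_congr_right fun h0 => ?_
  rw [← pow_left_inj₀ dist_nonneg (by norm_num) two_ne_zero, dist_sq_eq_bary]
  have e : ∑ k, (bary p k - bary (midpoint ℝ (vertex i) (vertex j)) k) ^ 2 =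
      ∑ k, bary p k ^ 2 - bary p i - bary p j + 1 / 2 := by
    simp only [bary_midpoint, Fin.sum_univ_four]
    fin_cases i <;> fin_cases j <;> first | exact absurd rfl hij | (simp; ring)
  rw [e]
  constructor <;> intro h <;> linarith

/-- The complement of the tangle in barycentric coordinates. -/
def baryComplement : Set (Fin 4 → ℝ) := {w | ∃ σ : Equiv.Perm (Fin 4), w ∘ σ ∈ cell}

theorem sum_comp_perm (w : Fin 4 → ℝ) (σ : Equiv.Perm (Fin 4)) (f : ℝ → ℝ) :
    ∑ i, f ((w ∘ σ) i) = ∑ i, f (w i) := Equiv.sum_comp σ fun i => f (w i)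

/-- The arcs are so close to their edges that the two coordinates other than the equal ones have sum
at most `1/4`. The equal ones are then the two largest, so only one of the six arcs has to be
considered in the chamber. -/
theorem arc_iff_sorted {l : Fin 4 → ℝ} (hl : l ∈ chamber) :
    (∃ i j, i ≠ j ∧ l i = l j ∧ ∑ k, l k ^ 2 = l i + l j - 15 / 32) ↔
      l 2 = l 3 ∧ ∑ k, l k ^ 2 = l 2 + l 3 - 15 / 32 := by
  refine ⟨?_, fun h => ⟨2, 3, by decide, h⟩⟩
  obtain ⟨hm, h0, hs⟩ := hl
  rw [monotone_iff] at hm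
  obtain ⟨h1, h2, h3⟩ := hm
  rw [Fin.sum_univ_four] at hs ⊢
  have key : ∀ a b c : ℝ, 0 ≤ b → 0 ≤ c → a + a + b + c = 1 →
      a ^ 2 + a ^ 2 + b ^ 2 + c ^ 2 = a + a - 15 / 32 → b < a ∧ c < a := by
    intro a b c hb hc e1 e2
    have e3 : a = (1 - b - c) / 2 := by linarith
    have e4 : b + c ≤ 1 / 4 := by
      rw [e3] at e2
      nlinarith [sq_nonneg (b + c), sq_nonneg (b - c)]
    constructor <;> linarith
  rintro ⟨i, j, hij, e1, e2⟩
  fin_cases i <;> fin_cases j <;> simp only [Fin.zero_eta, Fin.mk_one, Fin.reduceFinMk, Fin.isValue,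
    ne_eq, not_true_eq_false] at hij e1 e2
  · rw [← e1] at e2 hs
    have := key (l 0) (l 2) (l 3) (by linarith) (by linarith) (by linarith) (by linarith)
    linarith
  · rw [← e1] at e2 hs
    have := key (l 0) (l 1) (l 3) (by linarith) (by linarith) (by linarith) (by linarith)
    linarith
  · rw [← e1] at e2 hs
    have := key (l 0) (l 1) (l 2) (by linarith) (by linarith) (by linarith) (by linarith)
    linarith
  · rw [e1] at e2 hs
    have := key (l 0) (l 2) (l 3) (by linarith) (by linarith) (by linarith) (by linarith)
    linarith
  · rw [← e1] at e2 hs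
    have := key (l 1) (l 0) (l 3) (by linarith) (by linarith) (by linarith) (by linarith)
    linarith
  · rw [← e1] at e2 hs
    have := key (l 1) (l 0) (l 2) (by linarith) (by linarith) (by linarith) (by linarith)
    linarith
  · rw [e1] at e2 hs
    have := key (l 0) (l 1) (l 3) (by linarith) (by linarith) (by linarith) (by linarith)
    linarith
  · rw [e1] at e2 hs
    have := key (l 1) (l 0) (l 3) (by linarith) (by linarith) (by linarith) (by linarith)
    linarith
  · exact ⟨e1, e2⟩
  · rw [e1] at e2 hs
    have := key (l 0) (l 1) (l 2) (by linarith) (by linarith) (by linarith) (by linarith)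
    linarith
  · rw [e1] at e2 hs
    have := key (l 1) (l 0) (l 2) (by linarith) (by linarith) (by linarith) (by linarith)
    linarith
  · exact ⟨e1.symm, by linarith⟩

theorem tangle_iff_sorted {w : Fin 4 → ℝ} {σ : Equiv.Perm (Fin 4)} (h : w ∘ σ ∈ chamber) :
    (∃ i, w i = 0 ∧ ∑ j, w j ^ 2 = 11 / 24) ∨
      (∃ i j, i ≠ j ∧ w i = w j ∧ ∑ k, w k ^ 2 = w i + w j - 15 / 32) ↔
      w ∘ σ ∈ chamberTangle := by
  rw [chamberTangle, Set.mem_ofPred_eq, ← arc_iff_sorted h, sum_comp_perm w σ (fun x => x ^ 2)]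
  apply or_congr
  · constructor
    · rintro ⟨i, h1, h2⟩
      refine ⟨le_antisymm ?_ h.2.1, h2⟩
      have := h.1 (Fin.zero_le (σ.symm i))
      simpa [h1] using this
    · rintro ⟨h1, h2⟩
      exact ⟨_, h1, h2⟩
  · constructor
    · rintro ⟨i, j, h1, h2, h3⟩
      exact ⟨σ.symm i, σ.symm j, fun h => h1 (σ.symm.injective h), by simpa using h2,
        by simpa using h3⟩
    · rintro ⟨i, j, h1, h2, h3⟩
      exact ⟨σ i, σ j, fun h => h1 (σ.injective h), h2, h3⟩

theorem mem_tangle_iff {p : E3} (hp : p ∈ tet) : p ∈ tangle ↔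
    (∃ i, bary p i = 0 ∧ ∑ j, bary p j ^ 2 = 11 / 24) ∨
      ∃ i j, i ≠ j ∧ bary p i = bary p j ∧
        ∑ k, bary p k ^ 2 = bary p i + bary p j - 15 / 32 := by
  simp only [tangle, Set.mem_union, Set.mem_iUnion, mem_faceCircle_iff hp]
  refine or_congr Iff.rfl ⟨?_, ?_⟩
  · rintro ⟨i, j, hij, h⟩
    exact ⟨i, j, hij, (mem_edgeArc_iff hp hij).1 h⟩
  · rintro ⟨i, j, hij, h⟩
    exact ⟨i, j, hij, (mem_edgeArc_iff hp hij).2 h⟩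

theorem bary_mem_iff (p : E3) : bary p ∈ baryComplement ↔ p ∈ tet \ tangle := by
  constructor
  · rintro ⟨σ, hσ⟩
    have hp : p ∈ tet := by
      rw [mem_tet_iff]
      intro i
      have := hσ.1.2.1.trans (hσ.1.1 (Fin.zero_le (σ.symm i)))
      simpa using this
    refine ⟨hp, fun ht => hσ.2 ?_⟩
    rw [mem_tangle_iff hp] at ht
    exact (tangle_iff_sorted hσ.1).1 ht
  · rintro ⟨hp, ht⟩
    rw [mem_tangle_iff hp] at ht
    have hc : bary p ∘ Tuple.sort (bary p) ∈ chamber :=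
      ⟨Tuple.monotone_sort _, mem_tet_iff.1 hp _, by
        rw [sum_comp_perm _ _ fun x => x]; exact sum_bary p⟩
    exact ⟨_, hc, fun h => ht ((tangle_iff_sorted hc).2 h)⟩

theorem continuous_bary : Continuous bary := by
  unfold bary
  fun_prop

/-- Barycentric coordinates as a homeomorphism. -/
noncomputable def baryHomeomorph : baryComplement ≃ₜ Complement where
  toFun w := ⟨∑ i, w.1 i • vertex i, by
    obtain ⟨σ, hσ⟩ := w.2
    have h1 : ∑ i, w.1 i = 1 := by rw [← sum_comp_perm w.1 σ fun x => x]; exact hσ.1.2.2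
    rw [← bary_mem_iff, bary_sum_smul h1]
    exact w.2⟩
  invFun p := ⟨bary p.1, (bary_mem_iff _).2 p.2⟩
  left_inv w := by
    obtain ⟨σ, hσ⟩ := w.2
    have h1 : ∑ i, w.1 i = 1 := by rw [← sum_comp_perm w.1 σ fun x => x]; exact hσ.1.2.2
    exact Subtype.ext (bary_sum_smul h1)
  right_inv p := Subtype.ext (sum_bary_smul p.1)
  continuous_toFun := by
    refine Continuous.subtype_mk (continuous_finsetSum _ fun i _ => ?_) _
    exact ((continuous_apply i).comp continuous_subtype_val).smul continuous_const
  continuous_invFun := (continuous_bary.comp continuous_subtype_val).subtype_mk _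

theorem baryHomeomorph_mem_boundaryFace {w : baryComplement} {i : Fin 4} :
    baryHomeomorph w ∈ boundaryFace i ↔ w.1 i = 0 := by
  have h : bary (baryHomeomorph w).1 = w.1 := congrArg Subtype.val (baryHomeomorph.left_inv w)
  rw [boundaryFace, Set.mem_ofPred_eq, mem_face_iff, h, and_iff_right (baryHomeomorph w).2.1]

end TetTangle

namespace TetTangle

open UpperHalfSpace Filter Topology

/-! ### Folding the tangle complement onto the polyhedron -/

theorem continuousOn_of_finite_closed_cover {α β ι : Type*} [TopologicalSpace α]
    [TopologicalSpace β] [Finite ι] {f : α → β} {s : Set α} {c : ι → Set α}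
    (hc : ∀ i, IsClosed (c i)) (hs : ∀ x ∈ s, ∃ i, x ∈ c i)
    (hf : ∀ i, ContinuousOn f (s ∩ c i)) : ContinuousOn f s := by
  intro x hx
  have h1 : s = ⋃ i, s ∩ c i := by
    ext y
    simp only [Set.mem_iUnion, Set.mem_inter_iff, exists_and_left]
    exact ⟨fun h => ⟨h, hs y h⟩, fun h => h.1⟩
  rw [ContinuousWithinAt, h1, nhdsWithin_iUnion, tendsto_iSup]
  intro i
  by_cases h : x ∈ c i
  · exact hf i x ⟨hx, h⟩
  · have : 𝓝[s ∩ c i] x = ⊥ := by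
      rw [← notMem_closure_iff_nhdsWithin_eq_bot]
      exact fun h' => h ((hc i).closure_subset_iff.2 Set.inter_subset_right h')
    rw [this]
    exact tendsto_bot

theorem isClosed_monotone_comp (σ : Equiv.Perm (Fin 4)) :
    IsClosed {w : Fin 4 → ℝ | Monotone (w ∘ σ)} := by
  simp only [monotone_iff, Set.ofPred_and, Function.comp_apply]
  exact (isClosed_le (by fun_prop) (by fun_prop)).inter
    ((isClosed_le (by fun_prop) (by fun_prop)).inter (isClosed_le (by fun_prop) (by fun_prop)))

theorem comp_mem_cell {w : Fin 4 → ℝ} (hw : w ∈ baryComplement) {σ : Equiv.Perm (Fin 4)}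
    (hσ : Monotone (w ∘ σ)) : w ∘ σ ∈ cell := by
  obtain ⟨τ, hτ⟩ := hw
  rwa [Tuple.unique_monotone hσ hτ.1.1]

/-- The point of the polyhedron below a point of the tangle complement. -/
noncomputable def fold (w : Fin 4 → ℝ) : UpperHalfSpace := toPoly (w ∘ Tuple.sort w)

/-- Ties make the sorting permutation ambiguous but not the sorted tuple, so the definitions on
different chambers agree on the mirrors. -/
theorem fold_eq {w : Fin 4 → ℝ} {σ : Equiv.Perm (Fin 4)} (hσ : Monotone (w ∘ σ)) :
    fold w = toPoly (w ∘ σ) := by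
  rw [fold, Tuple.unique_monotone hσ (Tuple.monotone_sort w)]

theorem fold_mem {w : Fin 4 → ℝ} (hw : w ∈ baryComplement) : fold w ∈ polyhedron :=
  toPoly_mem (comp_mem_cell hw (Tuple.monotone_sort w))

theorem ofPoly_fold {w : Fin 4 → ℝ} (hw : w ∈ baryComplement) {σ : Equiv.Perm (Fin 4)}
    (hσ : Monotone (w ∘ σ)) : ofPoly (fold w) = w ∘ σ := by
  rw [fold_eq hσ, ofPoly_toPoly (comp_mem_cell hw hσ)]

theorem continuousOn_fold : ContinuousOn fold baryComplement := by
  refine continuousOn_of_finite_closed_cover isClosed_monotone_comp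
    (fun w _ => ⟨_, Tuple.monotone_sort w⟩) fun σ => ?_
  have : ContinuousOn (fun w : Fin 4 → ℝ => toPoly (w ∘ σ))
      (baryComplement ∩ {w | Monotone (w ∘ σ)}) :=
    continuousOn_toPoly.comp (by fun_prop) fun w hw => comp_mem_cell hw.1 hw.2
  exact this.congr fun w hw => fold_eq hw.2

/-- The point of a chamber of the tangle complement that corresponds to a point of the
polyhedron. -/
noncomputable def unfold (σ : Equiv.Perm (Fin 4)) (p : UpperHalfSpace) : Fin 4 → ℝ :=
  ofPoly p ∘ σ.symm

theorem unfold_comp (σ : Equiv.Perm (Fin 4)) (p : UpperHalfSpace) :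
    unfold σ p ∘ σ = ofPoly p := by
  ext i
  simp [unfold]

theorem unfold_mem (σ : Equiv.Perm (Fin 4)) {p : UpperHalfSpace} (hp : p ∈ polyhedron) :
    unfold σ p ∈ baryComplement := ⟨σ, by rw [unfold_comp]; exact ofPoly_mem hp⟩

theorem fold_unfold (σ : Equiv.Perm (Fin 4)) {p : UpperHalfSpace} (hp : p ∈ polyhedron) :
    fold (unfold σ p) = p := by
  have h : Monotone (unfold σ p ∘ σ) := by rw [unfold_comp]; exact (ofPoly_mem hp).1.1
  rw [fold_eq h, unfold_comp, toPoly_ofPoly hp]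

theorem unfold_fold {w : Fin 4 → ℝ} (hw : w ∈ baryComplement) {σ : Equiv.Perm (Fin 4)}
    (hσ : Monotone (w ∘ σ)) : unfold σ (fold w) = w := by
  ext i
  simp [unfold, ofPoly_fold hw hσ]

theorem continuousOn_unfold (σ : Equiv.Perm (Fin 4)) : ContinuousOn (unfold σ) polyhedron := by
  have : Continuous fun w : Fin 4 → ℝ => w ∘ σ.symm := by fun_prop
  exact this.comp_continuousOn continuousOn_ofPoly

/-! ### The path metric -/

/-- There is a path of length at most `l` from `x` to `y`. -/
def Reach (x y : baryComplement) (l : ℝ) : Prop :=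
  -- Length is measured after folding, since the complement carries no hyperbolic metric yet. A path
  -- that is 1-Lipschitz after folding has length at most `l` over `[0, l]`.
  0 ≤ l ∧ ∃ f : ℝ → baryComplement, Continuous f ∧ f 0 = x ∧ f l = y ∧
    ∀ s t, hdist (fold (f s).1) (fold (f t).1) ≤ |s - t|

theorem Reach.refl (x : baryComplement) : Reach x x 0 :=
  ⟨le_rfl, fun _ => x, continuous_const, rfl, rfl, by simp⟩

theorem Reach.symm {x y : baryComplement} {l : ℝ} (h : Reach x y l) : Reach y x l := by
  obtain ⟨h0, f, hf, h1, h2, h3⟩ := h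
  refine ⟨h0, fun t => f (l - t), by fun_prop, by simpa using h2, by simpa using h1,
    fun s t => (h3 _ _).trans_eq ?_⟩
  rw [sub_sub_sub_cancel_left, abs_sub_comm]

theorem Reach.trans {x y z : baryComplement} {l m : ℝ} (h : Reach x y l) (h' : Reach y z m) :
    Reach x z (l + m) := by
  obtain ⟨h0, f, hf, h1, h2, h3⟩ := h
  obtain ⟨h0', g, hg, h1', h2', h3'⟩ := h'
  have key : ∀ s t, s ≤ l → ¬t ≤ l →
      hdist (fold (f s).1) (fold (g (t - l)).1) ≤ |s - t| := by
    intro s t hs ht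
    push Not at ht
    have e1 := h3 s l
    have e2 := h3' 0 (t - l)
    rw [h1', ← h2] at e2
    refine (hdist_triangle _ _ _).trans ((add_le_add e1 e2).trans ?_)
    rw [abs_of_nonpos (by linarith), abs_of_nonpos (by linarith), abs_of_nonpos (by linarith)]
    linarith
  refine ⟨by linarith, fun t => if t ≤ l then f t else g (t - l), ?_, by simp [h0, h1], ?_, ?_⟩
  · refine Continuous.if_le hf (by fun_prop) continuous_id continuous_const fun t ht => ?_
    rw [ht, sub_self, h1', h2]
  · rcases eq_or_lt_of_le h0' with h | h
    · rw [← h] at h2'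
      simp [← h, h2, ← h2', h1']
    · simp [h, h2']
  · intro s t
    dsimp only
    split_ifs with hs ht ht
    · exact h3 s t
    · exact key s t hs ht
    · rw [hdist_comm, abs_sub_comm]
      exact key t s ht hs
    · refine (h3' _ _).trans_eq ?_
      rw [sub_sub_sub_cancel_right]

theorem Reach.hdist_fold_le {x y : baryComplement} {l : ℝ} (h : Reach x y l) :
    hdist (fold x.1) (fold y.1) ≤ l := by
  obtain ⟨h0, f, -, h1, h2, h3⟩ := h
  have := h3 0 l
  rwa [h1, h2, zero_sub, abs_neg, abs_of_nonneg h0] at this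

/-- The polyhedron is an intersection of half-spaces, hence convex, so the geodesic can be drawn
inside one chamber. -/
theorem reach_unfold (σ : Equiv.Perm (Fin 4)) {p q : UpperHalfSpace} (hp : p ∈ polyhedron)
    (hq : q ∈ polyhedron) :
    Reach ⟨unfold σ p, unfold_mem σ hp⟩ ⟨unfold σ q, unfold_mem σ hq⟩ (hdist p q) := by
  obtain ⟨γ, hc, h0, h1, h2, h3, -⟩ := exists_geodesic p q
  have hγ : ∀ t, γ t ∈ polyhedron := by
    intro t
    obtain ⟨⟨a1, a2⟩, ⟨a3, a4⟩, a5, a6⟩ := hp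
    obtain ⟨⟨b1, b2⟩, ⟨b3, b4⟩, b5, b6⟩ := hq
    have c1 := h3 t 0 (-1) 0 0 (by linarith) (by linarith)
    have c2 := h3 t 0 1 0 (-1) (by linarith) (by linarith)
    have c3 := h3 t 0 0 (-1) 0 (by linarith) (by linarith)
    have c4 := h3 t 0 0 1 (-3) (by linarith) (by linarith)
    have c5 := h3 t (-1) slope 0 0 (by linarith) (by linarith)
    have c6 := h3 t (-1) 0 4 0 (by linarith) (by linarith)
    exact ⟨⟨by linarith, by linarith⟩, ⟨by linarith, by linarith⟩, by linarith, by linarith⟩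
  refine ⟨hdist_nonneg p q, fun t => ⟨unfold σ (γ t), unfold_mem σ (hγ t)⟩, ?_, ?_, ?_, ?_⟩
  · refine Continuous.subtype_mk ?_ _
    exact (continuousOn_unfold σ).comp_continuous hc hγ
  · simp [h0]
  · simp [h1]
  · intro s t
    simp only [fold_unfold σ (hγ _)]
    exact h2 s t

/-- The barycenter of the tetrahedron. -/
noncomputable def center : Fin 4 → ℝ := fun _ => 1 / 4

theorem center_mem : center ∈ cell := by
  refine ⟨⟨monotone_const, by norm_num [center], by norm_num [center]⟩, ?_⟩
  rintro (⟨h, -⟩ | ⟨-, h⟩)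
  · norm_num [center] at h
  · norm_num [center] at h

/-- All chambers contain the barycenter of the tetrahedron, through which any two points can be
joined. -/
theorem exists_reach (x y : baryComplement) : ∃ l, Reach x y l := by
  have hc := toPoly_mem center_mem
  have h : ∀ z : baryComplement, Reach z ⟨center, 1, center_mem⟩
      (hdist (fold z.1) (toPoly center)) := by
    intro z
    have h1 := Tuple.monotone_sort z.1
    have h2 := reach_unfold (Tuple.sort z.1) (fold_mem z.2) hc
    have h3 : unfold (Tuple.sort z.1) (toPoly center) = center := by
      rw [unfold, ofPoly_toPoly center_mem]
      rfl
    simpa only [unfold_fold z.2 h1, h3] using h2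
  exact ⟨_, (h x).trans (h y).symm⟩

/-- The infimum of the lengths of paths. -/
noncomputable def pathDist (x y : baryComplement) : ℝ := sInf {l | Reach x y l}

theorem bddBelow_reach (x y : baryComplement) : BddBelow {l | Reach x y l} :=
  ⟨0, fun _ h => h.1⟩

theorem pathDist_le {x y : baryComplement} {l : ℝ} (h : Reach x y l) : pathDist x y ≤ l :=
  csInf_le (bddBelow_reach x y) h

theorem exists_reach_lt {x y : baryComplement} {l : ℝ} (h : pathDist x y < l) :
    ∃ m < l, Reach x y m := by
  obtain ⟨m, hm, hl⟩ := exists_lt_of_csInf_lt (exists_reach x y) h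
  exact ⟨m, hl, hm⟩

theorem le_pathDist {x y : baryComplement} {l : ℝ} (h : ∀ m, Reach x y m → l ≤ m) :
    l ≤ pathDist x y := le_csInf (exists_reach x y) h

theorem pathDist_self (x : baryComplement) : pathDist x x = 0 :=
  le_antisymm (pathDist_le (Reach.refl x)) (le_pathDist fun _ h => h.1)

theorem pathDist_comm (x y : baryComplement) : pathDist x y = pathDist y x :=
  le_antisymm (le_pathDist fun _ h => pathDist_le h.symm)
    (le_pathDist fun _ h => pathDist_le h.symm)

theorem pathDist_triangle (x y z : baryComplement) :
    pathDist x z ≤ pathDist x y + pathDist y z := by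
  refine le_of_forall_pos_lt_add fun ε hε => ?_
  obtain ⟨l, hl, h⟩ := exists_reach_lt (lt_add_of_pos_right (pathDist x y) (half_pos hε))
  obtain ⟨m, hm, h'⟩ := exists_reach_lt (lt_add_of_pos_right (pathDist y z) (half_pos hε))
  have := pathDist_le (h.trans h')
  linarith

theorem hdist_fold_le_pathDist (x y : baryComplement) :
    hdist (fold x.1) (fold y.1) ≤ pathDist x y := le_pathDist fun _ h => h.hdist_fold_le

/-- Geodesics in the chamber give one inequality, and folding arbitrary paths gives the other. -/
theorem pathDist_unfold (σ : Equiv.Perm (Fin 4)) {p q : UpperHalfSpace} (hp : p ∈ polyhedron)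
    (hq : q ∈ polyhedron) :
    pathDist ⟨unfold σ p, unfold_mem σ hp⟩ ⟨unfold σ q, unfold_mem σ hq⟩ = hdist p q := by
  refine le_antisymm (pathDist_le (reach_unfold σ hp hq)) ?_
  have := hdist_fold_le_pathDist ⟨unfold σ p, unfold_mem σ hp⟩ ⟨unfold σ q, unfold_mem σ hq⟩
  rwa [fold_unfold σ hp, fold_unfold σ hq] at this

end TetTangle

namespace TetTangle

open UpperHalfSpace Filter Topology

/-! ### Developing the tangle complement into hyperbolic space -/

/-- Coordinates on hyperbolic space, permuted isometrically by a group of permutations, in which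
the walls of the polyhedron that meet a given part of it are the walls of the group. -/
structure ChartModel where
  coord : UpperHalfSpace → Fin 4 → ℝ
  point : (Fin 4 → ℝ) → UpperHalfSpace
  range : Set (Fin 4 → ℝ)
  W : Subgroup (Equiv.Perm (Fin 4))
  dom : Set UpperHalfSpace
  coord_mem : ∀ h, coord h ∈ range
  point_coord : ∀ h, point (coord h) = h
  coord_point : ∀ n ∈ range, coord (point n) = n
  continuous_coord : Continuous coord
  continuousOn_point : ContinuousOn point range
  comp_mem : ∀ n ∈ range, ∀ w ∈ W, n ∘ w ∈ range
  isom : ∀ n ∈ range, ∀ n' ∈ range, ∀ w ∈ W,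
    hdist (point (n ∘ w)) (point (n' ∘ w)) = hdist (point n) (point n')
  -- This lets paths in the image of the developing map be lifted without becoming longer.
  contr : ∀ n ∈ range, ∀ n' ∈ range, ∀ w ∈ W, ∀ w' ∈ W, Monotone (n ∘ w) → Monotone (n' ∘ w') →
    hdist (point (n ∘ w)) (point (n' ∘ w')) ≤ hdist (point n) (point n')
  dom_subset : dom ⊆ polyhedron
  dom_open : ∀ h ∈ dom, ∀ᶠ h' in 𝓝 h, h' ∈ polyhedron → h' ∈ dom
  monotone_coord : ∀ h ∈ dom, Monotone (coord h)
  -- Agreement of the ties makes the developing map independent of the choice of a sorting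
  -- permutation. Together with `block` it ensures that the only mirrors met over the domain are
  -- those of `W`.
  walls : ∀ h ∈ dom, ∀ i j, coord h i = coord h j ↔ ofPoly h i = ofPoly h j
  block : ∀ h ∈ dom, ∀ n ∈ range, ∀ w : Equiv.Perm (Fin 4), n ∘ w = coord h → w ∈ W

namespace ChartModel

variable (m : ChartModel) (g : Equiv.Perm (Fin 4))

/-- The part of the tangle complement on which the developing map is defined. -/
def domain : Set (Fin 4 → ℝ) :=
  {x | x ∈ baryComplement ∧ fold x ∈ m.dom ∧ ∃ w ∈ m.W, Monotone (x ∘ (g * w))}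

/-- The developing map. -/
noncomputable def dev (x : Fin 4 → ℝ) : UpperHalfSpace :=
  -- If `x` lies in the chamber `g * w`, the permutation applied to the coordinates is the inverse
  -- of `w`: the folded point is carried to the copy of the model chamber that corresponds to `w`.
  m.point (m.coord (fold x) ∘ (Tuple.sort x).symm ∘ g)

/-- The image of the developing map. -/
def region : Set UpperHalfSpace :=
  {h | ∃ w ∈ m.W, Monotone (m.coord h ∘ w) ∧ m.point (m.coord h ∘ w) ∈ m.dom}

/-- The inverse of the developing map. -/
noncomputable def devInv (h : UpperHalfSpace) : Fin 4 → ℝ :=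
  unfold (g * Tuple.sort (m.coord h)) (m.point (m.coord h ∘ Tuple.sort (m.coord h)))

variable {m g} {x y : Fin 4 → ℝ} {w v : Equiv.Perm (Fin 4)} {h : UpperHalfSpace}

theorem dev_eq (hx : x ∈ baryComplement) (hd : fold x ∈ m.dom) (hw : Monotone (x ∘ (g * w))) :
    m.dev g x = m.point (m.coord (fold x) ∘ w.symm) := by
  rw [dev]
  congr 1
  ext i
  simp only [Function.comp_apply]
  rw [m.walls _ hd, congrFun (ofPoly_fold hx (Tuple.monotone_sort x)),
    congrFun (ofPoly_fold hx hw)]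
  simp

/-- Two permutations that sort the same point differ by one that respects its ties. By `walls` these
are the ties of the model coordinates, and `block` applies. -/
theorem mem_W_of_monotone (hx : x ∈ m.domain g) (hv : Monotone (x ∘ (g * v))) : v ∈ m.W := by
  obtain ⟨hx, hd, w, hw, hm⟩ := hx
  refine m.block _ hd (m.coord (fold x) ∘ w.symm) (m.comp_mem _ (m.coord_mem _) _ (m.W.inv_mem hw))
    v ?_
  ext i
  simp only [Function.comp_apply]
  rw [m.walls _ hd]
  have h1 := congrFun (ofPoly_fold hx hm) (w.symm (v i))
  have h2 := congrFun (ofPoly_fold hx hv) i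
  rw [h1, h2]
  simp

theorem coord_dev (hx : x ∈ baryComplement) (hd : fold x ∈ m.dom) (hw : w ∈ m.W)
    (hm : Monotone (x ∘ (g * w))) : m.coord (m.dev g x) = m.coord (fold x) ∘ w.symm := by
  rw [dev_eq hx hd hm]
  exact m.coord_point _ (m.comp_mem _ (m.coord_mem _) _ (m.W.inv_mem hw))

theorem coord_dev_comp (hx : x ∈ baryComplement) (hd : fold x ∈ m.dom) (hw : w ∈ m.W)
    (hm : Monotone (x ∘ (g * w))) : m.coord (m.dev g x) ∘ w = m.coord (fold x) := by
  rw [coord_dev hx hd hw hm]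
  ext i
  simp

theorem dev_mem_region (hx : x ∈ m.domain g) : m.dev g x ∈ m.region := by
  obtain ⟨hx, hd, w, hw, hm⟩ := hx
  refine ⟨w, hw, ?_, ?_⟩ <;> rw [coord_dev_comp hx hd hw hm]
  · exact m.monotone_coord _ hd
  · rwa [m.point_coord]

theorem devInv_eq (hw : w ∈ m.W) (hm : Monotone (m.coord h ∘ w))
    (hd : m.point (m.coord h ∘ w) ∈ m.dom) :
    m.devInv g h = unfold (g * w) (m.point (m.coord h ∘ w)) := by
  have h1 := Tuple.unique_monotone hm (Tuple.monotone_sort (m.coord h))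
  rw [devInv, ← h1]
  ext i
  simp only [unfold, Function.comp_apply]
  rw [← m.walls _ hd, m.coord_point _ (m.comp_mem _ (m.coord_mem _) _ hw)]
  have h2 := congrFun h1 ((g * Tuple.sort (m.coord h)).symm i)
  simp only [Function.comp_apply] at h2 ⊢
  rw [h2]
  simp [Equiv.Perm.mul_def]

theorem devInv_spec (hw : w ∈ m.W) (hm : Monotone (m.coord h ∘ w))
    (hd : m.point (m.coord h ∘ w) ∈ m.dom) :
    m.devInv g h ∈ m.domain g ∧ fold (m.devInv g h) = m.point (m.coord h ∘ w) ∧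
      m.dev g (m.devInv g h) = h ∧ m.devInv g h ∘ (g * w) = ofPoly (m.point (m.coord h ∘ w)) := by
  have hp := m.dom_subset hd
  have e := devInv_eq (g := g) hw hm hd
  have hmem : m.devInv g h ∈ baryComplement := by rw [e]; exact unfold_mem _ hp
  have hf : fold (m.devInv g h) = m.point (m.coord h ∘ w) := by rw [e, fold_unfold _ hp]
  have hc : m.devInv g h ∘ (g * w) = ofPoly (m.point (m.coord h ∘ w)) := by
    rw [e, unfold_comp]
  have hm' : Monotone (m.devInv g h ∘ (g * w)) := by rw [hc]; exact (ofPoly_mem hp).1.1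
  refine ⟨⟨hmem, by rwa [hf], w, hw, hm'⟩, hf, ?_, hc⟩
  rw [dev_eq hmem (by rwa [hf]) hm', hf, m.coord_point _ (m.comp_mem _ (m.coord_mem _) _ hw)]
  have : (m.coord h ∘ w) ∘ w.symm = m.coord h := by
    ext i
    simp
  rw [this, m.point_coord]

theorem devInv_dev (hx : x ∈ m.domain g) : m.devInv g (m.dev g x) = x := by
  obtain ⟨hx, hd, w, hw, hm⟩ := hx
  have h1 := coord_dev_comp hx hd hw hm
  rw [devInv_eq hw (by rw [h1]; exact m.monotone_coord _ hd) (by rwa [h1, m.point_coord]), h1,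
    m.point_coord, unfold_fold hx hm]

theorem continuousOn_dev : ContinuousOn (m.dev g) (m.domain g) := by
  refine continuousOn_of_finite_closed_cover isClosed_monotone_comp
    (fun x _ => ⟨_, Tuple.monotone_sort x⟩) fun σ => ?_
  obtain ⟨w, rfl⟩ : ∃ w, σ = g * w := ⟨g⁻¹ * σ, by simp⟩
  by_cases hw : w ∈ m.W
  · have h1 : ContinuousOn (fun x => m.point (m.coord (fold x) ∘ w.symm))
        (m.domain g ∩ {x | Monotone (x ∘ (g * w))}) := by
      refine m.continuousOn_point.comp ?_
        fun x _ => m.comp_mem _ (m.coord_mem _) _ (m.W.inv_mem hw)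
      have h2 : Continuous fun n : Fin 4 → ℝ => n ∘ w.symm := by fun_prop
      exact (h2.comp m.continuous_coord).comp_continuousOn
        (continuousOn_fold.mono fun x hx => hx.1.1)
    exact h1.congr fun x hx => dev_eq hx.1.1 hx.1.2.1 hx.2
  · have : m.domain g ∩ {x | Monotone (x ∘ (g * w))} = ∅ := by
      rw [Set.eq_empty_iff_forall_notMem]
      exact fun x hx => hw (mem_W_of_monotone hx.1 hx.2)
    rw [this]
    exact continuousOn_empty _

theorem continuousOn_devInv : ContinuousOn (m.devInv g) m.region := by
  refine continuousOn_of_finite_closed_cover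
    (c := fun w : Equiv.Perm (Fin 4) => {h | Monotone (m.coord h ∘ w)})
    (fun w => (isClosed_monotone_comp w).preimage m.continuous_coord)
    (fun h _ => ⟨_, Tuple.monotone_sort (m.coord h)⟩) fun w => ?_
  have key : ∀ h ∈ m.region ∩ {h | Monotone (m.coord h ∘ w)},
      w ∈ m.W ∧ m.point (m.coord h ∘ w) ∈ m.dom := by
    rintro h ⟨⟨v, hv, hm, hd⟩, hw⟩
    have h1 := Tuple.unique_monotone hm hw
    rw [h1] at hd
    refine ⟨m.block _ hd _ (m.coord_mem h) w ?_, hd⟩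
    rw [← h1, m.coord_point _ (m.comp_mem _ (m.coord_mem _) _ hv)]
  have h1 : ContinuousOn (fun h => unfold (g * w) (m.point (m.coord h ∘ w)))
      (m.region ∩ {h | Monotone (m.coord h ∘ w)}) := by
    refine (continuousOn_unfold (g * w)).comp (m.continuousOn_point.comp ?_ ?_)
      fun h hh => m.dom_subset (key h hh).2
    · have h2 : Continuous fun n : Fin 4 → ℝ => n ∘ w := by fun_prop
      exact (h2.comp m.continuous_coord).continuousOn
    · exact fun h hh => m.comp_mem _ (m.coord_mem _) _ (key h hh).1
  exact h1.congr fun h hh => devInv_eq (key h hh).1 hh.2 (key h hh).2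

theorem hdist_fold_le_dev (hx : x ∈ m.domain g) (hy : y ∈ m.domain g) :
    hdist (fold x) (fold y) ≤ hdist (m.dev g x) (m.dev g y) := by
  obtain ⟨hx, hdx, w, hw, hm⟩ := hx
  obtain ⟨hy, hdy, v, hv, hm'⟩ := hy
  have h1 := coord_dev_comp hx hdx hw hm
  have h2 := coord_dev_comp hy hdy hv hm'
  have h3 := m.contr _ (m.coord_mem (m.dev g x)) _ (m.coord_mem (m.dev g y)) w hw v hv
    (by rw [h1]; exact m.monotone_coord _ hdx) (by rw [h2]; exact m.monotone_coord _ hdy)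
  rwa [h1, h2, m.point_coord, m.point_coord, m.point_coord, m.point_coord] at h3

theorem hdist_dev_eq (hx : x ∈ m.domain g) (hy : y ∈ m.domain g) (hw : w ∈ m.W)
    (hmx : Monotone (x ∘ (g * w))) (hmy : Monotone (y ∘ (g * w))) :
    hdist (m.dev g x) (m.dev g y) = hdist (fold x) (fold y) := by
  rw [dev_eq hx.1 hx.2.1 hmx, dev_eq hy.1 hy.2.1 hmy,
    show (w.symm : Fin 4 → Fin 4) = (w⁻¹ : Equiv.Perm (Fin 4)) from rfl,
    m.isom _ (m.coord_mem _) _ (m.coord_mem _) _ (m.W.inv_mem hw), m.point_coord, m.point_coord]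

theorem eventually_monotone (x : Fin 4 → ℝ) :
    ∀ᶠ y in 𝓝 x, ∀ σ : Equiv.Perm (Fin 4), Monotone (y ∘ σ) → Monotone (x ∘ σ) := by
  rw [eventually_all]
  intro σ
  by_cases hσ : Monotone (x ∘ σ)
  · exact Eventually.of_forall fun _ _ => hσ
  · filter_upwards [(isClosed_monotone_comp σ).isOpen_compl.mem_nhds hσ] with y hy h
    exact absurd h hy

/-- Every chamber that contains a nearby point also contains `x`, and on a single chamber the
developing map is the fold followed by an isometry. -/
theorem eventually_hdist_dev (hx : x ∈ m.domain g) :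
    ∀ᶠ y in 𝓝 x, y ∈ m.domain g → hdist (m.dev g x) (m.dev g y) = hdist (fold x) (fold y) := by
  filter_upwards [eventually_monotone x] with y hy hyd
  obtain ⟨w, hw, hm⟩ := hyd.2.2
  exact hdist_dev_eq hx hyd hw (hy _ hm) hm

theorem eventually_mem_domain (hx : x ∈ m.domain g) :
    ∀ᶠ y in 𝓝[baryComplement] x, y ∈ m.domain g := by
  have h1 := (continuousOn_fold x hx.1).eventually (m.dom_open _ hx.2.1)
  have h2 := (eventually_monotone x).filter_mono (nhdsWithin_le_nhds (s := baryComplement))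
  filter_upwards [h1, h2, self_mem_nhdsWithin] with y hy1 hy2 hy
  refine ⟨hy, hy1 (fold_mem hy), g⁻¹ * Tuple.sort y, ?_, ?_⟩
  · refine mem_W_of_monotone hx (hy2 _ ?_)
    simpa using Tuple.monotone_sort y
  · simpa using Tuple.monotone_sort y

/-- A path that stays over the domain of the model stays in the domain of the developing map. -/
theorem path_mem_domain {f : ℝ → baryComplement} (hf : Continuous f) {l : ℝ}
    (hd : ∀ t ∈ Set.Icc 0 l, fold (f t).1 ∈ m.dom) (h0 : (f 0).1 ∈ m.domain g) :
    ∀ t ∈ Set.Icc 0 l, (f t).1 ∈ m.domain g := by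
  have hcl : ∀ S : Set (Equiv.Perm (Fin 4)),
      IsClosed {t : ℝ | ∃ σ ∈ S, Monotone ((f t).1 ∘ σ)} := by
    intro S
    have : {t : ℝ | ∃ σ ∈ S, Monotone ((f t).1 ∘ σ)} =
        ⋃ σ ∈ S, {t | Monotone ((f t).1 ∘ σ)} := by
      ext t
      simp
    rw [this]
    exact Set.Finite.isClosed_biUnion (Set.toFinite S) fun σ _ =>
      (isClosed_monotone_comp σ).preimage (continuous_subtype_val.comp hf)
  intro t ht
  -- The coset of the chambers used by the developing map. The times spent in these chambers and the
  -- times spent in the others form two closed sets, which are disjoint as long as the path is over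
  -- the domain, by `mem_W_of_monotone`. Connectedness excludes a change.
  let A : Set (Equiv.Perm (Fin 4)) := {σ | g⁻¹ * σ ∈ m.W}
  have hpc : IsPreconnected (Set.Icc 0 t) := isPreconnected_Icc
  by_contra hn
  have hcov : Set.Icc 0 t ⊆ {t | ∃ σ ∈ A, Monotone ((f t).1 ∘ σ)} ∪
      {t | ∃ σ ∈ Aᶜ, Monotone ((f t).1 ∘ σ)} := by
    intro s _
    by_cases h : Tuple.sort (f s).1 ∈ A
    · exact Or.inl ⟨_, h, Tuple.monotone_sort _⟩
    · exact Or.inr ⟨_, h, Tuple.monotone_sort _⟩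
  obtain ⟨w, hw, hm⟩ := h0.2.2
  have hA : ∀ s ∈ Set.Icc 0 t, (∃ σ ∈ A, Monotone ((f s).1 ∘ σ)) → (f s).1 ∈ m.domain g := by
    rintro s hs ⟨σ, hσ, hm⟩
    exact ⟨(f s).2, hd s ⟨hs.1, hs.2.trans ht.2⟩, _, hσ, by simpa using hm⟩
  obtain ⟨s, hs, h1, σ, hσ, h2⟩ := (isPreconnected_closed_iff.1 hpc) _ _ (hcl A) (hcl Aᶜ) hcov
    ⟨0, ⟨le_rfl, ht.1⟩, g * w, by simpa [A] using hw, hm⟩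
    ⟨t, ⟨ht.1, le_rfl⟩, by
      rcases hcov ⟨ht.1, le_rfl⟩ with h | h
      · exact absurd (hA t ⟨ht.1, le_rfl⟩ h) hn
      · exact h⟩
  exact hσ (mem_W_of_monotone (hA s hs h1) (by simpa using h2))

/-- Continuous induction: the times at which the bound holds form a closed set, and just after such
a time the developed path moves exactly as far as the folded one. -/
theorem hdist_dev_path_le {f : ℝ → baryComplement} (hf : Continuous f) {l : ℝ}
    (hd : ∀ t ∈ Set.Icc 0 l, fold (f t).1 ∈ m.dom) (h0 : (f 0).1 ∈ m.domain g)
    (hlip : ∀ s t, hdist (fold (f s).1) (fold (f t).1) ≤ |s - t|) :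
    ∀ t ∈ Set.Icc 0 l, hdist (m.dev g (f 0).1) (m.dev g (f t).1) ≤ t := by
  have hmem := path_mem_domain hf hd h0
  have hcont : ContinuousOn (fun t => hdist (m.dev g (f 0).1) (m.dev g (f t).1))
      (Set.Icc 0 l) := by
    have h1 : ContinuousOn (fun t => m.dev g (f t).1) (Set.Icc 0 l) :=
      ContinuousOn.comp (g := m.dev g) (f := fun t => (f t).1) (t := m.domain g) continuousOn_dev
        (continuous_subtype_val.comp hf).continuousOn hmem
    exact continuousOn_hdist continuousOn_const h1
  have hclosed : IsClosed ({t | hdist (m.dev g (f 0).1) (m.dev g (f t).1) ≤ t} ∩ Set.Icc 0 l) := by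
    have := isClosed_Icc.isClosed_le hcont continuousOn_id
    rwa [Set.inter_comm]
  refine fun t ht => hclosed.Icc_subset_of_forall_exists_gt ?_ ?_ ht
  · simp
  · rintro s ⟨hs1, hs2⟩ u hu
    have hs2' : s ∈ Set.Icc 0 l := ⟨hs2.1, hs2.2.le⟩
    have h1 : ∀ᶠ r in 𝓝[>] s, r ∈ Set.Ioc s (min u l) :=
      Ioc_mem_nhdsGT (lt_min hu hs2.2)
    have h2 : ∀ᶠ r in 𝓝[>] s, (f r).1 ∈ m.domain g →
        hdist (m.dev g (f s).1) (m.dev g (f r).1) = hdist (fold (f s).1) (fold (f r).1) :=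
      (((continuous_subtype_val.comp hf).tendsto s).eventually
        (eventually_hdist_dev (hmem s hs2'))).filter_mono nhdsWithin_le_nhds
    obtain ⟨r, hr1, hr2⟩ := (h1.and h2).exists
    have hr3 : r ∈ Set.Icc 0 l :=
      ⟨hs2.1.trans hr1.1.le, hr1.2.trans (min_le_right _ _)⟩
    refine ⟨r, ?_, hr1.1, hr1.2.trans (min_le_left _ _)⟩
    have h3 := hlip s r
    rw [← hr2 (hmem r hr3), abs_of_nonpos (by linarith [hr1.1])] at h3
    have h4 := hdist_triangle (m.dev g (f 0).1) (m.dev g (f s).1) (m.dev g (f r).1)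
    have hs1' : hdist (m.dev g (f 0).1) (m.dev g (f s).1) ≤ s := hs1
    show hdist (m.dev g (f 0).1) (m.dev g (f r).1) ≤ r
    linarith

/-- Short paths that start near a point are not shortened by the developing map. -/
theorem reach_dev {k : UpperHalfSpace} {R : ℝ} (hR : ∀ h ∈ polyhedron, hdist h k < R → h ∈ m.dom)
    (hk : ∀ x ∈ m.domain g, hdist (fold x) k ≤ hdist (m.dev g x) k)
    {x y : baryComplement} (hx : x.1 ∈ m.domain g) {l : ℝ} (hl : hdist (m.dev g x.1) k + l < R)
    (h : Reach x y l) : y.1 ∈ m.domain g ∧ hdist (m.dev g x.1) (m.dev g y.1) ≤ l := by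
  obtain ⟨h0, f, hf, rfl, rfl, hlip⟩ := h
  have hd : ∀ t ∈ Set.Icc 0 l, fold (f t).1 ∈ m.dom := by
    intro t ht
    refine hR _ (fold_mem (f t).2) ?_
    have h1 := hlip t 0
    have h2 := hdist_triangle (fold (f t).1) (fold (f 0).1) k
    have h3 := hk _ hx
    rw [sub_zero, abs_of_nonneg ht.1] at h1
    linarith [ht.2]
  exact ⟨path_mem_domain hf hd hx l ⟨h0, le_rfl⟩,
    hdist_dev_path_le hf hd hx hlip l ⟨h0, le_rfl⟩⟩

/-- Paths in the image of the developing map lift. -/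
theorem reach_of_path {x y : baryComplement} (hx : x.1 ∈ m.domain g) (hy : y.1 ∈ m.domain g)
    {γ : ℝ → UpperHalfSpace} {l : ℝ} (hl : 0 ≤ l) (hc : Continuous γ) (h0 : γ 0 = m.dev g x.1)
    (h1 : γ l = m.dev g y.1) (hlip : ∀ s t, hdist (γ s) (γ t) ≤ |s - t|)
    (hr : ∀ t, γ t ∈ m.region) : Reach x y l := by
  have hspec : ∀ t, m.devInv g (γ t) ∈ m.domain g ∧ m.dev g (m.devInv g (γ t)) = γ t := by
    intro t
    obtain ⟨w, hw, hm, hd⟩ := hr t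
    have := devInv_spec (g := g) hw hm hd
    exact ⟨this.1, this.2.2.1⟩
  refine ⟨hl, fun t => ⟨m.devInv g (γ t), (hspec t).1.1⟩,
    (continuousOn_devInv.comp_continuous hc hr).subtype_mk _, ?_, ?_, fun s t => ?_⟩
  · exact Subtype.ext (by simp only [h0]; exact devInv_dev hx)
  · exact Subtype.ext (by simp only [h1]; exact devInv_dev hy)
  · have := hdist_fold_le_dev (hspec s).1 (hspec t).1
    rw [(hspec s).2, (hspec t).2] at this
    exact this.trans (hlip s t)

end ChartModel

end TetTangle

namespace TetTangle

open UpperHalfSpace Filter Topology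

/-! ### The two coordinate systems -/

theorem eq_iff_eq_of_monotone {l n : Fin 4 → ℝ} (hl : Monotone l) (hn : Monotone n)
    (h01 : n 0 = n 1 ↔ l 0 = l 1) (h12 : n 1 = n 2 ↔ l 1 = l 2) (h23 : n 2 = n 3 ↔ l 2 = l 3) :
    ∀ i j, n i = n j ↔ l i = l j := by
  have key : ∀ {a b c : ℝ}, a ≤ b → b ≤ c → (a = c ↔ a = b ∧ b = c) := fun h1 h2 =>
    ⟨fun h => ⟨by linarith, by linarith⟩, fun h => h.1.trans h.2⟩
  rw [monotone_iff] at hl hn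
  obtain ⟨l1, l2, l3⟩ := hl
  obtain ⟨n1, n2, n3⟩ := hn
  have h02 : n 0 = n 2 ↔ l 0 = l 2 := by rw [key l1 l2, key n1 n2, h01, h12]
  have h13 : n 1 = n 3 ↔ l 1 = l 3 := by rw [key l2 l3, key n2 n3, h12, h23]
  have h03 : n 0 = n 3 ↔ l 0 = l 3 := by
    rw [key (l1.trans l2) l3, key (n1.trans n2) n3, h02, h23]
  intro i j
  fin_cases i <;> fin_cases j <;> simp only [Fin.zero_eta, Fin.mk_one, Fin.reduceFinMk] <;>
    first | assumption | (rw [eq_comm, @eq_comm _ (l _)]; assumption)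

theorem ofPoly_walls {p : UpperHalfSpace} (hp : p ∈ polyhedron) :
    (ofPoly p 0 = 0 ↔ p.1 0 = 0 ∨ normSq p = slope * p.1 0) ∧
    (ofPoly p 0 = ofPoly p 1 ↔ p.1 0 = 1) ∧ (ofPoly p 1 = ofPoly p 2 ↔ normSq p = 4 * p.1 1) ∧
    (ofPoly p 2 = ofPoly p 3 ↔ p.1 1 = 0 ∨ p.1 1 = 3) := by
  have := toPoly_walls (ofPoly_mem hp)
  rwa [toPoly_ofPoly hp] at this

/-- The time coordinate of a point of the hyperboloid with given space coordinates. -/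
noncomputable def time (n : Fin 4 → ℝ) : ℝ := √(1 + 2 * ∑ i, n i ^ 2)

/-- Hyperboloid coordinates at the center of the tetrahedron. -/
noncomputable def cornerCoord (h : UpperHalfSpace) : Fin 4 → ℝ :=
  -- Consecutive differences are the equally normalized functionals `(1 - x) / z`, `(|p|² - 4y) /
  -- (4z)` and `(3 - y) / z` of the three mirrors, and the sum is zero. Transposing neighboring
  -- entries is then the reflection in the corresponding mirror.
  ![(-3 * (1 - h.1 0) - (normSq h - 4 * h.1 1) / 2 - (3 - h.1 1)) / (4 * h.1 2),
    ((1 - h.1 0) - (normSq h - 4 * h.1 1) / 2 - (3 - h.1 1)) / (4 * h.1 2),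
    ((1 - h.1 0) + (normSq h - 4 * h.1 1) / 2 - (3 - h.1 1)) / (4 * h.1 2),
    ((1 - h.1 0) + (normSq h - 4 * h.1 1) / 2 + 3 * (3 - h.1 1)) / (4 * h.1 2)]

/-- The reciprocal of the height of a point with given hyperboloid coordinates. -/
noncomputable def invHeight (n : Fin 4 → ℝ) : ℝ := (√2 * time n - (n 3 + n 2 - n 1 - n 0)) / 2

/-- The point with given hyperboloid coordinates. -/
noncomputable def cornerPoint (n : Fin 4 → ℝ) : UpperHalfSpace :=
  ofCoords ((√2 * time n + 4 * n 0) / 2 / invHeight n)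
    ((3 * invHeight n - (n 3 - n 2)) / invHeight n) (1 / invHeight n)

theorem sqrt_two_sq : √2 * √2 = (2 : ℝ) := Real.mul_self_sqrt (by norm_num)

theorem time_sq (n : Fin 4 → ℝ) : time n * time n = 1 + 2 * ∑ i, n i ^ 2 :=
  Real.mul_self_sqrt (by positivity)

theorem time_pos (n : Fin 4 → ℝ) : 0 < time n := Real.sqrt_pos.2 (by positivity)

/-- By the Cauchy–Schwarz inequality the square of the subtracted term is at most `4 * ∑ n²`, which
is less than `2 * time²`. -/
theorem invHeight_pos (n : Fin 4 → ℝ) : 0 < invHeight n := by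
  have h1 := time_pos n
  have h2 : n 3 + n 2 - n 1 - n 0 < √2 * time n := by
    refine lt_of_pow_lt_pow_left₀ 2 (by positivity) ?_
    have h3 : (√2 * time n) ^ 2 = 2 * (1 + 2 * ∑ i, n i ^ 2) := by
      rw [← time_sq, mul_pow, sq, sq, sqrt_two_sq]
    rw [h3, Fin.sum_univ_four]
    nlinarith [sq_nonneg (n 3 - n 2), sq_nonneg (n 3 + n 1), sq_nonneg (n 3 + n 0),
      sq_nonneg (n 2 + n 1), sq_nonneg (n 2 + n 0), sq_nonneg (n 1 - n 0)]
  unfold invHeight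
  linarith

theorem cornerPoint_coords (n : Fin 4 → ℝ) :
    (cornerPoint n).1 0 = (√2 * time n + 4 * n 0) / 2 / invHeight n ∧
    (cornerPoint n).1 1 = (3 * invHeight n - (n 3 - n 2)) / invHeight n ∧
    (cornerPoint n).1 2 = 1 / invHeight n :=
  ⟨ofCoords_zero _ _ _, ofCoords_one _ _ _, ofCoords_two _ _ (one_div_pos.2 (invHeight_pos n))⟩

theorem cornerPoint_normSq {n : Fin 4 → ℝ} (hn : ∑ i, n i = 0) :
    normSq (cornerPoint n) = (6 * √2 * time n - 12 * n 3 + 4 * n 0) / invHeight n := by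
  obtain ⟨h0, h1, h2⟩ := cornerPoint_coords n
  have hp := invHeight_pos n
  have hs := sqrt_two_sq
  have ht := time_sq n
  rw [Fin.sum_univ_four] at hn ht
  have e : n 1 = -n 0 - n 2 - n 3 := by linarith
  rw [normSq, h0, h1, h2, eq_div_iff hp.ne']
  have e2 : invHeight n = √2 * time n / 2 - n 2 - n 3 := by rw [invHeight, e]; ring
  have e3 : ((√2 * time n + 4 * n 0) / 2) ^ 2 + (3 * invHeight n - (n 3 - n 2)) ^ 2 + 1 =
      (6 * √2 * time n - 12 * n 3 + 4 * n 0) * invHeight n := by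
    rw [e2]
    rw [e] at ht
    linear_combination (-(1 / 2 : ℝ)) * (time n * time n) * hs - ht
  field_simp
  linear_combination 4 * e3

theorem cornerCoord_sum (h : UpperHalfSpace) : ∑ i, cornerCoord h i = 0 := by
  rw [Fin.sum_univ_four]
  simp [cornerCoord]
  ring

/-- The right-hand side is `cosh` of the distance to `(1, 3, √2)`, the point where the three mirrors
meet and the origin of these coordinates. -/
theorem time_cornerCoord (h : UpperHalfSpace) :
    time (cornerCoord h) = ((normSq h + 12) / 2 - h.1 0 - 3 * h.1 1) / (√2 * h.1 2) := by
  have hz := h.2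
  have hpos : 0 ≤ (normSq h + 12) / 2 - h.1 0 - 3 * h.1 1 := by
    rw [normSq]
    nlinarith [sq_nonneg (h.1 0 - 1), sq_nonneg (h.1 1 - 3), sq_nonneg (h.1 2)]
  rw [time, Real.sqrt_eq_iff_mul_self_eq (by positivity) (by positivity), div_mul_div_comm,
    mul_mul_mul_comm, sqrt_two_sq, Fin.sum_univ_four]
  simp only [cornerCoord, Matrix.cons_val_zero, Matrix.cons_val_one, Matrix.cons_val]
  rw [normSq]
  field_simp
  ring

theorem cornerPoint_cornerCoord (h : UpperHalfSpace) : cornerPoint (cornerCoord h) = h := by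
  have hz := h.2
  have ht : √2 * time (cornerCoord h) = ((normSq h + 12) / 2 - h.1 0 - 3 * h.1 1) / h.1 2 := by
    rw [time_cornerCoord]
    field_simp
  have hi : invHeight (cornerCoord h) = 1 / h.1 2 := by
    rw [invHeight, ht]
    simp only [cornerCoord, Matrix.cons_val_zero, Matrix.cons_val_one, Matrix.cons_val]
    field_simp
    ring
  obtain ⟨h0, h1, h2⟩ := cornerPoint_coords (cornerCoord h)
  refine ext_coords ?_ ?_ ?_
  · rw [h0, hi, ht]
    simp only [cornerCoord, Matrix.cons_val_zero]
    field_simp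
    ring
  · rw [h1, hi]
    simp only [cornerCoord, Matrix.cons_val]
    field_simp
    ring
  · rw [h2, hi, one_div_one_div]

theorem cornerCoord_cornerPoint {n : Fin 4 → ℝ} (hn : ∑ i, n i = 0) :
    cornerCoord (cornerPoint n) = n := by
  have hq := cornerPoint_normSq hn
  obtain ⟨h0, h1, h2⟩ := cornerPoint_coords n
  have hp := invHeight_pos n
  rw [Fin.sum_univ_four] at hn
  have e : n 1 = -n 0 - n 2 - n 3 := by linarith
  have e2 : √2 * time n = 2 * invHeight n + 2 * (n 2 + n 3) := by
    rw [invHeight, e]; ring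
  rw [mul_assoc, e2] at hq
  rw [e2] at h0
  ext i
  fin_cases i <;>
    simp only [cornerCoord, h0, h1, h2, hq, Matrix.cons_val_zero, Matrix.cons_val_one,
      Matrix.cons_val, Fin.zero_eta, Fin.mk_one, Fin.reduceFinMk] <;>
    field_simp <;> first | (rw [e]; ring) | ring

/-- The right-hand side is a Lorentz form that is invariant under simultaneous permutations, which
is why these act by isometries in `cornerModel`. -/
theorem cosh_hdist_cornerPoint {n n' : Fin 4 → ℝ} (hn : ∑ i, n i = 0) (hn' : ∑ i, n' i = 0) :
    Real.cosh (hdist (cornerPoint n) (cornerPoint n')) =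
      time n * time n' - 2 * ∑ i, n i * n' i := by
  have hq := cornerPoint_normSq hn
  obtain ⟨h0, h1, h2⟩ := cornerPoint_coords n
  have hp := invHeight_pos n
  have hq' := cornerPoint_normSq hn'
  obtain ⟨h0', h1', h2'⟩ := cornerPoint_coords n'
  have hp' := invHeight_pos n'
  rw [Fin.sum_univ_four] at hn hn'
  have e : n 1 = -n 0 - n 2 - n 3 := by linarith
  have e2 : invHeight n = √2 * time n / 2 - n 2 - n 3 := by rw [invHeight, e]; ring
  have e' : n' 1 = -n' 0 - n' 2 - n' 3 := by linarith
  have e2' : invHeight n' = √2 * time n' / 2 - n' 2 - n' 3 := by rw [invHeight, e']; ring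
  rw [cosh_hdist, h0, h1, h2, h0', h1', h2', hq, hq', Fin.sum_univ_four]
  have key : ((6 * √2 * time n - 12 * n 3 + 4 * n 0) * invHeight n' +
      (6 * √2 * time n' - 12 * n' 3 + 4 * n' 0) * invHeight n) / 2 -
      (√2 * time n + 4 * n 0) / 2 * ((√2 * time n' + 4 * n' 0) / 2) -
      (3 * invHeight n - (n 3 - n 2)) * (3 * invHeight n' - (n' 3 - n' 2)) =
      time n * time n' - 2 * (n 0 * n' 0 + n 1 * n' 1 + n 2 * n' 2 + n 3 * n' 3) := by
    rw [e2, e2', e, e']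
    linear_combination (1 / 2 * time n * time n') * sqrt_two_sq
  rw [← key]
  field_simp

theorem continuous_time : Continuous time := by
  unfold time
  fun_prop

theorem continuous_cornerPoint : Continuous cornerPoint := by
  have h1 := continuous_time
  have h2 : Continuous invHeight := by
    unfold invHeight
    fun_prop
  rw [← continuousOn_univ]
  refine continuousOn_ofCoords ?_ ?_ ?_ fun n _ => one_div_pos.2 (invHeight_pos n)
  · exact (Continuous.div (by fun_prop) h2 fun n => (invHeight_pos n).ne').continuousOn
  · exact (Continuous.div (by fun_prop) h2 fun n => (invHeight_pos n).ne').continuousOn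
  · exact (Continuous.div (by fun_prop) h2 fun n => (invHeight_pos n).ne').continuousOn

theorem continuous_cornerCoord : Continuous cornerCoord := by
  refine continuous_pi fun i => ?_
  have h : ∀ h : UpperHalfSpace, 4 * h.1 2 ≠ 0 := fun h => by have := h.2; positivity
  fin_cases i <;> exact Continuous.div (by fun_prop) (by fun_prop) h

theorem monotone_cornerCoord_iff (h : UpperHalfSpace) : Monotone (cornerCoord h) ↔
    h.1 0 ≤ 1 ∧ 4 * h.1 1 ≤ normSq h ∧ h.1 1 ≤ 3 := by
  have hz : 0 < 4 * h.1 2 := by have := h.2; positivity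
  rw [monotone_iff]
  simp only [cornerCoord, Matrix.cons_val_zero, Matrix.cons_val_one, Matrix.cons_val,
    div_le_div_iff_of_pos_right hz]
  refine and_congr ?_ (and_congr ?_ ?_) <;> constructor <;> intro <;> linarith

theorem cornerCoord_eq_iff (h : UpperHalfSpace) :
    (cornerCoord h 0 = cornerCoord h 1 ↔ h.1 0 = 1) ∧
    (cornerCoord h 1 = cornerCoord h 2 ↔ normSq h = 4 * h.1 1) ∧
    (cornerCoord h 2 = cornerCoord h 3 ↔ h.1 1 = 3) := by
  have hz : 4 * h.1 2 ≠ 0 := by have := h.2; positivity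
  simp only [cornerCoord, Matrix.cons_val_zero, Matrix.cons_val_one, Matrix.cons_val,
    div_left_inj' hz]
  refine ⟨?_, ?_, ?_⟩ <;> constructor <;> intro <;> linarith

/-- The model for the points that do not lie on the disks spanned by the arcs of the tangle. -/
noncomputable def cornerModel : ChartModel where
  coord := cornerCoord
  point := cornerPoint
  range := {n | ∑ i, n i = 0}
  W := ⊤
  -- The wall `y = 0` is excluded because it is a mirror of the tetrahedron but not of the group
  -- generated at `(1, 3, √2)`.
  dom := {h | h ∈ polyhedron ∧ h.1 1 ≠ 0}
  coord_mem := cornerCoord_sum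
  point_coord := cornerPoint_cornerCoord
  coord_point _ hn := cornerCoord_cornerPoint hn
  continuous_coord := continuous_cornerCoord
  continuousOn_point := continuous_cornerPoint.continuousOn
  comp_mem n hn w _ := (Equiv.sum_comp w n).trans hn
  isom n hn n' hn' w _ := by
    have e1 : ∑ i, (n ∘ w) i = 0 := (Equiv.sum_comp w n).trans hn
    have e2 : ∑ i, (n' ∘ w) i = 0 := (Equiv.sum_comp w n').trans hn'
    rw [hdist_eq_hdist_iff, cosh_hdist_cornerPoint e1 e2, cosh_hdist_cornerPoint hn hn', time, time,
      time, time, sum_comp_perm n w (fun x => x ^ 2), sum_comp_perm n' w (fun x => x ^ 2)]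
    congr 2
    exact Equiv.sum_comp w fun i => n i * n' i
  contr n hn n' hn' w _ w' _ h h' := by
    have e1 : ∑ i, (n ∘ w) i = 0 := (Equiv.sum_comp w n).trans hn
    have e2 : ∑ i, (n' ∘ w') i = 0 := (Equiv.sum_comp w' n').trans hn'
    rw [hdist_le_hdist_iff, cosh_hdist_cornerPoint e1 e2, cosh_hdist_cornerPoint hn hn', time, time,
      time, time, sum_comp_perm n w (fun x => x ^ 2), sum_comp_perm n' w' (fun x => x ^ 2)]
    -- The rearrangement inequality: the sum of products is largest when both tuples are sorted, and
    -- a larger sum means a smaller distance.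
    have h1 := (h.monovary h').sum_mul_comp_perm_le_sum_mul (σ := w'⁻¹ * w)
    have h2 : ∑ i, (n ∘ w) i * (n' ∘ w') ((w'⁻¹ * w) i) = ∑ i, n i * n' i := by
      rw [← Equiv.sum_comp w fun i => n i * n' i]
      simp
    rw [h2] at h1
    linarith
  dom_subset h hh := hh.1
  dom_open h hh := by
    filter_upwards [(continuous_coord 1).continuousAt.eventually_ne hh.2] with h' h1 h2
    exact ⟨h2, h1⟩
  monotone_coord h hh := by
    obtain ⟨⟨⟨-, h1⟩, ⟨-, h2⟩, -, h3⟩, -⟩ := hh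
    exact (monotone_cornerCoord_iff h).2 ⟨h1, h3, h2⟩
  walls h hh := by
    obtain ⟨c1, c2, c3⟩ := cornerCoord_eq_iff h
    obtain ⟨-, w1, w2, w3⟩ := ofPoly_walls hh.1
    obtain ⟨⟨⟨-, h1⟩, ⟨-, h2⟩, -, h3⟩, h4⟩ := id hh
    refine eq_iff_eq_of_monotone (ofPoly_mem hh.1).1.1
      ((monotone_cornerCoord_iff h).2 ⟨h1, h3, h2⟩) (c1.trans w1.symm) (c2.trans w2.symm) ?_
    rw [c3, w3, or_iff_right h4]
  block _ _ _ _ _ _ := Subgroup.mem_top _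

/-- The permutations that preserve the decomposition of the vertices into two pairs. -/
def pairStabilizer : Subgroup (Equiv.Perm (Fin 4)) where
  carrier := {w | ∀ i, w i < 2 ↔ i < 2}
  one_mem' _ := Iff.rfl
  mul_mem' {a b} ha hb i := (ha (b i)).trans (hb i)
  inv_mem' {a} ha i := by
    have := ha (a⁻¹ i)
    rw [show a (a⁻¹ i) = i from a.apply_symm_apply i] at this
    exact this.symm

theorem pairStabilizer_cases {w : Equiv.Perm (Fin 4)} (hw : w ∈ pairStabilizer) :
    (w 0 = 0 ∧ w 1 = 1 ∨ w 0 = 1 ∧ w 1 = 0) ∧ (w 2 = 2 ∧ w 3 = 3 ∨ w 2 = 3 ∧ w 3 = 2) := by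
  have h : ∀ i, w i < 2 ↔ i < 2 := hw
  have h0 := (h 0).2 (by decide)
  have h1 := (h 1).2 (by decide)
  have h2 := mt (h 2).1 (by decide)
  have h3 := mt (h 3).1 (by decide)
  have n1 : w 0 ≠ w 1 := w.injective.ne (by decide)
  have n2 : w 2 ≠ w 3 := w.injective.ne (by decide)
  omega

/-- Coordinates in which the walls of the polyhedron at infinity are coordinate planes. -/
noncomputable def arcCoord (h : UpperHalfSpace) : Fin 4 → ℝ :=
  -- Swapping the first two entries is the reflection in `x = 1`, swapping the last two the
  -- reflection in `y = 0`. The constant `5` keeps the two pairs apart over the polyhedron: `1 - x ≤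
  -- 1 < 2 ≤ 5 - y`.
  ![(h.1 0 - 1) / h.1 2, (1 - h.1 0) / h.1 2, (5 - h.1 1) / h.1 2, (5 + h.1 1) / h.1 2]

/-- The inverse of `arcCoord`. -/
noncomputable def arcPoint (n : Fin 4 → ℝ) : UpperHalfSpace :=
  ofCoords (1 + n 0 * (10 / (n 2 + n 3))) ((n 3 - n 2) / 2 * (10 / (n 2 + n 3)))
    (10 / (n 2 + n 3))

theorem arcPoint_coords {n : Fin 4 → ℝ} (hn : 0 < n 2 + n 3) :
    (arcPoint n).1 0 = 1 + n 0 * (10 / (n 2 + n 3)) ∧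
    (arcPoint n).1 1 = (n 3 - n 2) / 2 * (10 / (n 2 + n 3)) ∧
    (arcPoint n).1 2 = 10 / (n 2 + n 3) :=
  ⟨ofCoords_zero _ _ _, ofCoords_one _ _ _, ofCoords_two _ _ (by positivity)⟩

theorem arcPoint_arcCoord (h : UpperHalfSpace) : arcPoint (arcCoord h) = h := by
  have hz := h.2
  have e : arcCoord h 2 + arcCoord h 3 = 10 / h.1 2 := by
    simp only [arcCoord, Matrix.cons_val]
    field_simp
    ring
  obtain ⟨h0, h1, h2⟩ := arcPoint_coords (n := arcCoord h) (by rw [e]; positivity)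
  rw [e] at h0 h1 h2
  refine ext_coords ?_ ?_ ?_
  · rw [h0]
    simp only [arcCoord, Matrix.cons_val_zero]
    field_simp
    ring
  · rw [h1]
    simp only [arcCoord, Matrix.cons_val]
    field_simp
    ring
  · rw [h2]
    field_simp

theorem arcCoord_arcPoint {n : Fin 4 → ℝ} (h01 : n 0 + n 1 = 0) (hn : 0 < n 2 + n 3) :
    arcCoord (arcPoint n) = n := by
  obtain ⟨h0, h1, h2⟩ := arcPoint_coords hn
  have e : n 1 = -n 0 := by linarith
  ext i
  fin_cases i <;>
    simp only [arcCoord, h0, h1, h2, Matrix.cons_val_zero, Matrix.cons_val_one, Matrix.cons_val,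
      Fin.zero_eta, Fin.mk_one, Fin.reduceFinMk] <;>
    field_simp <;> first | (rw [e]; ring) | ring

theorem arcPoint_comp {n : Fin 4 → ℝ} (h01 : n 0 + n 1 = 0) (hn : 0 < n 2 + n 3)
    {w : Equiv.Perm (Fin 4)} (hw : w ∈ pairStabilizer) :
    ((n ∘ w) 0 + (n ∘ w) 1 = 0 ∧ (n ∘ w) 2 + (n ∘ w) 3 = n 2 + n 3) ∧
    (w 0 = 0 ∧ (arcPoint (n ∘ w)).1 0 = (arcPoint n).1 0 ∨
      w 0 = 1 ∧ (arcPoint (n ∘ w)).1 0 = 2 - (arcPoint n).1 0) ∧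
    (w 2 = 2 ∧ (arcPoint (n ∘ w)).1 1 = (arcPoint n).1 1 ∨
      w 2 = 3 ∧ (arcPoint (n ∘ w)).1 1 = -(arcPoint n).1 1) ∧
    (arcPoint (n ∘ w)).1 2 = (arcPoint n).1 2 := by
  have e : n 1 = -n 0 := by linarith
  obtain ⟨h1, h2⟩ := pairStabilizer_cases hw
  have s1 : (n ∘ w) 0 + (n ∘ w) 1 = 0 := by
    rcases h1 with ⟨a, b⟩ | ⟨a, b⟩ <;> simp only [Function.comp_apply, a, b] <;> linarith
  have s2 : (n ∘ w) 2 + (n ∘ w) 3 = n 2 + n 3 := by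
    rcases h2 with ⟨a, b⟩ | ⟨a, b⟩ <;> simp only [Function.comp_apply, a, b]
    ring
  obtain ⟨p0, p1, p2⟩ := arcPoint_coords hn
  obtain ⟨q0, q1, q2⟩ := arcPoint_coords (n := n ∘ w) (by rw [s2]; exact hn)
  rw [s2] at q0 q1 q2
  refine ⟨⟨s1, s2⟩, ?_, ?_, q2.trans p2.symm⟩
  · rcases h1 with ⟨a, b⟩ | ⟨a, b⟩
    · exact Or.inl ⟨a, by rw [q0, p0, Function.comp_apply, a]⟩
    · exact Or.inr ⟨a, by rw [q0, p0, Function.comp_apply, a, e]; ring⟩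
  · rcases h2 with ⟨a, b⟩ | ⟨a, b⟩
    · exact Or.inl ⟨a, by rw [q1, p1, Function.comp_apply, Function.comp_apply, a, b]⟩
    · exact Or.inr ⟨a, by rw [q1, p1, Function.comp_apply, Function.comp_apply, a, b]; ring⟩

theorem hdist_le_hdist_of_coords {p q p' q' : UpperHalfSpace} (hp : p.1 2 = p'.1 2)
    (hq : q.1 2 = q'.1 2) (h0 : (p.1 0 - q.1 0) ^ 2 ≤ (p'.1 0 - q'.1 0) ^ 2)
    (h1 : (p.1 1 - q.1 1) ^ 2 ≤ (p'.1 1 - q'.1 1) ^ 2) : hdist p q ≤ hdist p' q' := by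
  have hp' := p'.2
  have hq' := q'.2
  rw [hdist_le_hdist_iff, cosh_hdist_eq_one_add, cosh_hdist_eq_one_add, dist_sq, dist_sq, hp, hq]
  gcongr

theorem monotone_arcCoord_iff (h : UpperHalfSpace) : Monotone (arcCoord h) ↔
    h.1 0 ≤ 1 ∧ 1 - h.1 0 ≤ 5 - h.1 1 ∧ 0 ≤ h.1 1 := by
  have hz := h.2
  rw [monotone_iff]
  simp only [arcCoord, Matrix.cons_val_zero, Matrix.cons_val_one, Matrix.cons_val,
    div_le_div_iff_of_pos_right hz]
  refine and_congr ?_ (and_congr ?_ ?_) <;> constructor <;> intro <;> linarith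

theorem continuousOn_arcPoint : ContinuousOn arcPoint {n | n 0 + n 1 = 0 ∧ 0 < n 2 + n 3} := by
  have h : ContinuousOn (fun n : Fin 4 → ℝ => 10 / (n 2 + n 3))
      {n | n 0 + n 1 = 0 ∧ 0 < n 2 + n 3} :=
    ContinuousOn.div (by fun_prop) (by fun_prop) fun n hn => hn.2.ne'
  exact continuousOn_ofCoords (by fun_prop) (by fun_prop) h fun n hn =>
    div_pos (by norm_num) hn.2

theorem continuous_arcCoord : Continuous arcCoord := by
  refine continuous_pi fun i => ?_
  have h : ∀ h : UpperHalfSpace, h.1 2 ≠ 0 := fun h => h.2.ne'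
  fin_cases i <;> exact Continuous.div (by fun_prop) (by fun_prop) h

theorem sub_sq_le_of_reflect {a b a' b' : ℝ} (ha : 0 ≤ a) (hb : 0 ≤ b) (h : a = a' ∨ a = -a')
    (h' : b = b' ∨ b = -b') : (a - b) ^ 2 ≤ (a' - b') ^ 2 := by
  rcases h with rfl | rfl <;> rcases h' with rfl | rfl <;> nlinarith

/-- The model for the points near the disks spanned by the arcs of the tangle. -/
noncomputable def arcModel : ChartModel where
  coord := arcCoord
  point := arcPoint
  range := {n | n 0 + n 1 = 0 ∧ 0 < n 2 + n 3}
  W := pairStabilizer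
  -- The excluded walls are the mirrors `y = 3` and `|p|² = 4y`, which do not belong to the group
  -- generated by the reflections in `x = 1` and `y = 0`.
  dom := {h | h ∈ polyhedron ∧ h.1 1 < 3 ∧ 4 * h.1 1 < normSq h}
  coord_mem h := by
    have hz := h.2
    constructor
    · simp only [arcCoord, Matrix.cons_val_zero, Matrix.cons_val_one]
      ring
    · simp only [arcCoord, Matrix.cons_val]
      rw [← add_div, show 5 - h.1 1 + (5 + h.1 1) = 10 by ring]
      positivity
  point_coord := arcPoint_arcCoord
  coord_point _ hn := arcCoord_arcPoint hn.1 hn.2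
  continuous_coord := continuous_arcCoord
  continuousOn_point := continuousOn_arcPoint
  comp_mem n hn w hw := by
    obtain ⟨⟨h1, h2⟩, -⟩ := arcPoint_comp hn.1 hn.2 hw
    exact ⟨h1, by rw [h2]; exact hn.2⟩
  isom n hn n' hn' w hw := by
    obtain ⟨-, x, y, z⟩ := arcPoint_comp hn.1 hn.2 hw
    obtain ⟨-, x', y', z'⟩ := arcPoint_comp hn'.1 hn'.2 hw
    have hx : ((arcPoint (n ∘ w)).1 0 - (arcPoint (n' ∘ w)).1 0) ^ 2 =
        ((arcPoint n).1 0 - (arcPoint n').1 0) ^ 2 := by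
      rcases x with ⟨a, x⟩ | ⟨a, x⟩ <;> rcases x' with ⟨b, x'⟩ | ⟨b, x'⟩ <;>
        first | exact absurd (a.symm.trans b) (by decide) | (simp only [x, x']; done) | (simp only [x, x']; ring)
    have hy : ((arcPoint (n ∘ w)).1 1 - (arcPoint (n' ∘ w)).1 1) ^ 2 =
        ((arcPoint n).1 1 - (arcPoint n').1 1) ^ 2 := by
      rcases y with ⟨a, y⟩ | ⟨a, y⟩ <;> rcases y' with ⟨b, y'⟩ | ⟨b, y'⟩ <;>
        first | exact absurd (a.symm.trans b) (by decide) | (simp only [y, y']; done) | (simp only [y, y']; ring)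
    exact le_antisymm (hdist_le_hdist_of_coords z z' hx.le hy.le)
      (hdist_le_hdist_of_coords z.symm z'.symm hx.ge hy.ge)
  contr n hn n' hn' w hw w' hw' h h' := by
    obtain ⟨⟨s1, s2⟩, x, y, z⟩ := arcPoint_comp hn.1 hn.2 hw
    obtain ⟨⟨s1', s2'⟩, x', y', z'⟩ := arcPoint_comp hn'.1 hn'.2 hw'
    rw [← arcCoord_arcPoint s1 (by rw [s2]; exact hn.2), monotone_arcCoord_iff] at h
    rw [← arcCoord_arcPoint s1' (by rw [s2']; exact hn'.2), monotone_arcCoord_iff] at h'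
    refine hdist_le_hdist_of_coords z z' ?_ ?_
    · have := sub_sq_le_of_reflect (a := 1 - (arcPoint (n ∘ w)).1 0)
        (b := 1 - (arcPoint (n' ∘ w')).1 0) (a' := 1 - (arcPoint n).1 0)
        (b' := 1 - (arcPoint n').1 0) (by linarith) (by linarith)
        (x.imp (fun h => by linarith [h.2]) fun h => by linarith [h.2])
        (x'.imp (fun h => by linarith [h.2]) fun h => by linarith [h.2])
      nlinarith
    · exact sub_sq_le_of_reflect h.2.2 h'.2.2 (y.imp And.right And.right)
        (y'.imp And.right And.right)
  dom_subset h hh := hh.1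
  dom_open h hh := by
    filter_upwards [(continuous_coord 1).continuousAt.eventually (gt_mem_nhds hh.2.1),
      ((continuous_const.mul (continuous_coord 1)).continuousAt.eventually_lt
        continuous_normSq.continuousAt hh.2.2)] with h' h1 h2 h3
    exact ⟨h3, h1, h2⟩
  monotone_coord h hh := by
    obtain ⟨⟨⟨h1, h2⟩, ⟨h3, h4⟩, -, h5⟩, -⟩ := hh
    exact (monotone_arcCoord_iff h).2 ⟨h2, by linarith, h3⟩
  walls h hh := by
    obtain ⟨-, w1, w2, w3⟩ := ofPoly_walls hh.1
    obtain ⟨⟨⟨h1, h2⟩, ⟨h3, h4⟩, -, h5⟩, h6, h7⟩ := id hh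
    have hz := h.2
    refine eq_iff_eq_of_monotone (ofPoly_mem hh.1).1.1
      ((monotone_arcCoord_iff h).2 ⟨h2, by linarith, h3⟩) ?_ ?_ ?_
    · rw [w1]
      simp only [arcCoord, Matrix.cons_val_zero, Matrix.cons_val_one, div_left_inj' hz.ne']
      constructor <;> intro <;> linarith
    · rw [w2]
      simp only [arcCoord, Matrix.cons_val_one, Matrix.cons_val, div_left_inj' hz.ne']
      constructor <;> intro <;> linarith
    · rw [w3, or_iff_left h6.ne]
      simp only [arcCoord, Matrix.cons_val, div_left_inj' hz.ne']
      constructor <;> intro <;> linarith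
  block h hh n hn w hw := by
    obtain ⟨⟨⟨h1, h2⟩, ⟨h3, h4⟩, -, h5⟩, h6, h7⟩ := hh
    have hz := h.2
    have e : ∀ i, n i = arcCoord h (w⁻¹ i) := fun i => by rw [← hw]; simp
    have h01 := hn.1
    rw [e, e] at h01
    have hne : w⁻¹ 0 ≠ w⁻¹ 1 := (w⁻¹).injective.ne (by decide)
    -- The first two entries of `arcCoord h` are the only two with sum zero.
    have key : w⁻¹ 0 < 2 ∧ w⁻¹ 1 < 2 := by
      generalize w⁻¹ 0 = i at *
      generalize w⁻¹ 1 = j at *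
      fin_cases i <;> fin_cases j <;> simp [arcCoord] at h01 hne ⊢ <;>
        (rw [← add_div, div_eq_zero_iff, or_iff_left hz.ne'] at h01; linarith)
    rw [← pairStabilizer.inv_mem_iff]
    intro i
    have a0 : i ≠ 0 → w⁻¹ i ≠ w⁻¹ 0 := fun hi => (w⁻¹).injective.ne hi
    have a1 : i ≠ 1 → w⁻¹ i ≠ w⁻¹ 1 := fun hi => (w⁻¹).injective.ne hi
    by_cases hi0 : i = 0
    · rw [hi0]; exact iff_of_true key.1 (by decide)
    by_cases hi1 : i = 1
    · rw [hi1]; exact iff_of_true key.2 (by decide)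
    have := a0 hi0
    have := a1 hi1
    omega

end TetTangle

namespace TetTangle

open UpperHalfSpace Filter Topology

/-! ### The walls through a point of the boundary -/

/-- Half-spaces whose intersection is the image of the developing map near a point `k` of the
polyhedron: one for each of the barycentric coordinates that vanish at `k`. -/
structure LocalSides (m : ChartModel) (k : UpperHalfSpace) where
  side : Fin 4 → HypHalfSpace
  dom_iff : ∀ᶠ h in 𝓝 k, Monotone (m.coord h) →
    (h ∈ m.dom ↔ (ofPoly k 0 = 0 → (side 0).fn h ≤ 0))
  wall : ofPoly k 0 = 0 → ∀ᶠ h in 𝓝 k, h ∈ m.dom → (ofPoly h 0 = 0 ↔ (side 0).fn h = 0)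
  -- Dividing by the height turns the defining function into a linear functional on the hyperboloid,
  -- the form in which half-spaces can be compared under isometries.
  inv : ofPoly k 0 = 0 → ∀ w ∈ m.W, m.coord k ∘ w = m.coord k → ∀ h,
    (side 0).fn (m.point (m.coord h ∘ w)) / (m.point (m.coord h ∘ w)).1 2 =
      (side (w 0)).fn h / h.1 2
  -- The half-space of the smallest coordinate is thus the most restrictive one, so the single wall
  -- of the polyhedron accounts for all faces through the point.
  mono : ∀ i j, ofPoly k i = 0 → ofPoly k j = 0 → ∃ c : ℝ, 0 < c ∧ ∀ h,
    (side i).fn h / h.1 2 - (side j).fn h / h.1 2 = c * (m.coord h j - m.coord h i)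
  orth : ∀ i j, i ≠ j → ofPoly k i = 0 → ofPoly k j = 0 →
    (side i).b * (side j).b + (side i).c * (side j).c =
      2 * ((side i).a * (side j).d + (side j).a * (side i).d)

theorem cornerModel_mem_dom_iff {k : UpperHalfSpace} (hk : k ∈ cornerModel.dom) :
    ∀ᶠ h in 𝓝 k, Monotone (cornerModel.coord h) →
      (h ∈ cornerModel.dom ↔ 0 ≤ h.1 0 ∧ slope * h.1 0 ≤ normSq h) := by
  have hY : 0 < k.1 1 := lt_of_le_of_ne hk.1.2.1.1 (Ne.symm hk.2)
  filter_upwards [(continuous_coord 1).continuousAt.eventually (lt_mem_nhds hY)] with h h1 hm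
  obtain ⟨a, b, c⟩ := (monotone_cornerCoord_iff h).1 hm
  exact ⟨fun h => ⟨h.1.1.1, h.1.2.2.1⟩, fun h2 => ⟨⟨⟨h2.1, a⟩, ⟨h1.le, c⟩, h2.2, b⟩, h1.ne'⟩⟩

theorem arcModel_mem_dom_iff {k : UpperHalfSpace} (hk : k ∈ arcModel.dom) :
    ∀ᶠ h in 𝓝 k, Monotone (arcModel.coord h) →
      (h ∈ arcModel.dom ↔ 0 ≤ h.1 0 ∧ slope * h.1 0 ≤ normSq h) := by
  filter_upwards [(continuous_coord 1).continuousAt.eventually (gt_mem_nhds hk.2.1),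
      ((continuous_const.mul (continuous_coord 1)).continuousAt.eventually_lt
        continuous_normSq.continuousAt hk.2.2)] with h h1 h2 hm
  obtain ⟨a, b, c⟩ := (monotone_arcCoord_iff h).1 hm
  exact ⟨fun h => ⟨h.1.1.1, h.1.2.2.1⟩, fun h3 => ⟨⟨⟨h3.1, a⟩, ⟨c, h1.le⟩, h3.2, h2.le⟩, h1, h2⟩⟩

/-- The half-space `0 ≤ x`. -/
noncomputable def arcSide : HypHalfSpace where
  a := 0
  b := -1
  c := 0
  d := 0
  discr_pos := by norm_num

theorem arcSide_fn (h : UpperHalfSpace) : arcSide.fn h = -h.1 0 := by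
  simp [HypHalfSpace.fn, arcSide]

theorem sqrt_two_bounds : 1.41 < √2 ∧ √2 < 1.42 :=
  ⟨Real.lt_sqrt_of_sq_lt (by norm_num), (Real.sqrt_lt' (by norm_num)).2 (by norm_num)⟩

/-- The half-spaces bounded by the hemisphere `slope * x = x² + y² + z²` and by its mirror images
in the walls of the center of the tetrahedron. -/
noncomputable def cornerSide : Fin 4 → HypHalfSpace :=
  ![{ a := -1
      b := 4 - 2 * √2
      c := 0
      d := 0
      discr_pos := by have := sqrt_two_bounds; nlinarith },
    { a := -1
      b := 2 * √2
      c := 0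
      d := -(4 * √2 - 4)
      discr_pos := by have := sqrt_two_bounds; have := sqrt_two_sq; nlinarith },
    { a := -√2
      b := 2 * √2
      c := 4 * (√2 - 1)
      d := -(4 * √2 - 4)
      discr_pos := by have := sqrt_two_bounds; have := sqrt_two_sq; nlinarith },
    arcSide]

theorem cornerSide_fn (h : UpperHalfSpace) :
    (cornerSide 0).fn h = slope * h.1 0 - normSq h ∧
    (cornerSide 1).fn h = 2 * √2 * h.1 0 - normSq h - (4 * √2 - 4) ∧
    (cornerSide 2).fn h = 2 * √2 * h.1 0 - √2 * normSq h + 4 * (√2 - 1) * h.1 1 -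
      (4 * √2 - 4) := by
  simp only [HypHalfSpace.fn, cornerSide, Matrix.cons_val_zero, Matrix.cons_val_one,
    Matrix.cons_val, normSq, slope]
  refine ⟨by ring, by ring, by ring⟩

theorem cornerSide_orth {i j : Fin 4} (hi : i ≠ 3) (hj : j ≠ 3) (h : i ≠ j) :
    (cornerSide i).b * (cornerSide j).b + (cornerSide i).c * (cornerSide j).c =
      2 * ((cornerSide i).a * (cornerSide j).d + (cornerSide j).a * (cornerSide i).d) := by
  have := sqrt_two_sq
  fin_cases i <;> fin_cases j <;>
    simp only [cornerSide, Fin.zero_eta, Fin.mk_one, Fin.reduceFinMk, Matrix.cons_val_zero,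
      Matrix.cons_val_one, Matrix.cons_val, ne_eq, not_true_eq_false] at hi hj h ⊢ <;>
    nlinarith

/-- Only the time and the entries with indices `3` and `j` occur, so permutations that fix `3`
permute the three half-spaces. -/
theorem cornerSide_fn_div {j : Fin 4} (hj : j ≠ 3) (h : UpperHalfSpace) :
    (cornerSide j).fn h / h.1 2 = -((4 * √2 + 2) * time (cornerCoord h) -
      12 * cornerCoord h 3 + (4 * √2 - 4) * cornerCoord h j) := by
  have hz := h.2
  have hs := sqrt_two_sq
  obtain ⟨h0, h1, h2⟩ := cornerSide_fn h
  have e : time (cornerCoord h) = √2 * ((normSq h + 12) / 2 - h.1 0 - 3 * h.1 1) / (2 * h.1 2) := by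
    rw [time_cornerCoord, div_eq_div_iff (by positivity) (by positivity)]
    linear_combination (-((normSq h + 12) / 2 - h.1 0 - 3 * h.1 1) * h.1 2) * hs
  rw [e]
  fin_cases j <;>
    simp only [Fin.zero_eta, Fin.mk_one, Fin.reduceFinMk, h0, h1, h2, cornerCoord,
      Matrix.cons_val_zero, Matrix.cons_val_one, Matrix.cons_val, slope, ne_eq,
      not_true_eq_false] at hj ⊢
  all_goals
    field_simp
    linear_combination (16 * (normSq h + 12 - 2 * h.1 0 - 6 * h.1 1)) * hs

/-- Only the time and the first entry occur, so permutations that fix `0` preserve the plane `x =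
0`. -/
theorem coord_zero_div (h : UpperHalfSpace) :
    h.1 0 / h.1 2 = (√2 * time (cornerCoord h) + 4 * cornerCoord h 0) / 2 := by
  have hz := h.2
  rw [time_cornerCoord]
  simp only [cornerCoord, Matrix.cons_val_zero]
  field_simp
  ring

theorem time_comp_perm (n : Fin 4 → ℝ) (w : Equiv.Perm (Fin 4)) : time (n ∘ w) = time n := by
  rw [time, time, sum_comp_perm n w (fun x => x ^ 2)]

end TetTangle

/-! ### The faces of the tetrahedron in the developed image -/

namespace TetTangle

open UpperHalfSpace Filter Topology

theorem sign_iff_of_div_eq {a b c d : ℝ} (hc : 0 < c) (hd : 0 < d) (h : a / c = b / d) :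
    (a ≤ 0 ↔ b ≤ 0) ∧ (a = 0 ↔ b = 0) := by
  have ha : a = b / d * c := by rw [← h, div_mul_cancel₀ _ hc.ne']
  have hb : b = b / d * d := by rw [div_mul_cancel₀ _ hd.ne']
  generalize b / d = t at ha hb
  subst ha hb
  simp [hc.ne', hd.ne', mul_nonpos_iff_pos_imp_nonpos, hc.not_ge, hd.not_ge, hc.le, hd.le]

/-- On `x = 0` only one face passes through `k`, because two smallest coordinates are equal only on
`x = 1`. On the hemisphere the mirror images of its half-space serve all faces through `k`.
Elsewhere there is no face. -/
theorem exists_localSides_of_corner {m : ChartModel} {k : UpperHalfSpace} (hk : k ∈ m.dom)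
    (hdom : ∀ᶠ h in 𝓝 k, Monotone (m.coord h) →
      (h ∈ m.dom ↔ 0 ≤ h.1 0 ∧ slope * h.1 0 ≤ normSq h))
    (hA : ∀ w ∈ m.W, w 0 = 0 → ∀ h, (m.point (m.coord h ∘ w)).1 0 / (m.point (m.coord h ∘ w)).1 2 =
      h.1 0 / h.1 2)
    (hinv : 0 < k.1 0 → normSq k = slope * k.1 0 → ∀ w ∈ m.W, m.coord k ∘ w = m.coord k → ∀ h,
      (cornerSide 0).fn (m.point (m.coord h ∘ w)) / (m.point (m.coord h ∘ w)).1 2 =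
      (cornerSide (w 0)).fn h / h.1 2)
    (hmono : 0 < k.1 0 → normSq k = slope * k.1 0 → ∀ i j, m.coord k i = m.coord k 0 →
      m.coord k j = m.coord k 0 → ∃ c : ℝ, 0 < c ∧ ∀ h,
      (cornerSide i).fn h / h.1 2 - (cornerSide j).fn h / h.1 2 =
        c * (m.coord h j - m.coord h i)) : Nonempty (LocalSides m k) := by
  have hkp := m.dom_subset hk
  obtain ⟨w0, w1, -, -⟩ := ofPoly_walls hkp
  obtain ⟨⟨kX, kX'⟩, -, kA, -⟩ := id hkp
  have hcell := (ofPoly_mem hkp).1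
  have hn0 : 0 < normSq k := normSq_pos k
  have hzero : ∀ i, ofPoly k i = 0 → ofPoly k 0 = 0 := fun i hi =>
    le_antisymm (hi ▸ hcell.1 (Fin.zero_le i)) hcell.2.1
  have hcoord : ∀ i, ofPoly k i = 0 → m.coord k i = m.coord k 0 := fun i hi => by
    rw [m.walls _ hk, hi, hzero i hi]
  have hX := (continuous_coord 0).continuousAt (x := k)
  have hQ : ContinuousAt (fun h : UpperHalfSpace => slope * h.1 0) k := continuousAt_const.mul hX
  have hN := continuous_normSq.continuousAt (x := k)
  rcases kX.eq_or_lt with hX0 | hX0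
  · have e0 : ofPoly k 0 = 0 := w0.2 (Or.inl hX0.symm)
    have hI : ∀ i, ofPoly k i = 0 → i = 0 := by
      intro i hi
      by_contra hne
      have h1 : ofPoly k 1 = 0 := le_antisymm (hi ▸ hcell.1 (Fin.one_le_of_ne_zero hne))
        (e0 ▸ hcell.1 (Fin.zero_le 1))
      have := w1.1 (e0.trans h1.symm)
      linarith
    have hev : ∀ᶠ h in 𝓝 k, slope * h.1 0 < normSq h :=
      hQ.eventually_lt hN (by simp only [← hX0, mul_zero]; exact hn0)
    refine ⟨{
      side := fun _ => arcSide
      dom_iff := ?_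
      wall := ?_
      inv := ?_
      mono := ?_
      orth := ?_ }⟩
    · filter_upwards [hdom, hev] with h h1 h2 h3
      rw [h1 h3, arcSide_fn, neg_nonpos]
      exact ⟨fun h _ => h.1, fun h => ⟨h e0, h2.le⟩⟩
    · intro _
      filter_upwards [hev] with h h1 h2
      rw [(ofPoly_walls (m.dom_subset h2)).1, arcSide_fn, neg_eq_zero, or_iff_left h1.ne']
    · intro _ w hw hwk h
      have hw0 : w 0 = 0 := hI _ (by
        rw [← e0, ← m.walls _ hk]
        exact congrFun hwk 0)
      rw [arcSide_fn, arcSide_fn, neg_div, neg_div, hA w hw hw0]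
    · intro i j hi hj
      exact ⟨1, one_pos, fun h => by rw [hI i hi, hI j hj]; ring⟩
    · intro i j hij hi hj
      exact absurd ((hI i hi).trans (hI j hj).symm) hij
  have hevX : ∀ᶠ h : UpperHalfSpace in 𝓝 k, 0 < h.1 0 := hX.eventually (lt_mem_nhds hX0)
  by_cases hA2 : normSq k = slope * k.1 0
  · have h3 : ∀ i, ofPoly k i = 0 → i ≠ 3 := by
      rintro i hi rfl
      have h2 : ∀ j, ofPoly k j = 0 := fun j =>
        le_antisymm (hi ▸ hcell.1 (Fin.le_last j)) (hcell.2.1.trans (hcell.1 (Fin.zero_le j)))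
      have := hcell.2.2
      simp [h2] at this
    have e0 : ofPoly k 0 = 0 := w0.2 (Or.inr hA2)
    refine ⟨{
      side := cornerSide
      dom_iff := ?_
      wall := ?_
      inv := fun _ => hinv hX0 hA2
      mono := ?_
      orth := fun i j hij hi hj => cornerSide_orth (h3 i hi) (h3 j hj) hij }⟩
    · filter_upwards [hdom, hevX] with h h1 h2 h3
      rw [h1 h3, (cornerSide_fn h).1, sub_nonpos]
      exact ⟨fun h _ => h.2, fun h => ⟨h2.le, h e0⟩⟩
    · intro _
      filter_upwards [hevX] with h h1 h2
      rw [(ofPoly_walls (m.dom_subset h2)).1, (cornerSide_fn h).1, or_iff_right h1.ne', sub_eq_zero,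
        eq_comm]
    · exact fun i j hi hj => hmono hX0 hA2 i j (hcoord i hi) (hcoord j hj)
  · have e0 : ofPoly k 0 ≠ 0 := fun h => (w0.1 h).elim hX0.ne' hA2
    have hne : ∀ i, ofPoly k i ≠ 0 := fun i hi => e0 (hzero i hi)
    refine ⟨{
      side := fun _ => arcSide
      dom_iff := ?_
      wall := fun h => absurd h e0
      inv := fun h => absurd h e0
      mono := fun i j h => absurd h (hne i)
      orth := fun i j _ h => absurd h (hne i) }⟩
    filter_upwards [hdom, hevX, hQ.eventually_lt hN (lt_of_le_of_ne kA (Ne.symm hA2))]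
      with h h1 h2 h3 h4
    rw [h1 h4]
    exact ⟨fun _ h => absurd h e0, fun _ => ⟨h2.le, h3.le⟩⟩

/-- The arc model serves the wall `y = 0`, the corner model all other points. On the hemisphere the
squared norm is at most `slope`, which keeps `y` below `3` and so keeps the last coordinate apart
from the others. -/
theorem exists_localSides {k : UpperHalfSpace} (hk : k ∈ polyhedron) :
    ∃ m : ChartModel, k ∈ m.dom ∧ Nonempty (LocalSides m k) := by
  have hs := slope_bounds
  have hpos := normSq_pos k
  obtain ⟨⟨kX, kX'⟩, ⟨kY, kY'⟩, kA, kD⟩ := id hk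
  by_cases hY : k.1 1 = 0
  · have hkd : k ∈ arcModel.dom := ⟨hk, by rw [hY]; norm_num, by rw [hY, mul_zero]; exact hpos⟩
    refine ⟨arcModel, hkd, exists_localSides_of_corner hkd (arcModel_mem_dom_iff hkd) ?_ ?_ ?_⟩
    · intro w hw hw0 h
      have h1 : arcCoord h 0 + arcCoord h 1 = 0 := (arcModel.coord_mem h).1
      have h2 : 0 < arcCoord h 2 + arcCoord h 3 := (arcModel.coord_mem h).2
      obtain ⟨-, hx, -, hz⟩ := arcPoint_comp h1 h2 hw
      have hx' := (hx.resolve_right (by simp [hw0])).2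
      show (arcPoint (arcCoord h ∘ w)).1 0 / (arcPoint (arcCoord h ∘ w)).1 2 = _
      rw [hx', hz, arcPoint_arcCoord]
    · intro _ _ w hw _ h
      have h1 : arcCoord h 0 + arcCoord h 1 = 0 := (arcModel.coord_mem h).1
      have h2 : 0 < arcCoord h 2 + arcCoord h 3 := (arcModel.coord_mem h).2
      obtain ⟨-, hx, hy, hz⟩ := arcPoint_comp h1 h2 hw
      show (cornerSide 0).fn (arcPoint (arcCoord h ∘ w)) / (arcPoint (arcCoord h ∘ w)).1 2 = _
      have hy' : (arcPoint (arcCoord h ∘ w)).1 1 ^ 2 = (arcPoint (arcCoord h)).1 1 ^ 2 := by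
        rcases hy with ⟨-, hy⟩ | ⟨-, hy⟩
        · exact congrArg (· ^ 2) hy
        · exact (congrArg (· ^ 2) hy).trans (neg_sq _)
      rw [arcPoint_arcCoord] at hz hy'
      obtain ⟨f0, f1, -⟩ := cornerSide_fn h
      rcases hx with ⟨hw0, hx⟩ | ⟨hw0, hx⟩
      · rw [arcPoint_arcCoord] at hx
        rw [(cornerSide_fn _).1, hw0, f0, normSq, hx, hy', hz, normSq]
      · rw [arcPoint_arcCoord] at hx
        rw [(cornerSide_fn _).1, hw0, f1, normSq, hx, hy', hz, normSq, slope]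
        ring
    · intro _ _
      have hI : ∀ i, arcModel.coord k i = arcModel.coord k 0 → i = 0 ∨ i = 1 := by
        intro i hi
        have hz := k.2
        change arcCoord k i = arcCoord k 0 at hi
        fin_cases i <;> simp only [Fin.zero_eta, Fin.mk_one, Fin.reduceFinMk, arcCoord,
          Matrix.cons_val_zero, Matrix.cons_val_one, Matrix.cons_val, div_left_inj' hz.ne'] at hi ⊢
        · simp
        · simp
        · linarith
        · linarith
      have key : ∀ h, (cornerSide 0).fn h / h.1 2 - (cornerSide 1).fn h / h.1 2 =
          (2 * √2 - 2) * (arcCoord h 1 - arcCoord h 0) := by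
        intro h
        have hz := h.2
        obtain ⟨f0, f1, -⟩ := cornerSide_fn h
        simp only [f0, f1, arcCoord, Matrix.cons_val_zero, Matrix.cons_val_one, slope]
        field_simp
        ring
      have hc : 0 < 2 * √2 - 2 := by linarith [sqrt_two_bounds.1]
      intro i j hi hj
      refine ⟨2 * √2 - 2, hc, fun h => ?_⟩
      change _ = (2 * √2 - 2) * (arcCoord h j - arcCoord h i)
      have := key h
      rcases hI i hi with rfl | rfl <;> rcases hI j hj with rfl | rfl <;> linarith
  · have hkd : k ∈ cornerModel.dom := ⟨hk, hY⟩
    have hI : 0 < k.1 0 → normSq k = slope * k.1 0 → ∀ i,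
        cornerModel.coord k i = cornerModel.coord k 0 → i ≠ 3 := by
      rintro _ h i hi rfl
      change cornerCoord k 3 = cornerCoord k 0 at hi
      obtain ⟨-, -, c3⟩ := cornerCoord_eq_iff k
      have hm := cornerModel.monotone_coord k hkd
      change Monotone (cornerCoord k) at hm
      have : cornerCoord k 2 = cornerCoord k 3 :=
        le_antisymm (hm (by decide)) (hi ▸ hm (Fin.zero_le 2))
      have := c3.1 this
      nlinarith
    refine ⟨cornerModel, hkd, exists_localSides_of_corner hkd (cornerModel_mem_dom_iff hkd) ?_ ?_ ?_⟩
    · intro w hw hw0 h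
      rw [coord_zero_div, coord_zero_div]
      have := cornerModel.coord_point _ (cornerModel.comp_mem _ (cornerModel.coord_mem h) w hw)
      change cornerCoord (cornerPoint (cornerCoord h ∘ w)) = cornerCoord h ∘ w at this
      change (√2 * time (cornerCoord (cornerPoint (cornerCoord h ∘ w))) +
        4 * cornerCoord (cornerPoint (cornerCoord h ∘ w)) 0) / 2 = _
      rw [this, time_comp_perm, Function.comp_apply, hw0]
    · intro h0 h1 w hw hwk h
      have hw0 : w 0 ≠ 3 := hI h0 h1 _ (congrFun hwk 0)
      -- At `k` the last coordinate is strictly the largest, so the stabilizer of the coordinates of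
      -- `k` fixes its index.
      have hw3 : w 3 = 3 := by
        obtain ⟨i, hi⟩ := w.surjective 3
        have h2 : ¬ i < 3 := by
          intro hi3
          have hm := cornerModel.monotone_coord k hkd
          have a1 : cornerModel.coord k (w i) = cornerModel.coord k i := congrFun hwk i
          have a2 : cornerModel.coord k 2 = cornerModel.coord k 3 := by
            refine le_antisymm (hm (by decide)) ?_
            rw [hi] at a1
            rw [a1]
            exact hm (by omega)
          have := (cornerCoord_eq_iff k).2.2.1 a2
          nlinarith
        obtain rfl : i = 3 := by omega
        exact hi
      have := cornerModel.coord_point _ (cornerModel.comp_mem _ (cornerModel.coord_mem h) w hw)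
      change cornerCoord (cornerPoint (cornerCoord h ∘ w)) = cornerCoord h ∘ w at this
      change (cornerSide 0).fn (cornerPoint (cornerCoord h ∘ w)) /
        (cornerPoint (cornerCoord h ∘ w)).1 2 = _
      rw [cornerSide_fn_div (by decide), cornerSide_fn_div hw0, this, time_comp_perm,
        Function.comp_apply, Function.comp_apply, hw3]
    · intro h0 h1 i j hi hj
      refine ⟨4 * √2 - 4, by linarith [sqrt_two_bounds.1], fun h => ?_⟩
      change _ = (4 * √2 - 4) * (cornerCoord h j - cornerCoord h i)
      rw [cornerSide_fn_div (hI h0 h1 i hi), cornerSide_fn_div (hI h0 h1 j hj)]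
      ring

/-- Near a point of the polyhedron, the image of the developing map is an intersection of
half-spaces, and these are the images of the faces of the tetrahedron. -/
theorem LocalSides.eventually {m : ChartModel} {k : UpperHalfSpace} (S : LocalSides m k)
    (hk : k ∈ m.dom) (g : Equiv.Perm (Fin 4)) : ∀ᶠ h in 𝓝 k,
    (h ∈ m.region ↔ ∀ j, ofPoly k j = 0 → (S.side j).fn h ≤ 0) ∧
    (h ∈ m.region → ∀ j, (ofPoly k j = 0 → (m.devInv g h (g j) = 0 ↔ (S.side j).fn h = 0)) ∧
      (ofPoly k j ≠ 0 → m.devInv g h (g j) ≠ 0)) := by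
  have hkp := m.dom_subset hk
  have hcell := (ofPoly_mem hkp).1
  have hzero : ∀ i, ofPoly k i = 0 → ofPoly k 0 = 0 := fun i hi =>
    le_antisymm (hi ▸ hcell.1 (Fin.zero_le i)) hcell.2.1
  have hnz : ∀ᶠ h in 𝓝 k, h ∈ m.dom → ∀ i, ofPoly k i ≠ 0 → ofPoly h i ≠ 0 := by
    have h1 : ∀ i, ∀ᶠ h in 𝓝[polyhedron] k, ofPoly k i ≠ 0 → ofPoly h i ≠ 0 := by
      intro i
      by_cases hi : ofPoly k i = 0
      · exact Eventually.of_forall fun h h' => absurd hi h'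
      · filter_upwards [((continuous_apply i).continuousAt.comp_continuousWithinAt
          (continuousOn_ofPoly k hkp)).eventually_ne hi] with h hh _ using hh
    filter_upwards [eventually_nhdsWithin_iff.1 (eventually_all.2 h1)] with h h2 h3
    exact h2 (m.dom_subset h3)
  have hwall : ∀ᶠ h in 𝓝 k, h ∈ m.dom → ofPoly k 0 = 0 →
      (ofPoly h 0 = 0 ↔ (S.side 0).fn h = 0) := by
    by_cases h0 : ofPoly k 0 = 0
    · filter_upwards [S.wall h0] with h h1 h2 _ using h1 h2
    · exact Eventually.of_forall fun h _ h' => absurd h' h0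
  obtain ⟨r, hr, hball⟩ := (eventually_nhds (p := k)).1 ((S.dom_iff.and hnz).and hwall)
  have hmon := (m.continuous_coord.tendsto k).eventually
    (ChartModel.eventually_monotone (m.coord k))
  have hnear : ∀ᶠ h in 𝓝 k, hdist h k < r := eventually_nhds.2 ⟨r, hr, fun q hq => hq⟩
  filter_upwards [hmon, hnear] with h h1 h2
  -- Sorting moves `h` into the model chamber by an isometry that fixes `k`. There membership in the
  -- domain depends on `S.side 0` alone.
  set σ := Tuple.sort (m.coord h)
  have hσ : Monotone (m.coord h ∘ σ) := Tuple.monotone_sort _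
  have hfix : m.coord k ∘ σ = m.coord k :=
    Tuple.unique_monotone (σ := σ) (τ := 1) (h1 σ hσ) (m.monotone_coord k hk)
  have hW : σ ∈ m.W := m.block k hk (m.coord k) (m.coord_mem k) σ hfix
  set h' := m.point (m.coord h ∘ σ) with hh'
  have hc' : m.coord h' = m.coord h ∘ σ :=
    m.coord_point _ (m.comp_mem _ (m.coord_mem h) σ hW)
  have hdist' : hdist h' k < r := by
    have := m.isom _ (m.coord_mem h) _ (m.coord_mem k) σ hW
    rw [hfix, m.point_coord, m.point_coord] at this
    exact this.trans_lt h2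
  obtain ⟨⟨hdom, hnz'⟩, hwall'⟩ := hball h' hdist'
  replace hdom := hdom (by rw [hc']; exact hσ)
  have hreg : h ∈ m.region ↔ h' ∈ m.dom := by
    refine ⟨?_, fun hd => ⟨σ, hW, hσ, hd⟩⟩
    rintro ⟨w, hw, hm, hd⟩
    rwa [Tuple.unique_monotone hm hσ] at hd
  have hz := h.2
  have hz' := h'.2
  have hE : ofPoly k 0 = 0 → (S.side 0).fn h' / h'.1 2 = (S.side (σ 0)).fn h / h.1 2 :=
    fun h0 => S.inv h0 σ hW hfix h
  have hσ0 : ofPoly k (σ 0) = ofPoly k 0 := by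
    rw [← m.walls k hk]
    exact congrFun hfix 0
  -- The index `σ 0` belongs to the smallest coordinate of `h`, so by `S.mono` its functional
  -- dominates all others.
  have hle : ∀ j, ofPoly k j = 0 → ∃ c : ℝ, 0 < c ∧ (S.side (σ 0)).fn h / h.1 2 -
      (S.side j).fn h / h.1 2 = c * (m.coord h j - m.coord h (σ 0)) ∧
      m.coord h (σ 0) ≤ m.coord h j := by
    intro j hj
    obtain ⟨c, hc, hcj⟩ := S.mono (σ 0) j (hσ0.trans (hzero j hj)) hj
    refine ⟨c, hc, hcj h, ?_⟩
    have := hσ (Fin.zero_le (σ.symm j))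
    simpa using this
  have hE0 : ofPoly k 0 = 0 → ((S.side 0).fn h' ≤ 0 ↔ (S.side (σ 0)).fn h ≤ 0) ∧
      ((S.side 0).fn h' = 0 ↔ (S.side (σ 0)).fn h = 0) := by
    intro h0
    exact sign_iff_of_div_eq hz' hz (hE h0)
  have hval : h ∈ m.region → ∀ j, m.devInv g h (g j) = ofPoly h' (σ.symm j) := by
    intro hh j
    have := (ChartModel.devInv_spec (g := g) hW hσ (hreg.1 hh)).2.2.2
    have := congrFun this (σ.symm j)
    simpa using this
  refine ⟨?_, fun hh j => ⟨fun hj => ?_, fun hj => ?_⟩⟩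
  · rw [hreg, hdom]
    constructor
    · intro hd j hj
      have h0 := hzero j hj
      have h3 := (hE0 h0).1.1 (hd h0)
      obtain ⟨c, hc, h4, h5⟩ := hle j hj
      have h6 : (S.side (σ 0)).fn h / h.1 2 ≤ 0 := div_nonpos_of_nonpos_of_nonneg h3 hz.le
      have h7 := mul_nonneg hc.le (sub_nonneg.2 h5)
      have h8 : (S.side j).fn h / h.1 2 ≤ 0 := by linarith
      by_contra hn
      exact absurd h8 (not_le.2 (div_pos (not_le.1 hn) hz))
    · exact fun H h0 => (hE0 h0).1.2 (H _ (hσ0.trans h0))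
  · have hd := hreg.1 hh
    have h0 := hzero j hj
    have hcell' := (ofPoly_mem (m.dom_subset hd)).1
    rw [hval hh]
    have h3 : ofPoly h' (σ.symm j) = ofPoly h' 0 ↔ m.coord h j = m.coord h (σ 0) := by
      rw [← m.walls h' hd, hc']
      simp
    have h4 : ofPoly h' 0 = 0 ↔ (S.side (σ 0)).fn h = 0 := (hwall' hd h0).trans (hE0 h0).2
    have h9 : (S.side (σ 0)).fn h ≤ 0 := (hE0 h0).1.1 (hdom.1 hd h0)
    obtain ⟨c, hc, h5, h6⟩ := hle j hj
    constructor
    · intro h7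
      have h8 : ofPoly h' 0 = 0 :=
        le_antisymm (h7 ▸ hcell'.1 (Fin.zero_le _)) hcell'.2.1
      rw [h3.1 (h7.trans h8.symm), h4.1 h8, sub_self, mul_zero, zero_div] at h5
      have : (S.side j).fn h / h.1 2 = 0 := by linarith
      exact (div_eq_zero_iff.1 this).resolve_right hz.ne'
    · intro h7
      rw [h7, zero_div, sub_zero] at h5
      have h10 := div_nonpos_of_nonpos_of_nonneg h9 hz.le
      have h11 := mul_nonneg hc.le (sub_nonneg.2 h6)
      have h12 : c * (m.coord h j - m.coord h (σ 0)) = 0 := by linarith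
      have h13 := (mul_eq_zero.1 h12).resolve_left hc.ne'
      rw [h12] at h5
      rw [h3.2 (by linarith)]
      exact h4.2 ((div_eq_zero_iff.1 h5).resolve_right hz.ne')
  · rw [hval hh]
    refine hnz' (hreg.1 hh) _ ?_
    have h3 : m.coord k (σ.symm j) = m.coord k j := by
      have := congrFun hfix (σ.symm j)
      simpa using this.symm
    rwa [(m.walls k hk _ _).1 h3]

end TetTangle

namespace TetTangle

open UpperHalfSpace Filter Topology

/-! ### Charts of the path metric -/

/-- At a common point of the two planes only the constant remains, so orthogonality does not depend
on the point. -/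
theorem inner_outwardNormal (H K : HypHalfSpace) (p : UpperHalfSpace) :
    inner ℝ (H.outwardNormal p) (K.outwardNormal p) = 2 * K.a * H.fn p + 2 * H.a * K.fn p +
      (H.b * K.b + H.c * K.c - 2 * (H.a * K.d + K.a * H.d)) := by
  rw [PiLp.inner_apply, Fin.sum_univ_three]
  simp [HypHalfSpace.outwardNormal, HypHalfSpace.fn]
  ring

/-- A chart of the tangle complement with the path metric. -/
structure LocalChart (p : baryComplement) where
  m : ChartModel
  g : Equiv.Perm (Fin 4)
  radius : ℝ
  side : Fin 4 → HypHalfSpace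
  radius_pos : 0 < radius
  mem_domain : p.1 ∈ m.domain g
  mem_domain_of_lt : ∀ x : baryComplement, pathDist p x < radius →
    x.1 ∈ m.domain g ∧ hdist (m.dev g x.1) (m.dev g p.1) < radius
  hdist_dev : ∀ x y : baryComplement, x.1 ∈ m.domain g → y.1 ∈ m.domain g →
    hdist (m.dev g x.1) (m.dev g p.1) < radius → hdist (m.dev g y.1) (m.dev g p.1) < radius →
    hdist (m.dev g x.1) (m.dev g y.1) = pathDist x y
  mem_region_iff : ∀ h, hdist h (m.dev g p.1) < radius →
    (h ∈ m.region ↔ ∀ i, p.1 i = 0 → (side i).fn h ≤ 0)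
  eq_zero_iff : ∀ x ∈ m.domain g, hdist (m.dev g x) (m.dev g p.1) < radius →
    ∀ i, p.1 i = 0 → (x i = 0 ↔ (side i).fn (m.dev g x) = 0)
  ne_zero : ∀ x ∈ m.domain g, hdist (m.dev g x) (m.dev g p.1) < radius →
    ∀ i, p.1 i ≠ 0 → x i ≠ 0
  orth : ∀ i j, i ≠ j → p.1 i = 0 → p.1 j = 0 →
    (side i).b * (side j).b + (side i).c * (side j).c =
      2 * ((side i).a * (side j).d + (side j).a * (side i).d)

/-- The developed image of a small ball is a ball intersected with half-spaces, hence convex, so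
geodesics between its points lift. This bounds the path distance above. Conversely a path that stays
over the domain of the model is at least as long as the distance of its developed endpoints. -/
theorem nonempty_localChart (p : baryComplement) : Nonempty (LocalChart p) := by
  obtain ⟨m, hkd, ⟨S⟩⟩ := exists_localSides (fold_mem p.2)
  set k := fold p.1 with hk
  set g := Tuple.sort p.1 with hg
  have hmono : Monotone (p.1 ∘ (g * 1 : Equiv.Perm (Fin 4))) := by
    rw [mul_one]
    exact Tuple.monotone_sort p.1
  have hpd : p.1 ∈ m.domain g := ⟨p.2, hkd, 1, m.W.one_mem, hmono⟩
  have hdev : m.dev g p.1 = k := by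
    rw [ChartModel.dev_eq p.2 hkd hmono]
    exact m.point_coord k
  have hl : ∀ j, ofPoly k j = p.1 (g j) := congrFun (ofPoly_fold p.2 (Tuple.monotone_sort p.1))
  have hl' : ∀ i, ofPoly k (g.symm i) = p.1 i := fun i => by rw [hl, Equiv.apply_symm_apply]
  obtain ⟨R, hR, hdom⟩ := eventually_nhds.1 (m.dom_open k hkd)
  obtain ⟨r, hr, hS⟩ := eventually_nhds.1 (S.eventually hkd g)
  -- The factor `1/3` deals with paths too long to be developed: from a point of the ball of radius
  -- `ρ` they have length at least `R - ρ ≥ 2ρ`, which exceeds the distance of any two points of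
  -- this ball.
  have hρ : 0 < min (R / 3) r := lt_min (by positivity) hr
  have hρR : min (R / 3) r ≤ R / 3 := min_le_left _ _
  have hρr : min (R / 3) r ≤ r := min_le_right _ _
  generalize min (R / 3) r = ρ at hρ hρR hρr
  have hk' : ∀ x ∈ m.domain g, hdist (fold x) k ≤ hdist (m.dev g x) k := fun x hx => by
    have := ChartModel.hdist_fold_le_dev hx hpd
    rwa [hdev] at this
  have hreg : ∀ h, hdist h k < ρ → (h ∈ m.region ↔ ∀ i, p.1 i = 0 → (S.side (g.symm i)).fn h ≤ 0) := by
    intro h hh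
    rw [(hS h (hh.trans_le hρr)).1]
    exact ⟨fun H i hi => H _ ((hl' i).trans hi), fun H j hj => by
      have := H (g j) ((hl j).symm.trans hj)
      rwa [Equiv.symm_apply_apply] at this⟩
  have hle : ∀ x y : baryComplement, x.1 ∈ m.domain g → y.1 ∈ m.domain g →
      hdist (m.dev g x.1) k < ρ → hdist (m.dev g y.1) k < ρ →
      Reach x y (hdist (m.dev g x.1) (m.dev g y.1)) := by
    intro x y hx hy hxk hyk
    obtain ⟨γ, hc, h0, h1, h2, h3, h4⟩ := exists_geodesic (m.dev g x.1) (m.dev g y.1)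
    refine ChartModel.reach_of_path hx hy (hdist_nonneg _ _) hc h0 h1 h2 fun t => ?_
    rw [hreg _ (h4 t k ρ hxk hyk)]
    exact fun i hi => h3 t _ _ _ _ ((hreg _ hxk).1 (ChartModel.dev_mem_region hx) i hi)
      ((hreg _ hyk).1 (ChartModel.dev_mem_region hy) i hi)
  have hdevInv : ∀ x ∈ m.domain g, hdist (m.dev g x) k < ρ → ∀ i,
      (p.1 i = 0 → (x i = 0 ↔ (S.side (g.symm i)).fn (m.dev g x) = 0)) ∧ (p.1 i ≠ 0 → x i ≠ 0) := by
    intro x hx hxk i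
    have := (hS _ (hxk.trans_le hρr)).2 (ChartModel.dev_mem_region hx) (g.symm i)
    rwa [ChartModel.devInv_dev hx, hl', Equiv.apply_symm_apply] at this
  refine ⟨{
    m := m
    g := g
    radius := ρ
    side := fun i => S.side (g.symm i)
    radius_pos := hρ
    mem_domain := hpd
    mem_domain_of_lt := ?_
    hdist_dev := ?_
    mem_region_iff := by rwa [hdev]
    eq_zero_iff := ?_
    ne_zero := ?_
    orth := fun i j hij hi hj => S.orth _ _ (g.symm.injective.ne hij) ((hl' i).trans hi)
      ((hl' j).trans hj) }⟩
  · intro x hx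
    obtain ⟨l, hlt, h⟩ := exists_reach_lt hx
    have := ChartModel.reach_dev (fun h h1 h2 => hdom h h2 h1) hk' hpd (l := l) (by rw [hdev, hdist_self]; linarith) h
    exact ⟨this.1, by rw [hdist_comm]; exact this.2.trans_lt hlt⟩
  · rw [hdev]
    intro x y hx hy hxk hyk
    have h1 := hle x y hx hy hxk hyk
    refine le_antisymm (le_pathDist fun l h => ?_) (pathDist_le h1)
    have h2 := hdist_triangle (m.dev g x.1) k (m.dev g y.1)
    rw [hdist_comm k] at h2
    by_cases hlt : hdist (m.dev g x.1) k + l < R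
    · exact (ChartModel.reach_dev (fun h h1 h2 => hdom h h2 h1) hk' hx hlt h).2
    · linarith
  · rw [hdev]
    exact fun x hx hxk i => (hdevInv x hx hxk i).1
  · rw [hdev]
    exact fun x hx hxk i => (hdevInv x hx hxk i).2

theorem eventually_subtype {x : baryComplement} {P : (Fin 4 → ℝ) → Prop}
    (h : ∀ᶠ y in 𝓝[baryComplement] x.1, P y) : ∀ᶠ y : baryComplement in 𝓝 x, P y.1 := by
  rw [nhds_subtype_eq_comap_nhdsWithin]
  exact h.comap _

theorem ChartModel.eventually_hdist_dev_lt {m : ChartModel} {g : Equiv.Perm (Fin 4)}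
    {x : baryComplement} (hx : x.1 ∈ m.domain g) {k : UpperHalfSpace} {r : ℝ}
    (h : hdist (m.dev g x.1) k < r) :
    ∀ᶠ y : baryComplement in 𝓝 x, y.1 ∈ m.domain g ∧ hdist (m.dev g y.1) k < r := by
  have h1 := continuousOn_hdist (continuousOn_dev (m := m) (g := g)) (continuousOn_const (c := k))
  have h2 := (h1 x.1 hx).eventually (gt_mem_nhds h)
  refine eventually_subtype (P := fun y => y ∈ m.domain g ∧ hdist (m.dev g y) k < r) ?_
  filter_upwards [eventually_mem_domain hx,
    (eventually_nhdsWithin_iff.1 h2).filter_mono nhdsWithin_le_nhds] with y h3 h4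
  exact ⟨h3, h4 h3⟩

/-- The path metric induces the topology of the tangle complement. -/
theorem mem_nhds_iff_pathDist (p : baryComplement) (U : Set baryComplement) :
    U ∈ 𝓝 p ↔ ∃ ε > 0, ∀ y, pathDist p y < ε → y ∈ U := by
  obtain ⟨C⟩ := nonempty_localChart p
  have hreg := ChartModel.dev_mem_region C.mem_domain
  constructor
  · intro hU
    rw [nhds_subtype_eq_comap_nhdsWithin, mem_comap] at hU
    obtain ⟨V, hV, hVU⟩ := hU
    have h1 := ChartModel.continuousOn_devInv (m := C.m) (g := C.g) _ hreg
    rw [ContinuousWithinAt, ChartModel.devInv_dev C.mem_domain] at h1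
    have h2 : ∀ᶠ h in 𝓝[C.m.region] (C.m.dev C.g p.1), C.m.devInv C.g h ∈ V ∨
        C.m.devInv C.g h ∉ baryComplement := by
      filter_upwards [h1 (mem_nhdsWithin_iff_eventually.1 hV)] with h hh
      by_cases hb : C.m.devInv C.g h ∈ baryComplement
      · exact Or.inl (hh hb)
      · exact Or.inr hb
    obtain ⟨δ, hδ, h3⟩ := eventually_nhds.1 (eventually_nhdsWithin_iff.1 h2)
    refine ⟨min δ C.radius, lt_min hδ C.radius_pos, fun y hy => hVU ?_⟩
    obtain ⟨h4, h5⟩ := C.mem_domain_of_lt y (hy.trans_le (min_le_right _ _))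
    have h6 := C.hdist_dev y p h4 C.mem_domain h5 (by rw [hdist_self]; exact C.radius_pos)
    have h7 := h3 _ (by rw [h6, pathDist_comm]; exact hy.trans_le (min_le_left _ _))
      (ChartModel.dev_mem_region h4)
    rw [ChartModel.devInv_dev h4] at h7
    exact h7.resolve_right (not_not_intro y.2)
  · rintro ⟨ε, hε, hU⟩
    have h1 := ChartModel.eventually_hdist_dev_lt (r := min ε C.radius) C.mem_domain
      (k := C.m.dev C.g p.1) (by rw [hdist_self]; exact lt_min hε C.radius_pos)
    filter_upwards [h1] with y hy
    have h6 := C.hdist_dev y p hy.1 C.mem_domain (hy.2.trans_le (min_le_right _ _))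
      (by rw [hdist_self]; exact C.radius_pos)
    refine hU y ?_
    rw [pathDist_comm, ← h6]
    exact hy.2.trans_le (min_le_left _ _)

/-- The tangle complement, with the path metric. -/
def TangleSpace : Type := baryComplement

instance : TopologicalSpace TangleSpace := inferInstanceAs (TopologicalSpace baryComplement)

noncomputable instance : MetricSpace TangleSpace :=
  -- The metric is put on the existing topology, so that `marking` needs no further proof of
  -- continuity.
  MetricSpace.ofDistTopology (α := TangleSpace) pathDist pathDist_self pathDist_comm pathDist_triangle
    (fun s => by
      rw [isOpen_iff_mem_nhds]
      exact forall₂_congr fun x _ => mem_nhds_iff_pathDist x s)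
    (fun x y h => by
      by_contra hne
      obtain ⟨ε, hε, h2⟩ := (mem_nhds_iff_pathDist x _).1
        ((isOpen_compl_singleton (X := baryComplement) (x := y)).mem_nhds hne)
      exact h2 y (h.trans_lt hε) rfl)

/-- The identification of the metric space with the tangle complement. -/
noncomputable def marking : TangleSpace ≃ₜ Complement := baryHomeomorph

theorem mem_marking_preimage {w : TangleSpace} {i : Fin 4} :
    w ∈ marking ⁻¹' boundaryFace i ↔ w.1 i = 0 := baryHomeomorph_mem_boundaryFace

theorem LocalChart.inner_eq_zero {p : baryComplement} (C : LocalChart p) {i j : Fin 4}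
    (hi : p.1 i = 0) (hj : p.1 j = 0) (h : i ≠ j) :
    inner ℝ ((C.side i).outwardNormal (C.m.dev C.g p.1))
      ((C.side j).outwardNormal (C.m.dev C.g p.1)) = 0 := by
  have hr : hdist (C.m.dev C.g p.1) (C.m.dev C.g p.1) < C.radius := by
    rw [hdist_self]
    exact C.radius_pos
  rw [inner_outwardNormal, (C.eq_zero_iff _ C.mem_domain hr i hi).1 hi,
    (C.eq_zero_iff _ C.mem_domain hr j hj).1 hj, C.orth i j h hi hj]
  ring

theorem LocalChart.outwardNormal_ne_zero {p : baryComplement} (C : LocalChart p) {i : Fin 4}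
    (hi : p.1 i = 0) : (C.side i).outwardNormal (C.m.dev C.g p.1) ≠ 0 := by
  have hr : hdist (C.m.dev C.g p.1) (C.m.dev C.g p.1) < C.radius := by
    rw [hdist_self]
    exact C.radius_pos
  intro h
  have h1 := inner_outwardNormal (C.side i) (C.side i) (C.m.dev C.g p.1)
  rw [h, inner_zero_left, (C.eq_zero_iff _ C.mem_domain hr i hi).1 hi] at h1
  linarith [(C.side i).discr_pos]

/-- The geodesic corner chart given by the developing map. -/
noncomputable def LocalChart.toCornerChart {p : TangleSpace} (C : LocalChart p) :
    GeodesicCornerChart (fun i => marking ⁻¹' boundaryFace i) p where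
  source := {x : TangleSpace | x.1 ∈ C.m.domain C.g ∧
    hdist (C.m.dev C.g x.1) (C.m.dev C.g p.1) < C.radius}
  isOpen_source := isOpen_iff_mem_nhds.2 fun x hx =>
    ChartModel.eventually_hdist_dev_lt (x := x) hx.1 hx.2
  mem_source := ⟨C.mem_domain, by rw [hdist_self]; exact C.radius_pos⟩
  toFun x := C.m.dev C.g x.1
  hdist_eq x hx y hy := C.hdist_dev x y hx.1 hy.1 hx.2 hy.2
  side i := C.side i.1
  linearIndependent := linearIndependent_of_ne_zero_of_inner_eq_zero
    (fun i => C.outwardNormal_ne_zero (mem_marking_preimage.1 i.2))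
    fun i j hij => C.inner_eq_zero (mem_marking_preimage.1 i.2) (mem_marking_preimage.1 j.2)
      (Subtype.coe_ne_coe.2 hij)
  image_eq := by
    refine ⟨{h | hdist h (C.m.dev C.g p.1) < C.radius}, ?_, ?_⟩
    · rw [isOpen_iff_mem_nhds]
      intro h hh
      have h1 : Continuous fun h => hdist h (C.m.dev C.g p.1) :=
        continuousOn_univ.1 (continuousOn_hdist continuousOn_id continuousOn_const)
      exact h1.continuousAt.eventually (gt_mem_nhds hh)
    · ext h
      constructor
      · rintro ⟨x, hx, rfl⟩
        refine ⟨hx.2, Set.mem_iInter.2 fun i => ?_⟩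
        exact (C.mem_region_iff _ hx.2).1 (ChartModel.dev_mem_region hx.1) i.1
          (mem_marking_preimage.1 i.2)
      · rintro ⟨h1, h2⟩
        rw [Set.mem_iInter] at h2
        obtain ⟨w, hw, hm, hd⟩ := (C.mem_region_iff h h1).2 fun i hi =>
          h2 ⟨i, mem_marking_preimage.2 hi⟩
        have hs := ChartModel.devInv_spec (g := C.g) hw hm hd
        exact ⟨⟨C.m.devInv C.g h, hs.1.1⟩, ⟨hs.1, by rw [hs.2.2.1]; exact h1⟩, hs.2.2.1⟩
  mem_face_iff x hx i := mem_marking_preimage.trans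
    (C.eq_zero_iff x.1 hx.1 hx.2 i.1 (mem_marking_preimage.1 i.2))
  disjoint_of_notMem i hi := Set.disjoint_left.2 fun x hx h =>
    C.ne_zero x.1 hx.1 hx.2 i (fun h => hi (mem_marking_preimage.2 h)) (mem_marking_preimage.1 h)

end TetTangle

namespace TetTangle

open UpperHalfSpace Filter Topology

/-! ### Lengths of paths and completeness -/

/-- A path that is 1-Lipschitz after folding is also 1-Lipschitz for `pathDist`, because each of its
segments joins its own endpoints in the sense of `Reach`. It is then rescaled to the unit interval.
-/
theorem exists_path_eVariationOn_le (x y : TangleSpace) {ε : ℝ} (hε : 0 < ε) :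
    ∃ γ : Path x y, eVariationOn γ Set.univ ≤ ENNReal.ofReal (dist x y + ε) := by
  obtain ⟨l, hl, h0, f, hf, h1, h2, h3⟩ :=
    exists_reach_lt (x := x) (y := y) (lt_add_of_pos_right (pathDist x y) hε)
  have hle : ∀ s t, s ≤ t → pathDist (f s) (f t) ≤ t - s := fun s t hst =>
    pathDist_le ⟨sub_nonneg.2 hst, fun u => f (s + u), by fun_prop, by simp, by simp,
      fun u v => (h3 _ _).trans_eq (by rw [add_sub_add_left_eq_sub])⟩
  let F : ℝ → TangleSpace := fun t => f (l * t)
  have hF : LipschitzOnWith l.toNNReal F Set.univ := by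
    refine LipschitzOnWith.of_dist_le_mul fun s _ t _ => ?_
    rw [Real.coe_toNNReal l h0]
    rcases le_total s t with hst | hst
    · refine (hle _ _ (mul_le_mul_of_nonneg_left hst h0)).trans_eq ?_
      rw [dist_comm, Real.dist_eq, abs_of_nonneg (sub_nonneg.2 hst), ← mul_sub]
    · rw [dist_comm]
      refine (hle _ _ (mul_le_mul_of_nonneg_left hst h0)).trans_eq ?_
      rw [Real.dist_eq, abs_of_nonneg (sub_nonneg.2 hst), ← mul_sub]
  refine ⟨⟨⟨fun t => F t, hF.continuousOn.comp_continuous continuous_subtype_val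
    fun _ => Set.mem_univ _⟩, ?_, ?_⟩, ?_⟩
  · exact (congrArg f (mul_zero l)).trans h1
  · exact (congrArg f (mul_one l)).trans h2
  · have h4 := hF.comp_eVariationOn_le (g := fun t : unitInterval => (t : ℝ)) (s := Set.univ)
      fun _ _ => Set.mem_univ _
    have h5 : eVariationOn (fun t : unitInterval => (t : ℝ)) Set.univ ≤ 1 := by
      have h6 : MonotoneOn (fun t : unitInterval => (t : ℝ)) Set.univ := fun s _ t _ h => h
      have h7 := h6.eVariationOn_eq (Set.mem_univ 0) (Set.mem_univ 1)
      have h8 : Set.univ ∩ Set.Icc (0 : unitInterval) 1 = Set.univ := by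
        ext t
        exact iff_of_true ⟨trivial, t.2.1, t.2.2⟩ trivial
      rw [h8] at h7
      rw [h7]
      simp
    refine h4.trans ((mul_le_mul_right h5 _).trans ?_)
    rw [mul_one]
    exact ENNReal.ofReal_le_ofReal hl.le

theorem isClosed_polyhedron : IsClosed polyhedron := by
  have h0 := continuous_coord 0
  have h1 := continuous_coord 1
  have h2 := continuous_normSq
  simp only [polyhedron, Set.ofPred_and]
  exact ((isClosed_le (by fun_prop) h0).inter (isClosed_le h0 (by fun_prop))).inter
    (((isClosed_le (by fun_prop) h1).inter (isClosed_le h1 (by fun_prop))).inter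
    ((isClosed_le (by fun_prop) h2).inter (isClosed_le (by fun_prop) h2)))

/-- One of the finitely many chambers contains infinitely many terms of a Cauchy sequence. Their
folds converge in the closed polyhedron, and the limit is unfolded into the same chamber. -/
instance : CompleteSpace TangleSpace := by
  refine Metric.complete_of_cauchySeq_tendsto fun u hu => ?_
  obtain ⟨σ, hσ⟩ : ∃ σ, ∃ᶠ n in atTop, Tuple.sort (u n).1 = σ := by
    by_contra hn
    simp only [not_exists, not_frequently] at hn
    obtain ⟨n, hn⟩ := (eventually_all.2 hn).exists
    exact hn _ rfl
  obtain ⟨φ, hφ, hs⟩ := extraction_of_frequently_atTop hσ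
  have hm : ∀ n, Monotone ((u (φ n)).1 ∘ σ) := fun n => by
    rw [← hs n]
    exact Tuple.monotone_sort _
  have hp : ∀ n, fold (u (φ n)).1 ∈ polyhedron := fun n => fold_mem (u (φ n)).2
  have hcau := Metric.cauchySeq_iff.1 hu
  obtain ⟨p, hp'⟩ := exists_tendsto_of_cauchy (u := fun n => fold (u (φ n)).1) fun ε hε => by
    obtain ⟨N, hN⟩ := hcau ε hε
    exact ⟨N, fun m hm n hn => (hdist_fold_le_pathDist _ _).trans_lt
      (hN _ (hm.trans (hφ.id_le m)) _ (hn.trans (hφ.id_le n)))⟩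
  have hpp : p ∈ polyhedron := isClosed_polyhedron.mem_of_tendsto hp' (Eventually.of_forall hp)
  refine ⟨⟨unfold σ p, unfold_mem σ hpp⟩,
    tendsto_nhds_of_cauchySeq_of_subseq hu hφ.tendsto_atTop (tendsto_iff_dist_tendsto_zero.2 ?_)⟩
  refine (tendsto_hdist_nhds.1 hp').congr fun n => ?_
  rw [← pathDist_unfold σ (hp n) hpp]
  change pathDist _ _ = pathDist _ _
  congr 1
  exact Subtype.ext (unfold_fold (u (φ n)).2 (hm n))

end TetTangle

/-! ### Finite volume of the cusps -/

namespace UpperHalfSpace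

open MeasureTheory

/-- Inversion in the unit hemisphere. -/
noncomputable def inversion (p : UpperHalfSpace) : UpperHalfSpace :=
  ofCoords (p.1 0 / normSq p) (p.1 1 / normSq p) (p.1 2 / normSq p)

theorem inversion_coords (p : UpperHalfSpace) : (inversion p).1 0 = p.1 0 / normSq p ∧
    (inversion p).1 1 = p.1 1 / normSq p ∧ (inversion p).1 2 = p.1 2 / normSq p ∧
    normSq (inversion p) = 1 / normSq p := by
  have h := normSq_pos p
  have h0 : (inversion p).1 0 = p.1 0 / normSq p := ofCoords_zero _ _ _
  have h1 : (inversion p).1 1 = p.1 1 / normSq p := ofCoords_one _ _ _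
  have h2 : (inversion p).1 2 = p.1 2 / normSq p := ofCoords_two _ _ (div_pos p.2 h)
  refine ⟨h0, h1, h2, ?_⟩
  have e : p.1 0 ^ 2 + p.1 1 ^ 2 + p.1 2 ^ 2 = normSq p := rfl
  rw [normSq, h0, h1, h2]
  field_simp
  exact e

theorem inversion_inversion (p : UpperHalfSpace) : inversion (inversion p) = p := by
  have h := normSq_pos p
  obtain ⟨h0, h1, h2, h3⟩ := inversion_coords p
  obtain ⟨h0', h1', h2', -⟩ := inversion_coords (inversion p)
  refine ext_coords ?_ ?_ ?_
  · rw [h0', h0, h3]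
    field_simp
  · rw [h1', h1, h3]
    field_simp
  · rw [h2', h2, h3]
    field_simp

theorem hdist_inversion (p q : UpperHalfSpace) :
    hdist (inversion p) (inversion q) = hdist p q := by
  have h := normSq_pos p
  have h' := normSq_pos q
  obtain ⟨h0, h1, h2, h3⟩ := inversion_coords p
  obtain ⟨h0', h1', h2', h3'⟩ := inversion_coords q
  have := p.2
  have := q.2
  rw [hdist_eq_hdist_iff, cosh_hdist, cosh_hdist, h0, h1, h2, h3, h0', h1', h2', h3']
  field_simp
  ring

/-- The image of a vertical prism over a square that is bounded away from the boundary at infinity,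
under a map that does not increase distances, has finite volume. -/
theorem hausdorffMeasure_image_prism_lt_top {X : Type*} [MetricSpace X] [MeasurableSpace X]
    [BorelSpace X] {c b : ℝ} (hc : 0 < c) {T : Set UpperHalfSpace}
    (hT : ∀ p ∈ T, |p.1 0| ≤ b ∧ |p.1 1| ≤ b ∧ c ≤ p.1 2) {F : UpperHalfSpace → X}
    (hF : ∀ p ∈ T, ∀ q ∈ T, dist (F p) (F q) ≤ hdist p q) : μH[3] (F '' T) < ⊤ := by
  have : (μH[3] : Measure E3).IsAddHaarMeasure := by
    have := isAddHaarMeasure_hausdorffMeasure (E := E3)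
    rwa [finrank_euclideanSpace_fin] at this
  let B : Set E3 := {p | |p 0| ≤ b ∧ |p 1| ≤ b ∧ c ≤ p 2 ∧ p 2 ≤ 2 * c}
  let v : ℕ → E3 := fun n => !₂[0, 0, c * n]
  have hB : μH[3] B < ⊤ := by
    refine Bornology.IsBounded.measure_lt_top ?_
    refine isBounded_iff_forall_norm_le.2 ⟨√(b ^ 2 + b ^ 2 + (2 * c) ^ 2), fun p hp => ?_⟩
    obtain ⟨h0, h1, h2, h3⟩ := hp
    rw [EuclideanSpace.norm_eq, Fin.sum_univ_three]
    refine Real.sqrt_le_sqrt ?_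
    simp only [Real.norm_eq_abs]
    gcongr
    rwa [abs_of_pos (hc.trans_le h2)]
  -- In the slab above height `c * (n + 1)` hyperbolic distances are at most Euclidean ones divided
  -- by this height. All slabs fit into translates of one bounded box, so the measures are bounded
  -- by a multiple of `1 / (n + 1)³`.
  let S : ℕ → Set UpperHalfSpace := fun n => T ∩ {p | c * (n + 1) ≤ p.1 2 ∧ p.1 2 ≤ c * (n + 2)}
  have hcov : F '' T ⊆ ⋃ n, F '' S n := by
    rintro _ ⟨p, hp, rfl⟩
    have h1 := (hT p hp).2.2
    have h2 : 1 ≤ p.1 2 / c := (one_le_div hc).2 h1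
    have h3 := Nat.floor_le (sub_nonneg.2 h2)
    have h4 := Nat.lt_floor_add_one (p.1 2 / c - 1)
    have e : p.1 2 = c * (p.1 2 / c) := by field_simp
    refine Set.mem_iUnion.2 ⟨⌊p.1 2 / c - 1⌋₊, p, ⟨hp, ?_, ?_⟩, rfl⟩
    · rw [e]
      refine mul_le_mul_of_nonneg_left ?_ hc.le
      rw [← e]
      linarith
    · rw [e]
      refine mul_le_mul_of_nonneg_left ?_ hc.le
      rw [← e]
      linarith
  have hS : ∀ n : ℕ, μH[3] (F '' S n) ≤
      ENNReal.ofReal ((1 / c) ^ 3 * (1 / ((n + 1 : ℕ) : ℝ) ^ 3)) * μH[3] B := by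
    intro n
    have hn : 0 < c * (n + 1) := by positivity
    have hlip : LipschitzOnWith (1 / (c * (n + 1))).toNNReal F (S n) := by
      refine LipschitzOnWith.of_dist_le_mul fun p hp q hq => ?_
      refine (hF p hp.1 q hq.1).trans ((hdist_le_dist_div hn hp.2.1 hq.2.1).trans_eq ?_)
      rw [div_eq_inv_mul, ← one_div, Real.coe_toNNReal _ (by positivity)]
      rfl
    have h1 := hlip.hausdorffMeasure_image_le (d := 3) (by norm_num)
    have h2 : μH[3] (S n) ≤ μH[3] B := by
      have e : μH[3] (Subtype.val '' S n) = μH[3] (S n) :=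
        isometry_subtype_coe.hausdorffMeasure_image (Or.inl (by norm_num)) (S n)
      rw [← e, ← measure_preimage_add μH[3] (-v n) B]
      refine measure_mono ?_
      rintro _ ⟨p, hp, rfl⟩
      obtain ⟨a0, a1, -⟩ := hT p hp.1
      obtain ⟨a2, a3⟩ := hp.2
      refine ⟨?_, ?_, ?_, ?_⟩
      · simpa [v] using a0
      · simpa [v] using a1
      · simp [v]
        linarith
      · simp [v]
        linarith
    refine h1.trans (mul_le_mul' (le_of_eq ?_) h2)
    change ENNReal.ofReal _ ^ (3 : ℝ) = _
    rw [ENNReal.ofReal_rpow_of_pos (by positivity), ← one_div_mul_one_div, ← one_div_pow, ← mul_pow]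
    norm_cast
  refine (measure_mono hcov).trans_lt ((measure_iUnion_le _).trans_lt
    ((ENNReal.tsum_le_tsum hS).trans_lt ?_))
  rw [ENNReal.tsum_mul_right]
  refine ENNReal.mul_lt_top (Summable.tsum_ofReal_lt_top (Summable.mul_left _ ?_)) hB
  exact (summable_nat_add_iff 1).2 (Real.summable_one_div_nat_pow.2 (by norm_num : 1 < 3))

end UpperHalfSpace

namespace TetTangle

open UpperHalfSpace MeasureTheory

open Classical in
/-- A copy of the polyhedron in the tangle complement. -/
noncomputable def unfoldMap (σ : Equiv.Perm (Fin 4)) (p : UpperHalfSpace) : TangleSpace :=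
  if h : p ∈ polyhedron then ⟨unfold σ p, unfold_mem σ h⟩ else ⟨center, 1, center_mem⟩

theorem unfoldMap_eq (σ : Equiv.Perm (Fin 4)) {p : UpperHalfSpace} (hp : p ∈ polyhedron) :
    unfoldMap σ p = (⟨unfold σ p, unfold_mem σ hp⟩ : baryComplement) := dif_pos hp

theorem dist_unfoldMap (σ : Equiv.Perm (Fin 4)) {p q : UpperHalfSpace} (hp : p ∈ polyhedron)
    (hq : q ∈ polyhedron) : dist (unfoldMap σ p) (unfoldMap σ q) = hdist p q := by
  rw [unfoldMap_eq σ hp, unfoldMap_eq σ hq]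
  exact pathDist_unfold σ hp hq

theorem exists_unfoldMap_eq (x : TangleSpace) : ∃ σ, ∃ p ∈ polyhedron, unfoldMap σ p = x := by
  refine ⟨Tuple.sort x.1, fold x.1, fold_mem x.2, ?_⟩
  rw [unfoldMap_eq _ (fold_mem x.2)]
  exact Subtype.ext (unfold_fold x.2 (Tuple.monotone_sort x.1))

/-- Each of the 24 copies of the polyhedron is cut at height one, which separates its two cusps.
Inversion moves the lower one to infinity. -/
theorem hausdorffMeasure_tangleSpace_lt_top [MeasurableSpace TangleSpace]
    [BorelSpace TangleSpace] : μH[3] (Set.univ : Set TangleSpace) < ⊤ := by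
  let T₁ : Set UpperHalfSpace := {p | p ∈ polyhedron ∧ 1 ≤ p.1 2}
  let T₂ : Set UpperHalfSpace := {p | inversion p ∈ polyhedron ∧ (inversion p).1 2 ≤ 1}
  have hcov : (Set.univ : Set TangleSpace) ⊆ ⋃ σ, (unfoldMap σ '' T₁ ∪
      (fun p => unfoldMap σ (inversion p)) '' T₂) := by
    intro x _
    obtain ⟨σ, p, hp, rfl⟩ := exists_unfoldMap_eq x
    refine Set.mem_iUnion.2 ⟨σ, ?_⟩
    rcases le_total 1 (p.1 2) with h | h
    · exact Or.inl ⟨p, ⟨hp, h⟩, rfl⟩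
    · refine Or.inr ⟨inversion p, ⟨?_, ?_⟩, ?_⟩
      · rwa [inversion_inversion]
      · rwa [inversion_inversion]
      · simp only [inversion_inversion]
  refine (measure_mono hcov).trans_lt ((measure_iUnion_le _).trans_lt ?_)
  rw [tsum_fintype]
  refine ENNReal.sum_lt_top.2 fun σ _ => (measure_union_le _ _).trans_lt (ENNReal.add_lt_top.2
    ⟨?_, ?_⟩)
  · refine hausdorffMeasure_image_prism_lt_top (c := 1) (b := 3) one_pos (fun p hp => ?_)
      fun p hp q hq => (dist_unfoldMap σ hp.1 hq.1).le
    obtain ⟨⟨⟨h0, h1⟩, ⟨h2, h3⟩, -⟩, h4⟩ := hp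
    refine ⟨?_, ?_, h4⟩
    · rw [abs_of_nonneg h0]
      linarith
    · rwa [abs_of_nonneg h2]
  -- By `sq_add_sq_le` the squared height is at least `0.01` times the squared norm. As the height
  -- is at most one, the same bound holds for the height itself, and the quotient is the inverted
  -- height.
  · refine hausdorffMeasure_image_prism_lt_top (c := 0.01) (b := 1) (by norm_num) (fun p hp => ?_)
      fun p hp q hq => ((dist_unfoldMap σ hp.1 hq.1).trans (hdist_inversion p q)).le
    obtain ⟨e0, e1, e2, -⟩ := inversion_coords (inversion p)
    rw [inversion_inversion] at e0 e1 e2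
    rw [e0, e1, e2]
    obtain ⟨⟨⟨h0, h1⟩, ⟨h2, h3⟩, h4, h5⟩, h6⟩ := hp
    generalize inversion p = q at *
    have hq := normSq_pos q
    have hz := q.2
    have hs := slope_bounds.1
    have h7 := sq_add_sq_le h0 h1 h2 h3 h4 h5
    have e : normSq q = q.1 0 ^ 2 + q.1 1 ^ 2 + q.1 2 ^ 2 := rfl
    refine ⟨?_, ?_, ?_⟩
    · rw [abs_of_nonneg (div_nonneg h0 hq.le), div_le_one hq]
      nlinarith
    · rw [abs_of_nonneg (div_nonneg h2 hq.le), div_le_one hq]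
      linarith
    · rw [le_div_iff₀ hq]
      nlinarith

/-- The hyperbolic structure on the complement of the tangle. -/
noncomputable def hyperbolicStructure : GeodesicHyperbolicStructure Complement boundaryFace where
  X := TangleSpace
  marking := marking
  length x y _ hε := exists_path_eVariationOn_le x y hε
  chartAt p := (nonempty_localChart p).some.toCornerChart

end TetTangle

/-- The complement of the tangle in the regular tetrahedron has a complete hyperbolic structure of
finite volume with totally geodesic faces, all of whose dihedral angles are right angles. -/
theorem proposition3p4 :
    ∃ S : GeodesicHyperbolicStructure TetTangle.Complement TetTangle.boundaryFace,
      S.IsComplete ∧ S.volume < ⊤ ∧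
      ∀ (p : TetTangle.Complement) (i j : Fin 4) (hi : p ∈ TetTangle.boundaryFace i)
        (hj : p ∈ TetTangle.boundaryFace j), i ≠ j →
        S.dihedralAngle p i j hi hj = Real.pi / 2 := by
  refine ⟨TetTangle.hyperbolicStructure, inferInstanceAs (CompleteSpace TetTangle.TangleSpace),
    ?_, fun p i j hi hj hij => ?_⟩
  · let _ : MeasurableSpace TetTangle.TangleSpace := borel _
    have : BorelSpace TetTangle.TangleSpace := ⟨rfl⟩
    exact ENNReal.mul_lt_top ENNReal.ofReal_lt_top TetTangle.hausdorffMeasure_tangleSpace_lt_top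
  · have h : ∀ k, p ∈ TetTangle.boundaryFace k → (TetTangle.marking.symm p).1 k = 0 := by
      intro k hk
      refine TetTangle.mem_marking_preimage.1 ?_
      simpa using hk
    have h1 := (TetTangle.nonempty_localChart (TetTangle.marking.symm p)).some.inner_eq_zero
      (h i hi) (h j hj) hij
    rw [InnerProductGeometry.inner_eq_zero_iff_angle_eq_pi_div_two] at h1
    change Real.pi - InnerProductGeometry.angle _ _ = _
    refine (congrArg (Real.pi - ·) h1).trans ?_
    ring
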